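/- Let $\beta>0$. Let $F=[A,B]\subseteq\mathbb R$ be an interval, $-\infty\le A<B\le\infty$, let $f=\sum_i a_iz^i\neq 0$ and $g=\sum_i b_iz^i$ be real polynomials, and let $\rho=e^{-V}$ be a positive differentiable function with $-\rho'/\rho=V'=g/f$ at all interior points of $F$ where $f\ne0$, such that $\lim_{z\to A,B}f(z)\rho(z)z^k=0$ for all $k\ge 0$. Let $E=\bigcup_{i=1}^r[c_{2i-1},c_{2i}]\subseteq F$ with $-\infty\le c_1<c_2<\dots<c_{2r}\le\infty$, and let $\rho$ be integrable on $E$. For $n\ge 0$ and $t=(t_1,t_2,\dots)$ let $$I_n=I_n(t,c;\beta)=\int_{E^n}|\Delta_n(z)|^{2\beta}\prod_{k=1}^n\Big(e^{\sum_{i\ge1}t_iz_k^i}\rho(z_k)\,dz_k\Big),\qquad I_0=1,\quad \Delta_n(z)=\prod_{1\le i<j\le n}(z_i-z_j).$$ Put $\partial/\partial t_k=0$ and $t_k=0$ for $k\le 0$, and for $k,n\in\mathbb Z$ let $J^{(0)}_k=\delta_{k0}$, $J^{(1)}_k=\frac{\partial}{\partial t_k}+\frac1{2\beta}(-k)t_{-k}$,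 $$J^{(2)}_k=\sum_{i+j=k}\frac{\partial^2}{\partial t_i\partial t_j}+\frac1\beta\sum_{-i+j=k}it_i\frac{\partial}{\partial t_j}+\frac1{4\beta^2}\sum_{-i-j=k}it_i\,jt_j\qquad(i,j\ge1),$$ $$\mathbb J^{(1)}_{k,n}=J^{(1)}_k+nJ^{(0)}_k,\qquad \mathbb J^{(2)}_{k,n}=\beta J^{(2)}_k+\big(2n\beta+(k+1)(1-\beta)\big)J^{(1)}_k+n(n\beta+1-\beta)J^{(0)}_k .$$ (1) For all $n\ge0$ and $k\ge-1$, $$\Big(-\sum_{i}c_i^{k+1}f(c_i)\frac{\partial}{\partial c_i}+\sum_{i\ge0}\big(a_i\,\mathbb J^{(2)}_{k+i,n}-b_i\,\mathbb J^{(1)}_{k+i+1,n}\big)\Big)I_n=0,$$ where the first sum is over the finite end points $c_i$, and a term with $f(c_i)=0$ is zero; at the other finite end points $\partial/\partial c_i$ exists. If $E=F$, the first sum is absent. This holds (a) as an identity of formal power series in $t$, the exponentials being expanded in powers of $t$ under the integral and $\partial/\partial c_i$ acting coefficientwise, and (b) as an identity of functions at every $t$ for which there is an $R$ with $|z|<R$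 for all $z\in E$ and $\sum_i|t_i|R^i<\infty$; in this case all first and second partial derivatives of $I_n$ in $t$ exist and the series $\sum_{i\ge1} it_i\,\partial I_n/\partial t_{i+k}$, $k\ge-1$, converge absolutely. (2) For every $n\in\mathbb Z$, and all $k,\ell\in\mathbb Z$, as operators on formal power series in $t$, the $\mathbb J^{(2)}_{k,n}$ and $\mathbb J^{(1)}_{k,n}$ form a Virasoro and a Heisenberg algebra: $$[\mathbb J^{(2)}_{k,n},\mathbb J^{(2)}_{\ell,n}]=(k-\ell)\mathbb J^{(2)}_{k+\ell,n}+c\,\frac{k^3-k}{12}\,\delta_{k,-\ell},$$ $$[\mathbb J^{(2)}_{k,n},\mathbb J^{(1)}_{\ell,n}]=-\ell\,\mathbb J^{(1)}_{k+\ell,n}+c'k(k+1)\,\delta_{k,-\ell},\qquad [\mathbb J^{(1)}_{k,n},\mathbb J^{(1)}_{\ell,n}]=\frac{k}{2\beta}\,\delta_{k,-\ell},$$ with $c=1-6(\beta^{1/2}-\beta^{-1/2})^2$ and $c'=\frac12\big(\frac1\beta-1\big)$. -/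

import Mathlib

open MeasureTheory Filter Topology

noncomputable section

namespace BetaVirasoro

/-! ### Weights and sets of integration -/

/-- The interval `F = [A, B] ⊆ ℝ`, whose end points may be infinite. -/
def range (A B : EReal) : Set ℝ := {z : ℝ | A ≤ (z : EReal) ∧ (z : EReal) ≤ B}

/-- `ρ = e^{-V}` is a weight on `[A, B]` with rational logarithmic derivative
`-ρ'/ρ = V' = g/f`, and `f(z) ρ(z) z^k → 0` as `z → A` and `z → B` inside the interval, for every
`k ≥ 0`.  (For `A = -∞` the filter `comap (↑) (𝓝[>] A)` on `ℝ` is `atBot`, for `A` finite it is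
`𝓝[>] A`; similarly for `B`.) Zeros of `f` inside the interval are allowed; nothing is
required of `ρ` at these points. -/
structure IsRationalWeight (A B : EReal) (ρ : ℝ → ℝ) (f g : Polynomial ℝ) : Prop where
  lt : A < B
  f_ne_zero : f ≠ 0
  pos : ∀ z : ℝ, A < z → (z : EReal) < B → f.eval z ≠ 0 → 0 < ρ z
  hasDerivAt : ∀ z : ℝ, A < z → (z : EReal) < B → f.eval z ≠ 0 →
    HasDerivAt ρ (-(g.eval z / f.eval z) * ρ z) z
  tendsto_left : ∀ k : ℕ,
    Tendsto (fun z : ℝ => f.eval z * ρ z * z ^ k) (comap ((↑) : ℝ → EReal) (𝓝[>] A)) (𝓝 0)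
  tendsto_right : ∀ k : ℕ,
    Tendsto (fun z : ℝ => f.eval z * ρ z * z ^ k) (comap ((↑) : ℝ → EReal) (𝓝[<] B)) (𝓝 0)

/-- The set `E = ⋃_{i=1}^r [c_{2i-1}, c_{2i}] ⊆ ℝ`.  The end points are numbered from `0` here,
and may be infinite. -/
def intervals {r : ℕ} (c : Fin (2 * r) → EReal) : Set ℝ :=
  ⋃ i : Fin r, {z : ℝ | c ⟨2 * i, by omega⟩ ≤ (z : EReal) ∧ (z : EReal) ≤ c ⟨2 * i + 1, by omega⟩}

/-- The indices of the finite end points of `E`. -/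
def finiteEnds {r : ℕ} (c : Fin (2 * r) → EReal) : Finset (Fin (2 * r)) :=
  open Classical in Finset.univ.filter fun j => c j ≠ ⊥ ∧ c j ≠ ⊤

/-- `∂Φ/∂c_j`, at a finite end point `c_j`, of a function `Φ` of the end points. -/
def dEnd {r : ℕ} (j : Fin (2 * r)) (Φ : (Fin (2 * r) → EReal) → ℝ) (c : Fin (2 * r) → EReal) : ℝ :=
  deriv (fun s : ℝ => Φ (Function.update c j (s : EReal))) (c j).toReal

/-- `∂Φ/∂c_j` exists. -/
def HasEndDeriv {r : ℕ} (j : Fin (2 * r)) (Φ : (Fin (2 * r) → EReal) → ℝ)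
    (c : Fin (2 * r) → EReal) : Prop :=
  DifferentiableAt ℝ (fun s : ℝ => Φ (Function.update c j (s : EReal))) (c j).toReal

/-- The first order operator `∑_j c_j^{k+1} f(c_j) ∂/∂c_j`, the sum being over the finite end
points. It is used for `k ≥ -1` only. -/
def boundaryOp {r : ℕ} (f : Polynomial ℝ) (k : ℤ) (Φ : (Fin (2 * r) → EReal) → ℝ)
    (c : Fin (2 * r) → EReal) : ℝ :=
  ∑ j ∈ finiteEnds c, (c j).toReal ^ (k + 1) * f.eval (c j).toReal * dEnd j Φ c

/-! ### The integrals -/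

/-- `Δ_n(z) = ∏_{i<j} (z_i - z_j)`. -/
def vandermonde {n : ℕ} (z : Fin n → ℝ) : ℝ := ∏ i, ∏ j ∈ Finset.Ioi i, (z i - z j)

/-- The integral
`I_n(t) = ∫_{E^n} |Δ_n(z)|^{2β} ∏_k (e^{∑_{i ≥ 1} t_i z_k^i} ρ(z_k) dz_k)`. -/
def integral (n : ℕ) (β : ℝ) (ρ : ℝ → ℝ) (E : Set ℝ) (t : ℕ+ → ℝ) : ℝ :=
  ∫ z in Set.univ.pi (fun _ : Fin n => E),
    |vandermonde z| ^ (2 * β) * ∏ k, (Real.exp (∑' i : ℕ+, t i * z k ^ (i : ℕ)) * ρ (z k))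

/-- Formal power series in `t = (t_1, t_2, …)`. -/
abbrev TSeries : Type := MvPowerSeries ℕ+ ℝ

/-- The integral `I_n(t)` as a formal power series in `t`: expanding
`∏_k e^{∑_i t_i z_k^i} = ∏_i e^{t_i p_i(z)}`, where `p_i(z) = ∑_k z_k^i`, the coefficient
of `∏_i t_i^{m_i}` is `∫_{E^n} |Δ_n(z)|^{2β} ∏_i (p_i(z)^{m_i} / m_i!) ∏_k ρ(z_k) dz_k`. -/
def formalIntegral (n : ℕ) (β : ℝ) (ρ : ℝ → ℝ) (E : Set ℝ) : TSeries := fun m =>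
  ∫ z in Set.univ.pi (fun _ : Fin n => E),
    |vandermonde z| ^ (2 * β) *
      (m.prod fun i e => (∑ k, z k ^ (i : ℕ)) ^ e / (e.factorial : ℝ)) * ∏ k, ρ (z k)

/-! ### The operators on formal power series -/

/-- The partial derivative `∂/∂t_i` of formal power series. -/
def pderiv (i : ℕ+) : Module.End ℝ TSeries where
  toFun F := fun m => (m i + 1 : ℝ) * MvPowerSeries.coeff (m + Finsupp.single i 1) F
  map_add' F G := by funext m; simp only [map_add, mul_add]; rfl
  map_smul' a F := by
    funext m
    change _ = a * _
    simp only [map_smul, smul_eq_mul]; ring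

/-- `∂/∂t_k` for an integer index, with the convention `∂/∂t_k = 0` for `k ≤ 0`. -/
def dT (k : ℤ) : Module.End ℝ TSeries :=
  if h : 0 < k then pderiv ⟨k.toNat, by omega⟩ else 0

/-- Multiplication by `t_k` for an integer index, with the convention `t_k = 0` for `k ≤ 0`. -/
def mT (k : ℤ) : Module.End ℝ TSeries :=
  if h : 0 < k then LinearMap.mulLeft ℝ (MvPowerSeries.X ⟨k.toNat, by omega⟩ : TSeries) else 0

/-- The operator `∑_{i ≥ 1} i t_i ∂/∂t_{i+k}`.  The coefficient of a given monomial `t^m`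
only receives contributions from the finitely many `i` such that `t_i` divides `t^m`. -/
def eulerT (k : ℤ) : Module.End ℝ TSeries where
  toFun F := fun m => ∑ i ∈ m.support,
    (i : ℝ) * MvPowerSeries.coeff m (mT (i : ℤ) (dT (i + k) F))
  map_add' F G := by
    funext m
    simp only [map_add, mul_add, Finset.sum_add_distrib]; rfl
  map_smul' a F := by
    funext m
    change _ = a * _
    simp only [map_smul, smul_eq_mul, Finset.mul_sum]
    exact Finset.sum_congr rfl fun i _ => by ring

/-- `eulerT k` is the coefficientwise sum of the series `∑_{i ≥ 1} i t_i ∂/∂t_{i+k}`. -/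
theorem hasSum_eulerT (k : ℤ) (F : TSeries) (m : ℕ+ →₀ ℕ) :
    HasSum (fun i : ℕ+ => (i : ℝ) * MvPowerSeries.coeff m (mT (i : ℤ) (dT (i + k) F)))
      (MvPowerSeries.coeff m (eulerT k F)) := by
  refine hasSum_sum_of_ne_finset_zero fun i hi => ?_
  have hi' : m i = 0 := by simpa using hi
  have h0 : (0 : ℤ) < ((i : ℕ) : ℤ) := by exact_mod_cast i.pos
  have h1 : (⟨((i : ℕ) : ℤ).toNat, by omega⟩ : ℕ+) = i := by
    apply PNat.eq; simp
  simp only [mT, h0, dif_pos, LinearMap.mulLeft_apply]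
  rw [h1, MvPowerSeries.X_def, MvPowerSeries.coeff_monomial_mul, if_neg, mul_zero]
  intro hle
  have := hle i
  simp [hi'] at this

/-- `J_k^{(0)} = δ_{k0}`. -/
def J0 (k : ℤ) : Module.End ℝ TSeries := if k = 0 then 1 else 0

/-- `J_k^{(1)} = ∂/∂t_k + (1/2β) (-k) t_{-k}`. -/
def J1 (β : ℝ) (k : ℤ) : Module.End ℝ TSeries := dT k + (1 / (2 * β) * (-k : ℝ)) • mT (-k)

/-- `J_k^{(2)} = ∑_{i+j=k} ∂²/∂t_i∂t_j + (1/β) ∑_{-i+j=k} i t_i ∂/∂t_j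
+ (1/4β²) ∑_{-i-j=k} i t_i j t_j`, the sums being over `i, j ≥ 1`. -/
def J2 (β : ℝ) (k : ℤ) : Module.End ℝ TSeries :=
  (∑ i ∈ Finset.Ioo 0 k, dT i * dT (k - i)) + (1 / β) • eulerT k +
    (1 / (4 * β ^ 2)) • ∑ i ∈ Finset.Ioo 0 (-k), ((i : ℝ) • mT i) * (((-k - i : ℤ) : ℝ) • mT (-k - i))

/-- `𝕁^{(1)}_{k,n} = J_k^{(1)} + n J_k^{(0)}`. -/
def JJ1 (β : ℝ) (n k : ℤ) : Module.End ℝ TSeries := J1 β k + (n : ℝ) • J0 k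

/-- `𝕁^{(2)}_{k,n} = β J_k^{(2)} + (2nβ + (k+1)(1-β)) J_k^{(1)} + n (nβ + 1 - β) J_k^{(0)}`. -/
def JJ2 (β : ℝ) (n k : ℤ) : Module.End ℝ TSeries :=
  β • J2 β k + (2 * n * β + (k + 1) * (1 - β)) • J1 β k + (n * (n * β + 1 - β)) • J0 k

/-- `∑_{i ≥ 0} (a_i 𝕁^{(2)}_{k+i,n} - b_i 𝕁^{(1)}_{k+i+1,n})`, where `f = ∑ a_i z^i` and
`g = ∑ b_i z^i`. -/
def virasoroOp (f g : Polynomial ℝ) (β : ℝ) (n k : ℤ) : Module.End ℝ TSeries :=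
  (f.sum fun i a => a • JJ2 β n (k + i)) - g.sum fun i b => b • JJ1 β n (k + i + 1)

/-! ### The operators on functions of `t` -/

/-- `∂Φ/∂t_i` of a function of `t = (t_1, t_2, …)`. -/
def pderivFun (i : ℕ+) (Φ : (ℕ+ → ℝ) → ℝ) (t : ℕ+ → ℝ) : ℝ :=
  deriv (fun s => Φ (Function.update t i s)) (t i)

/-- `∂Φ/∂t_i` exists at `t`. -/
def HasPDeriv (i : ℕ+) (Φ : (ℕ+ → ℝ) → ℝ) (t : ℕ+ → ℝ) : Prop :=
  DifferentiableAt ℝ (fun s => Φ (Function.update t i s)) (t i)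

/-- `∂Φ/∂t_k` for an integer index, with the convention `∂/∂t_k = 0` for `k ≤ 0`. -/
def dFun (k : ℤ) (Φ : (ℕ+ → ℝ) → ℝ) : (ℕ+ → ℝ) → ℝ :=
  if h : 0 < k then pderivFun ⟨k.toNat, by omega⟩ Φ else 0

/-- The coordinate `t_k` for an integer index, with the convention `t_k = 0` for `k ≤ 0`. -/
def coordFun (k : ℤ) (t : ℕ+ → ℝ) : ℝ :=
  if h : 0 < k then t ⟨k.toNat, by omega⟩ else 0

/-- `J_k^{(1)}` acting on functions. -/
def J1Fun (β : ℝ) (k : ℤ) (Φ : (ℕ+ → ℝ) → ℝ) (t : ℕ+ → ℝ) : ℝ :=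
  dFun k Φ t + 1 / (2 * β) * (-k : ℝ) * coordFun (-k) t * Φ t

/-- `J_k^{(2)}` acting on functions. -/
def J2Fun (β : ℝ) (k : ℤ) (Φ : (ℕ+ → ℝ) → ℝ) (t : ℕ+ → ℝ) : ℝ :=
  (∑ i ∈ Finset.Ioo 0 k, dFun i (dFun (k - i) Φ) t) +
    1 / β * (∑' i : ℕ+, (i : ℝ) * t i * dFun (i + k) Φ t) +
    1 / (4 * β ^ 2) * (∑ i ∈ Finset.Ioo 0 (-k),
      (i : ℝ) * coordFun i t * (((-k - i : ℤ) : ℝ) * coordFun (-k - i) t)) * Φ t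

/-- `𝕁^{(1)}_{k,n}` acting on functions. -/
def JJ1Fun (β : ℝ) (n k : ℤ) (Φ : (ℕ+ → ℝ) → ℝ) (t : ℕ+ → ℝ) : ℝ :=
  J1Fun β k Φ t + n * (if k = 0 then Φ t else 0)

/-- `𝕁^{(2)}_{k,n}` acting on functions. -/
def JJ2Fun (β : ℝ) (n k : ℤ) (Φ : (ℕ+ → ℝ) → ℝ) (t : ℕ+ → ℝ) : ℝ :=
  β * J2Fun β k Φ t + (2 * n * β + (k + 1) * (1 - β)) * J1Fun β k Φ t +
    n * (n * β + 1 - β) * (if k = 0 then Φ t else 0)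

/-- `∑_{i ≥ 0} (a_i 𝕁^{(2)}_{k+i,n} - b_i 𝕁^{(1)}_{k+i+1,n})` acting on functions. -/
def virasoroFun (f g : Polynomial ℝ) (β : ℝ) (n k : ℤ) (Φ : (ℕ+ → ℝ) → ℝ) (t : ℕ+ → ℝ) : ℝ :=
  (f.sum fun i a => a * JJ2Fun β n (k + i) Φ t) - g.sum fun i b => b * JJ1Fun β n (k + i + 1) Φ t

end BetaVirasoro

end

namespace BetaVirasoro

/-! ### Commutation relations of the elementary operators -/

/-! The constraints are the statement that a total divergence integrates to its boundary values.
With `p = k + 1`, take the sum over `l` of `∂/∂z_l` of `z_l^p f(z_l) |Δ|^{2β} Ψ ∏ρ`, where `Ψ` is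
the exponential of `∑ t_i p_i(z)` or one of its Taylor coefficients in `t`, and integrate over
`E^n`. Since `(fρ)' = (f' - g)ρ`, the bulk term is a polynomial expression times the original
density. Differentiating `Δ` produces divided differences of `z^p f`, which are again polynomials
and can be written in power sums `p_i`. Multiplication by `p_i` is `∂/∂t_i`, and the vector field `∑
z_l^p ∂/∂z_l` acts on `Ψ` as `∑ i t_i p_{p+i-1}`. The result is exactly the combination of the
operators of orders two and one (`loop_equation`, `loop_expression`, `coeff_JJ2_formalIntegral`,
`JJ2Fun_integral`). The boundary term at `c_j` is `c_j^p f(c_j)` times the integral with one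
variable frozen at `c_j`, which is `∂I_n/∂c_j` (`exists_end_derivatives`).

Four analytic points need care. The weight `ρ` may be singular at zeros of `f`, but integrability of
`ρ` forces `fρ` to tend to zero there (`IsRationalWeight.continuousOn_mul`). At a finite end point
of `F` the decay of `fρ` forces `f` to vanish (`IsRationalWeight.mem_interior`), so such an end
contributes nothing. The decay at infinity together with integrability gives all moments
(`IsRationalWeight.hasMoments`). For small `β` the power `|Δ|^{2β}` is not differentiable on the
diagonals; it is replaced by `(Δ² + ε)^β`, for which integration by parts is legitimate, and `ε → 0`
is taken by dominated convergence.

The existence of `∂I_n/∂c_j` comes from writing the indicator of the moved set as that of `E` plus a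
jump and expanding the product over the variables: one jump gives the derivative by the fundamental
theorem of calculus, and two or more are `O(|s - c_j|²)`.

The algebra rests on the Heisenberg relation `J1_mul_J1` and on `J2_mul_J1`. The defect of the
Virasoro relation for `J2` commutes with every `∂/∂t_i`, so it is determined by constant terms
(`eq_zero_of_commute_dT`); these involve only products of positive modes, and reordering them yields
the cubic anomaly. Adding the linear term `(k+1)(1-β) J1` changes the central charge from `1` to `1
- 6(1-β)²/β`. -/

theorem coeff_pderiv (i : ℕ+) (F : TSeries) (m : ℕ+ →₀ ℕ) :
    MvPowerSeries.coeff m (pderiv i F) =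
      (m i + 1 : ℝ) * MvPowerSeries.coeff (m + Finsupp.single i 1) F := rfl

theorem coeff_eulerT (k : ℤ) (F : TSeries) (m : ℕ+ →₀ ℕ) :
    MvPowerSeries.coeff m (eulerT k F) = ∑ i ∈ m.support,
      (i : ℝ) * MvPowerSeries.coeff m (mT (i : ℤ) (dT (i + k) F)) := rfl

theorem dT_of_pos (i : ℕ+) : dT (i : ℤ) = pderiv i := by
  have h0 : (0 : ℤ) < ((i : ℕ) : ℤ) := by exact_mod_cast i.pos
  rw [dT, dif_pos h0]
  congr 1

theorem dT_of_nonpos {k : ℤ} (hk : k ≤ 0) : dT k = 0 := by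
  rw [dT, dif_neg (by omega)]

theorem mT_of_pos (i : ℕ+) :
    mT (i : ℤ) = LinearMap.mulLeft ℝ (MvPowerSeries.X i : TSeries) := by
  have h0 : (0 : ℤ) < ((i : ℕ) : ℤ) := by exact_mod_cast i.pos
  rw [mT, dif_pos h0]
  congr 2

theorem mT_of_nonpos {k : ℤ} (hk : k ≤ 0) : mT k = 0 := by
  rw [mT, dif_neg (by omega)]

theorem exists_pnat_cast {k : ℤ} (hk : 0 < k) : ∃ i : ℕ+, (i : ℤ) = k :=
  ⟨⟨k.toNat, by omega⟩, by simp; omega⟩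

theorem coeff_X_mul (i : ℕ+) (F : TSeries) (m : ℕ+ →₀ ℕ) :
    MvPowerSeries.coeff m (MvPowerSeries.X i * F) =
      if m i = 0 then 0 else MvPowerSeries.coeff (m - Finsupp.single i 1) F := by
  rw [MvPowerSeries.X_def, MvPowerSeries.coeff_monomial_mul]
  simp only [Finsupp.single_le_iff, one_mul]
  by_cases h : m i = 0
  · simp [h]
  · rw [if_pos (by omega), if_neg h]

theorem coeff_mT (i : ℕ+) (F : TSeries) (m : ℕ+ →₀ ℕ) :
    MvPowerSeries.coeff m (mT (i : ℤ) F) =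
      if m i = 0 then 0 else MvPowerSeries.coeff (m - Finsupp.single i 1) F := by
  rw [mT_of_pos, LinearMap.mulLeft_apply, coeff_X_mul]

theorem pderiv_X_mul (i j : ℕ+) (F : TSeries) :
    pderiv i (MvPowerSeries.X j * F) =
      MvPowerSeries.X j * pderiv i F + if i = j then F else 0 := by
  ext m
  rw [coeff_pderiv, map_add, coeff_X_mul, coeff_X_mul]
  by_cases hij : i = j
  · subst hij
    by_cases hm : m i = 0
    · simp [hm]
    · have h1 : m - Finsupp.single i 1 + Finsupp.single i 1 = m := by
        ext a
        by_cases ha : a = i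
        · subst ha; simp; omega
        · simp [Ne.symm ha]
      have h2 : ((m i - 1 : ℕ) : ℝ) = m i - 1 := by
        rw [Nat.cast_sub (by omega)]; simp
      simp only [coeff_pderiv, hm, if_false, if_true, h1]
      simp [h2]
      ring
  · have h1 : (Finsupp.single i 1 : ℕ+ →₀ ℕ) j = 0 := by simp [hij]
    have h3 : (Finsupp.single j 1 : ℕ+ →₀ ℕ) i = 0 := by simp [Ne.symm hij]
    by_cases hm : m j = 0
    · simp [hm, h1, hij]
    · have h2 : m + Finsupp.single i 1 - Finsupp.single j 1 =
          m - Finsupp.single j 1 + Finsupp.single i 1 := by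
        ext a
        by_cases ha : a = j
        · subst ha; simp [h1]
        · simp [Finsupp.single_apply, Ne.symm ha]
      simp [coeff_pderiv, hm, h1, h2, hij, h3]

theorem commute_dT (i j : ℤ) : dT i * dT j = dT j * dT i := by
  rcases le_or_gt i 0 with hi | hi
  · simp [dT_of_nonpos hi]
  rcases le_or_gt j 0 with hj | hj
  · simp [dT_of_nonpos hj]
  obtain ⟨i, rfl⟩ := exists_pnat_cast hi
  obtain ⟨j, rfl⟩ := exists_pnat_cast hj
  rw [dT_of_pos, dT_of_pos]
  refine LinearMap.ext fun F => MvPowerSeries.ext fun m => ?_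
  simp only [Module.End.mul_apply, coeff_pderiv]
  rw [show m + Finsupp.single i 1 + Finsupp.single j 1 =
    m + Finsupp.single j 1 + Finsupp.single i 1 by abel]
  by_cases hij : i = j
  · subst hij; ring
  · simp [hij, Ne.symm hij]; ring

theorem commute_mT (i j : ℤ) : mT i * mT j = mT j * mT i := by
  rcases le_or_gt i 0 with hi | hi
  · simp [mT_of_nonpos hi]
  rcases le_or_gt j 0 with hj | hj
  · simp [mT_of_nonpos hj]
  obtain ⟨i, rfl⟩ := exists_pnat_cast hi
  obtain ⟨j, rfl⟩ := exists_pnat_cast hj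
  rw [mT_of_pos, mT_of_pos]
  refine LinearMap.ext fun F => ?_
  simp only [Module.End.mul_apply, LinearMap.mulLeft_apply]
  ring

theorem dT_mul_mT (i j : ℤ) :
    dT i * mT j = mT j * dT i + if i = j ∧ 0 < i then 1 else 0 := by
  rcases le_or_gt i 0 with hi | hi
  · simp [dT_of_nonpos hi, not_lt.2 hi]
  rcases le_or_gt j 0 with hj | hj
  · rw [mT_of_nonpos hj, if_neg (by omega)]; simp
  obtain ⟨i, rfl⟩ := exists_pnat_cast hi
  obtain ⟨j, rfl⟩ := exists_pnat_cast hj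
  rw [dT_of_pos, mT_of_pos]
  refine LinearMap.ext fun F => ?_
  simp only [Module.End.mul_apply, LinearMap.mulLeft_apply, LinearMap.add_apply, pderiv_X_mul]
  by_cases hij : i = j
  · simp [hij]
  · have : (i : ℤ) ≠ j := by exact_mod_cast hij
    simp [hij]

theorem dT_mul_mT_apply (i j : ℤ) (F : TSeries) :
    dT i (mT j F) = mT j (dT i F) + if i = j ∧ 0 < i then F else 0 := by
  have := LinearMap.congr_fun (dT_mul_mT i j) F
  simp only [Module.End.mul_apply, LinearMap.add_apply] at this
  rw [this]
  split_ifs <;> simp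

theorem commute_dT_apply (i j : ℤ) (F : TSeries) : dT i (dT j F) = dT j (dT i F) :=
  LinearMap.congr_fun (commute_dT i j) F

theorem commute_mT_apply (i j : ℤ) (F : TSeries) : mT i (mT j F) = mT j (mT i F) :=
  LinearMap.congr_fun (commute_mT i j) F

/-- The Leibniz rule is applied inside the coefficientwise convergent series: only the term `i = j`
gives a correction. Comparing sums through `HasSum` avoids matching the different finite supports of
the coefficients. -/
theorem dT_mul_eulerT (k : ℤ) (j : ℕ+) :
    dT j * eulerT k = eulerT k * dT j + (j : ℝ) • dT (j + k) := by
  refine LinearMap.ext fun F => MvPowerSeries.ext fun m => ?_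
  have h1 : HasSum (fun i : ℕ+ => (i : ℝ) * MvPowerSeries.coeff m
      (dT j (mT (i : ℤ) (dT (i + k) F)))) (MvPowerSeries.coeff m (dT j (eulerT k F))) := by
    rw [dT_of_pos]
    simp only [coeff_pderiv]
    refine ((hasSum_eulerT k F (m + Finsupp.single j 1)).mul_left (m j + 1 : ℝ)).congr_fun
      fun i => ?_
    ring
  have h2 := (hasSum_eulerT k (dT j F) m).add
    (hasSum_ite_eq j ((j : ℝ) * MvPowerSeries.coeff m (dT (j + k) F)))
  refine (h1.unique (h2.congr_fun ?_)).trans ?_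
  · intro i
    rw [dT_mul_mT_apply, commute_dT_apply j, map_add, mul_add]
    congr 1
    by_cases h : i = j
    · simp [h]
    · have : (j : ℤ) ≠ i := by exact_mod_cast Ne.symm h
      simp [h, this]
  · simp

/-- Here the correction comes from the single `i` with `i + k = j`, whence the weight `j - k`; there
is none if `j - k` is not positive, in agreement with the convention for `mT`. -/
theorem mT_mul_eulerT (k : ℤ) (j : ℕ+) :
    mT j * eulerT k = eulerT k * mT j - ((j - k : ℤ) : ℝ) • mT (j - k) := by
  rw [eq_sub_iff_add_eq]
  refine LinearMap.ext fun F => MvPowerSeries.ext fun m => ?_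
  have h1 : HasSum (fun i : ℕ+ => (i : ℝ) * MvPowerSeries.coeff m
      (mT j (mT (i : ℤ) (dT (i + k) F)))) (MvPowerSeries.coeff m (mT j (eulerT k F))) := by
    rw [coeff_mT]
    split_ifs with h
    · refine hasSum_zero.congr_fun fun i => ?_
      rw [coeff_mT, if_pos h, mul_zero]
    · refine (hasSum_eulerT k F (m - Finsupp.single j 1)).congr_fun fun i => ?_
      rw [coeff_mT j, if_neg h]
  have h3 : HasSum (fun i : ℕ+ => (i : ℝ) * MvPowerSeries.coeff m
      (if (i : ℤ) + k = j ∧ 0 < (i : ℤ) + k then mT i F else 0))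
      (((j - k : ℤ) : ℝ) * MvPowerSeries.coeff m (mT (j - k) F)) := by
    rcases le_or_gt ((j : ℤ) - k) 0 with h | h
    · rw [mT_of_nonpos h]
      convert hasSum_zero using 2 with i
      · have := i.pos
        rw [if_neg (by omega)]; simp
      · simp
    · obtain ⟨p, hp⟩ := exists_pnat_cast h
      rw [← hp]
      refine (hasSum_ite_eq p (((p : ℤ) : ℝ) * MvPowerSeries.coeff m (mT p F))).congr_fun fun i => ?_
      have hj := j.pos
      by_cases hi : i = p
      · rw [if_pos hi, hi, if_pos (by omega)]; simp
      · have : (i : ℤ) ≠ p := by exact_mod_cast hi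
        rw [if_neg hi, if_neg (by omega)]; simp
  have h2 := hasSum_eulerT k (mT j F) m
  refine ((h1.add h3).unique (h2.congr_fun fun i => ?_)).trans ?_
  · rw [dT_mul_mT_apply, commute_mT_apply j, map_add, map_add, mul_add]
    congr 3
    split_ifs <;> simp
  · rfl

/-! ### The bosonic operators `J_k^{(1)}` and the action of `J_k^{(2)}` on them -/

variable {β : ℝ}

theorem J1_of_pos (i : ℕ+) : J1 β i = dT i := by
  have := i.pos
  rw [J1, mT_of_nonpos (by omega), smul_zero, add_zero]

theorem J1_neg (i : ℕ+) : J1 β (-i) = ((i : ℝ) / (2 * β)) • mT i := by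
  have := i.pos
  rw [J1, dT_of_nonpos (by omega), zero_add, neg_neg]
  congr 1
  push_cast
  ring

theorem J1_zero : J1 β 0 = 0 := by
  rw [J1, dT_of_nonpos le_rfl]; simp

theorem int_pos_or (k : ℤ) : (∃ i : ℕ+, k = i) ∨ k = 0 ∨ ∃ i : ℕ+, k = -i := by
  rcases lt_trichotomy k 0 with h | h | h
  · obtain ⟨i, hi⟩ := exists_pnat_cast (k := -k) (by omega)
    exact Or.inr (Or.inr ⟨i, by omega⟩)
  · exact Or.inr (Or.inl h)
  · obtain ⟨i, hi⟩ := exists_pnat_cast h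
    exact Or.inl ⟨i, hi.symm⟩

/-- Only a derivative and a multiplication in the same variable fail to commute. For `k > 0` this is
the pair `∂_k, t_k`, for `k < 0` the pair `t_{-k}, ∂_{-k}`; the opposite order is compensated by the
sign of `k`. -/
theorem J1_mul_J1 (k l : ℤ) :
    J1 β k * J1 β l = J1 β l * J1 β k + (if k + l = 0 then (k : ℝ) / (2 * β) else 0) • 1 := by
  have h1 := dT_mul_mT k (-l)
  have h2 := dT_mul_mT l (-k)
  simp only [J1, add_mul, mul_add, smul_mul_assoc, mul_smul_comm, h1, h2, commute_dT k l,
    commute_mT (-k) (-l)]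
  by_cases h : k + l = 0
  · obtain rfl : l = -k := by omega
    rcases lt_trichotomy k 0 with hk | rfl | hk
    · rw [if_pos h, if_neg (by omega), if_pos (by omega)]
      push_cast
      module
    · simp
    · rw [if_pos h, if_pos (by omega), if_neg (by omega)]
      push_cast
      module
  · rw [if_neg h, if_neg (by omega), if_neg (by omega)]
    module

/-- `J_k^{(2)}` in terms of the bosonic operators. -/
theorem J2_eq (k : ℤ) :
    J2 β k = (∑ i ∈ Finset.Ioo 0 k, J1 β i * J1 β (k - i)) + (1 / β) • eulerT k +
      ∑ i ∈ Finset.Ioo k 0, J1 β i * J1 β (k - i) := by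
  rw [J2]
  congr 1
  · congr 1
    refine Finset.sum_congr rfl fun i hi => ?_
    rw [Finset.mem_Ioo] at hi
    obtain ⟨p, hp⟩ := exists_pnat_cast hi.1
    obtain ⟨q, hq⟩ := exists_pnat_cast (k := k - i) (by omega)
    rw [← hq, ← hp, J1_of_pos, J1_of_pos]
  · rw [Finset.smul_sum]
    refine Finset.sum_nbij' (fun i => -i) (fun i => -i) ?_ ?_ ?_ ?_ ?_
    · intro i hi; rw [Finset.mem_Ioo] at *; omega
    · intro i hi; rw [Finset.mem_Ioo] at *; omega
    · intro i _; simp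
    · intro i _; simp
    · intro i hi
      rw [Finset.mem_Ioo] at hi
      obtain ⟨p, hp⟩ := exists_pnat_cast hi.1
      obtain ⟨q, hq⟩ := exists_pnat_cast (k := -k - i) (by omega)
      rw [← hq, show k - -i = -(q : ℤ) by omega, ← hp, J1_neg, J1_neg]
      simp only [smul_mul_assoc, mul_smul_comm, smul_smul]
      congr 1
      push_cast
      ring

/-- Moving `J1 β j` to the left past the factors of index `i` and `k - i` leaves a scalar when `i =
-j` and when `k - i = -j`. The set `s` is arbitrary so that both quadratic sums of `J2` are covered.
-/
theorem sum_J1_mul_J1 (s : Finset ℤ) (k j : ℤ) :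
    (∑ i ∈ s, J1 β i * J1 β (k - i)) * J1 β j =
      J1 β j * (∑ i ∈ s, J1 β i * J1 β (k - i)) -
        (((if k + j ∈ s then (j : ℝ) / (2 * β) else 0) • J1 β (k + j)) +
          (if -j ∈ s then (j : ℝ) / (2 * β) else 0) • J1 β (k + j)) := by
  have h : ∀ i, J1 β i * J1 β (k - i) * J1 β j = J1 β j * (J1 β i * J1 β (k - i)) -
      ((if i = k + j then ((j : ℝ) / (2 * β)) • J1 β (k + j) else 0) +
        if i = -j then ((j : ℝ) / (2 * β)) • J1 β (k + j) else 0) := by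
    intro i
    rw [mul_assoc, J1_mul_J1 (k - i) j, mul_add, ← mul_assoc, J1_mul_J1 i j, add_mul, mul_assoc,
      mul_smul_comm, smul_mul_assoc, mul_one, one_mul]
    by_cases h1 : i = k + j
    · subst h1
      -- When the two exceptional indices coincide, both factors equal `J1 β (-j)` and the single
      -- term `i` carries both corrections.
      by_cases h2 : k + j = -j
      · rw [if_pos (by omega), if_pos (by omega), if_pos rfl, if_pos h2,
          show k - (k + j) = k + j by omega, show ((k + j : ℤ) : ℝ) = -(j : ℝ) by rw [h2]; simp]
        module
      · rw [if_neg (by omega), if_pos (by omega), if_pos rfl, if_neg h2,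
          show ((k - (k + j) : ℤ) : ℝ) = -(j : ℝ) by push_cast; ring]
        module
    · by_cases h2 : i = -j
      · rw [if_pos (by omega), if_neg (by omega), if_neg h1, if_pos h2, h2,
          show k - -j = k + j by omega]
        push_cast
        module
      · rw [if_neg (by omega), if_neg (by omega), if_neg h1, if_neg h2]
        module
  rw [Finset.sum_mul, Finset.sum_congr rfl fun i _ => h i, Finset.sum_sub_distrib,
    ← Finset.mul_sum, Finset.sum_add_distrib, Finset.sum_ite_eq', Finset.sum_ite_eq']
  congr 2 <;> split_ifs <;> simp

/-- The three pieces of `J2` share out the signs: the mixed sum acts when `j` and `k + j` have the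
same sign, the double derivatives when `j < 0 < k + j`, the double multiplications when `k + j < 0 <
j`. Each quadratic sum contributes `j / (2β)` twice, the mixed sum contributes `j` with prefactor
`1/β`, so the coefficient is `j/β` throughout. -/
theorem J2_mul_J1 (hβ : β ≠ 0) (k j : ℤ) :
    J2 β k * J1 β j = J1 β j * J2 β k - ((j : ℝ) / β) • J1 β (k + j) := by
  have hE : eulerT k * J1 β j = J1 β j * eulerT k -
      (if 0 < j ∧ 0 < k + j ∨ j < 0 ∧ k + j < 0 then (j : ℝ) else 0) • J1 β (k + j) := by
    rcases int_pos_or j with ⟨p, rfl⟩ | rfl | ⟨p, rfl⟩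
    · have hp := p.pos
      rw [J1_of_pos, dT_mul_eulerT]
      rcases int_pos_or (k + p) with ⟨q, hq⟩ | hq | ⟨q, hq⟩
      · have := q.pos
        rw [if_pos (by omega), hq, J1_of_pos, add_comm (p : ℤ), hq]
        push_cast; module
      · rw [hq, J1_zero, add_comm (p : ℤ), hq, dT_of_nonpos le_rfl]
        simp
      · have := q.pos
        rw [if_neg (by omega), dT_of_nonpos (k := p + k) (by omega)]
        simp
    · simp [J1_zero]
    · have hp := p.pos
      rw [J1_neg, smul_mul_assoc, mul_smul_comm, mT_mul_eulerT]
      rcases int_pos_or (k + -p) with ⟨q, hq⟩ | hq | ⟨q, hq⟩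
      · have := q.pos
        rw [if_neg (by omega), mT_of_nonpos (k := p - k) (by omega)]
        simp
      · rw [hq, J1_zero, mT_of_nonpos (k := p - k) (by omega)]
        simp
      · have := q.pos
        rw [if_pos (by omega), hq, J1_neg, show (p : ℤ) - k = q by omega]
        push_cast
        rw [smul_sub, smul_smul, smul_smul]
        module
  rw [J2_eq, add_mul, add_mul, mul_add, mul_add, sum_J1_mul_J1, sum_J1_mul_J1, smul_mul_assoc, hE,
    mul_smul_comm]
  simp only [Finset.mem_Ioo]
  have h0 : j = 0 ∨ k + j = 0 ∨ (j ≠ 0 ∧ k + j ≠ 0) := by omega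
  rcases h0 with rfl | h0 | h0
  · simp [J1_zero]
  · simp [h0, J1_zero]
  · split_ifs <;> first | omega | (match_scalars <;> (field_simp; try ring))

/-! ### The Virasoro relations -/

/-- An operator commuting with all `∂/∂t_i` is determined by the constant terms of its values. -/
theorem eq_zero_of_commute_dT {D : Module.End ℝ TSeries}
    (hD : ∀ i : ℕ+, D * dT i = dT i * D)
    (h0 : ∀ F, MvPowerSeries.coeff 0 (D F) = 0) : D = 0 := by
  have key : ∀ (N : ℕ) (m : ℕ+ →₀ ℕ), (m.sum fun _ e => e) = N →
      ∀ F, MvPowerSeries.coeff m (D F) = 0 := by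
    intro N
    induction N with
    | zero =>
      intro m hm F
      have : m = 0 := by
        rw [Finsupp.sum, Finset.sum_eq_zero_iff] at hm
        ext a
        by_contra h
        exact h (hm a (by simpa using h))
      rw [this]; exact h0 F
    | succ N ih =>
      intro m hm F
      have : ∃ i, m i ≠ 0 := by
        by_contra! h
        have : m = 0 := by ext a; exact h a
        simp [this] at hm
      obtain ⟨i, hi⟩ := this
      have h1 : m - Finsupp.single i 1 + Finsupp.single i 1 = m := by
        ext a
        by_cases ha : a = i
        · subst ha; simp; omega
        · simp [Ne.symm ha]
      have h2 : ((m - Finsupp.single i 1).sum fun _ e => e) = N := by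
        rw [← h1, Finsupp.sum_add_index' (by simp) (by simp), Finsupp.sum_single_index rfl] at hm
        omega
      -- Up to the nonzero factor `m i`, the coefficient of `D F` at `m` is that of `∂_i D F = D ∂_i
      -- F` at the exponent lowered by one in `t_i`.
      have h3 := ih _ h2 (dT i F)
      rw [← Module.End.mul_apply, hD, Module.End.mul_apply, dT_of_pos, coeff_pderiv, h1] at h3
      refine (mul_eq_zero.1 h3).resolve_left ?_
      positivity
  exact LinearMap.ext fun F => MvPowerSeries.ext fun m => by
    simpa using key _ m rfl F

theorem coeff_zero_J1 {k : ℤ} (hk : k ≤ 0) (F : TSeries) :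
    MvPowerSeries.coeff 0 (J1 β k F) = 0 := by
  rcases int_pos_or k with ⟨p, rfl⟩ | rfl | ⟨p, rfl⟩
  · have := p.pos; omega
  · simp [J1_zero]
  · simp [J1_neg, coeff_mT]

/-- The mixed sum and the double multiplications have a variable `t_i` as leftmost factor and vanish
at `t = 0`. -/
theorem coeff_zero_J2 (k : ℤ) (F : TSeries) :
    MvPowerSeries.coeff 0 (J2 β k F) =
      ∑ i ∈ Finset.Ioo 0 k, MvPowerSeries.coeff 0 (J1 β i (J1 β (k - i) F)) := by
  have h1 : MvPowerSeries.coeff 0 (eulerT k F) = 0  := by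
    rw [coeff_eulerT]; simp
  have h2 : ∑ i ∈ Finset.Ioo k 0, MvPowerSeries.coeff 0 (J1 β i (J1 β (k - i) F)) = 0 :=
    Finset.sum_eq_zero fun i hi => coeff_zero_J1 (Finset.mem_Ioo.1 hi).2.le _
  rw [J2_eq]
  simp only [LinearMap.add_apply, LinearMap.smul_apply, LinearMap.sum_apply, Module.End.mul_apply,
    map_add, map_sum, map_smul, h1, h2]
  simp

/-- At `x = n + 1` the value is `(x³ - x)/6`, the origin of the cubic in the central term. -/
theorem sum_Ioo_sub_mul (x : ℝ) (n : ℕ) :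
    ∑ i ∈ Finset.Ioo (0 : ℤ) (n + 1), (x - i) * i =
      x * (n * (n + 1) / 2) - n * (n + 1) * (2 * n + 1) / 6 := by
  induction n with
  | zero =>
    rw [show Finset.Ioo (0 : ℤ) ((0 : ℕ) + 1) = ∅ by ext i; simp; omega]
    simp
  | succ n ih =>
    rw [show Finset.Ioo (0 : ℤ) ((n + 1 : ℕ) + 1) = insert ((n : ℤ) + 1) (Finset.Ioo (0 : ℤ) (n + 1)) by
      ext i; simp only [Finset.mem_Ioo, Finset.mem_insert]; omega, Finset.sum_insert (by simp), ih]
    push_cast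
    ring

/-- Here `b i` models the constant term of `J_i J_{k+l-i} F`, and `hs` is the Heisenberg relation.
If `k + l ≠ 0`, then `b` lives on `0 < i < k + l`; after shifting indices the coefficients at each
`i` add up to `k - l`, whatever the position of `i` relative to `k` and `l`. If `k + l = 0`, only
the anomaly `i e` survives, and it sums to the cubic. -/
theorem sum_Ioo_virasoro {b : ℤ → ℝ} {k l : ℤ} {e : ℝ} (hb : ∀ i ≤ 0, b i = 0)
    (hs : ∀ i, b i = b (k + l - i) + if k + l = 0 then i * e else 0) :
    (∑ i ∈ Finset.Ioo 0 k, ((i : ℝ) * b (l + i) + (k - i) * b i)) -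
        ∑ i ∈ Finset.Ioo 0 l, ((i : ℝ) * b (k + i) + (l - i) * b i) =
      (k - l) * (∑ i ∈ Finset.Ioo 0 (k + l), b i) +
        if k + l = 0 then e * ((k : ℝ) ^ 3 - k) / 6 else 0 := by
  by_cases h : k + l = 0
  · have hpos : ∀ k : ℤ, 0 < k → (∑ i ∈ Finset.Ioo 0 k, ((i : ℝ) * b (-k + i) + (k - i) * b i)) =
        e * ((k : ℝ) ^ 3 - k) / 6 := by
      intro k hk
      obtain ⟨n, rfl⟩ : ∃ n : ℕ, k = n + 1 := ⟨(k - 1).toNat, by omega⟩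
      have : ∀ i ∈ Finset.Ioo (0 : ℤ) (n + 1), (i : ℝ) * b (-((n : ℤ) + 1) + i) +
          (((n : ℤ) + 1 : ℤ) - i) * b i = e * ((((n : ℤ) + 1 : ℤ) - i) * i) := by
        intro i hi
        rw [Finset.mem_Ioo] at hi
        rw [hb _ (by omega), hs i, if_pos h, h, hb (0 - i) (by omega)]
        ring
      rw [Finset.sum_congr rfl this, ← Finset.mul_sum, sum_Ioo_sub_mul]
      push_cast
      ring
    obtain rfl : l = -k := by omega
    rw [if_pos h, h]
    rcases lt_trichotomy k 0 with hk | rfl | hk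
    · rw [Finset.Ioo_eq_empty (b := k) (by omega)]
      have := hpos (-k) (by omega)
      rw [neg_neg] at this
      rw [this]
      push_cast
      simp
      ring
    · simp
    · rw [Finset.Ioo_eq_empty (b := -k) (by omega), hpos k hk]
      simp
  · have hb' : ∀ i, i ∉ Finset.Ioo 0 (k + l) → b i = 0 := by
      intro i hi
      rw [Finset.mem_Ioo] at hi
      by_cases h0 : i ≤ 0
      · exact hb i h0
      · rw [hs i, if_neg h, hb _ (by omega), zero_add]
    have hext : ∀ (A : Finset ℤ) (g : ℤ → ℝ), ∑ i ∈ A, g i * b i =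
        ∑ i ∈ Finset.Ioo 0 (k + l), if i ∈ A then g i * b i else 0 := by
      intro A g
      rw [Finset.sum_ite_mem]
      refine (Finset.sum_subset Finset.inter_subset_right fun i hi hi' => ?_).symm
      rw [hb' i fun h => hi' (Finset.mem_inter.2 ⟨h, hi⟩), mul_zero]
    have hshift : ∀ k l : ℤ, ∑ i ∈ Finset.Ioo 0 k, (i : ℝ) * b (l + i) =
        ∑ i ∈ Finset.Ioo l (k + l), ((i : ℝ) - l) * b i := by
      intro k l
      refine Finset.sum_nbij' (fun i => l + i) (fun i => i - l) ?_ ?_ ?_ ?_ ?_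
      · intro i hi; rw [Finset.mem_Ioo] at *; omega
      · intro i hi; rw [Finset.mem_Ioo] at *; omega
      · intro i _; simp
      · intro i _; simp
      · intro i _; push_cast; ring
    rw [Finset.sum_add_distrib, Finset.sum_add_distrib, hshift, hshift, add_comm l k, hext, hext,
      hext, hext, ← Finset.sum_add_distrib, ← Finset.sum_add_distrib, ← Finset.sum_sub_distrib,
      if_neg h, add_zero, Finset.mul_sum]
    refine Finset.sum_congr rfl fun i hi => ?_
    simp only [Finset.mem_Ioo] at *
    rcases lt_trichotomy i k with h1 | rfl | h1 <;> rcases lt_trichotomy i l with h2 | rfl | h2 <;>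
      split_ifs <;> first | omega | ring

/-- By `J2_mul_J1` both sides have the same commutator with each positive mode, so the difference
commutes with all `∂/∂t_p` and only constant terms remain to be compared. There the products of four
positive modes are symmetric under exchange of `k` and `l` and cancel; what remains is
`sum_Ioo_virasoro`. -/
theorem J2_mul_J2 (hβ : β ≠ 0) (k l : ℤ) :
    J2 β k * J2 β l - J2 β l * J2 β k = (((k : ℝ) - l) / β) • J2 β (k + l) +
      (if k + l = 0 then ((k : ℝ) ^ 3 - k) / (12 * β ^ 2) else 0) • 1 := by
  rw [← sub_eq_zero]
  refine eq_zero_of_commute_dT (fun p => ?_) fun F => ?_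
  · rw [← J1_of_pos (β := β)]
    have h1 : J2 β k * J2 β l * J1 β p = J1 β p * (J2 β k * J2 β l) -
        ((p : ℝ) / β) • (J1 β (k + p) * J2 β l + J1 β (l + p) * J2 β k) +
          (p * (l + p) / β ^ 2 : ℝ) • J1 β (k + l + p) := by
      rw [mul_assoc, J2_mul_J1 hβ, mul_sub, ← mul_assoc, J2_mul_J1 hβ, mul_smul_comm,
        J2_mul_J1 hβ, sub_mul, smul_mul_assoc, mul_assoc, ← add_assoc k l]
      push_cast
      match_scalars <;> field_simp
    have h2 : J2 β l * J2 β k * J1 β p = J1 β p * (J2 β l * J2 β k) -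
        ((p : ℝ) / β) • (J1 β (k + p) * J2 β l + J1 β (l + p) * J2 β k) +
          (p * (k + p) / β ^ 2 : ℝ) • J1 β (k + l + p) := by
      rw [mul_assoc, J2_mul_J1 hβ, mul_sub, ← mul_assoc, J2_mul_J1 hβ, mul_smul_comm,
        J2_mul_J1 hβ, sub_mul, smul_mul_assoc, mul_assoc, ← add_assoc l k, add_comm l k]
      push_cast
      match_scalars <;> field_simp
    simp only [sub_mul, add_mul, mul_sub, mul_add, h1, h2, smul_mul_assoc, mul_smul_comm,
      J2_mul_J1 hβ, one_mul, mul_one]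
    match_scalars <;> field_simp <;> ring
  · set ε : TSeries →ₗ[ℝ] ℝ := MvPowerSeries.coeff 0
    have hε : ∀ k l : ℤ, ε (J2 β k (J2 β l F)) =
        (∑ i ∈ Finset.Ioo 0 k, ∑ j ∈ Finset.Ioo 0 l,
          ε (J1 β j (J1 β (l - j) (J1 β i (J1 β (k - i) F))))) +
        1 / β * ∑ i ∈ Finset.Ioo 0 k, ((i : ℝ) * ε (J1 β (l + i) (J1 β (k + l - (l + i)) F)) +
          (k - i) * ε (J1 β i (J1 β (k + l - i) F))) := by
      intro k l
      rw [coeff_zero_J2, Finset.mul_sum, ← Finset.sum_add_distrib]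
      refine Finset.sum_congr rfl fun i _ => ?_
      have h := fun j G => LinearMap.congr_fun (J2_mul_J1 hβ l j) G
      simp only [Module.End.mul_apply, LinearMap.sub_apply, LinearMap.smul_apply] at h
      have h1 : J1 β i (J1 β (k - i) (J2 β l F)) = J2 β l (J1 β i (J1 β (k - i) F)) +
          ((i : ℝ) / β) • J1 β (l + i) (J1 β (k + l - (l + i)) F) +
          (((k : ℝ) - i) / β) • J1 β i (J1 β (k + l - i) F) := by
        rw [h, h, map_sub, map_smul, show k + l - (l + i) = k - i by ring,
          show l + (k - i) = k + l - i by ring]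
        push_cast
        module
      rw [h1, map_add, map_add, map_smul, map_smul, coeff_zero_J2]
      simp only [smul_eq_mul, ε]
      ring
    have hswap : (∑ i ∈ Finset.Ioo 0 k, ∑ j ∈ Finset.Ioo 0 l,
          ε (J1 β j (J1 β (l - j) (J1 β i (J1 β (k - i) F))))) =
        ∑ j ∈ Finset.Ioo 0 l, ∑ i ∈ Finset.Ioo 0 k,
          ε (J1 β i (J1 β (k - i) (J1 β j (J1 β (l - j) F)))) := by
      rw [Finset.sum_comm]
      refine Finset.sum_congr rfl fun j hj => Finset.sum_congr rfl fun i hi => ?_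
      rw [Finset.mem_Ioo] at hi hj
      have hc : ∀ a c : ℤ, 0 < a → 0 < c → ∀ G, J1 β a (J1 β c G) = J1 β c (J1 β a G) := by
        intro a c ha hc G
        have := LinearMap.congr_fun (J1_mul_J1 (β := β) a c) G
        rw [if_neg (by omega), zero_smul, add_zero] at this
        exact this
      rw [hc (l - j) i (by omega) (by omega), hc j i (by omega) (by omega),
        hc (l - j) (k - i) (by omega) (by omega), hc j (k - i) (by omega) (by omega)]
    -- The anomaly of the Heisenberg relation, evaluated on the constant term of `F`, supplies `e`.
    have hfin := sum_Ioo_virasoro (b := fun i => ε (J1 β i (J1 β (k + l - i) F))) (k := k) (l := l)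
      (e := 1 / (2 * β) * ε F) (fun i hi => coeff_zero_J1 hi _) (fun i => by
        have := congrArg ε (LinearMap.congr_fun (J1_mul_J1 (β := β) i (k + l - i)) F)
        simp only [Module.End.mul_apply, LinearMap.add_apply, LinearMap.smul_apply, map_add,
          map_smul, Module.End.one_apply, smul_eq_mul] at this
        rw [this, sub_sub_cancel, add_sub_cancel]
        congr 1
        split_ifs <;> ring)
    have hlk := hε l k
    rw [add_comm l k] at hlk
    simp only [LinearMap.sub_apply, LinearMap.add_apply, LinearMap.smul_apply, map_sub, map_add,
      map_smul, Module.End.mul_apply, Module.End.one_apply, smul_eq_mul, hε k l, hlk, hswap]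
    have h0 := coeff_zero_J2 (β := β) (k + l) F
    change ε _ = ∑ i ∈ _, ε _ at h0
    rw [h0]
    have : ∀ a b c d e : ℝ, a + 1 / β * b - (a + 1 / β * c) - (d + e) =
        1 / β * (b - c) - (d + e) := by intros; ring
    rw [this, hfin]
    split_ifs <;> field_simp <;> ring

/-- The part `β J2` alone has central charge `1`. For `l = -k` the linear terms add
`(1+k)(1-k)(1-β)² k/(2β)`, which is `-6(1-β)²/β` times `(k³-k)/12`, while the terms containing `n`
form `2k` times the constant term of the zero mode. -/
theorem virasoro_relations (hβ : 0 < β) (n k l : ℤ) :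
    ⁅JJ2 β n k, JJ2 β n l⁆ = ((k : ℝ) - l) • JJ2 β n (k + l) +
      (if k = -l then (1 - 6 * (β ^ (1 / 2 : ℝ) - β ^ (-1 / 2 : ℝ)) ^ 2) *
        (((k : ℝ) ^ 3 - k) / 12) else 0) • (1 : Module.End ℝ TSeries) := by
  have h0 : β ≠ 0 := hβ.ne'
  have hsq : (β ^ (1 / 2 : ℝ) - β ^ (-1 / 2 : ℝ)) ^ 2 = (1 - β) ^ 2 / β := by
    have h1 : β ^ (1 / 2 : ℝ) * β ^ (1 / 2 : ℝ) = β := by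
      rw [← Real.rpow_add hβ]; norm_num
    have h2 : β ^ (-1 / 2 : ℝ) * β ^ (1 / 2 : ℝ) = 1 := by
      rw [← Real.rpow_add hβ]; norm_num
    have h3 : β ^ (-1 / 2 : ℝ) * β ^ (-1 / 2 : ℝ) = 1 / β := by
      rw [← Real.rpow_add hβ]; norm_num [Real.rpow_neg_one]
    rw [show (β ^ (1 / 2 : ℝ) - β ^ (-1 / 2 : ℝ)) ^ 2 = β ^ (1 / 2 : ℝ) * β ^ (1 / 2 : ℝ) -
      2 * (β ^ (-1 / 2 : ℝ) * β ^ (1 / 2 : ℝ)) + β ^ (-1 / 2 : ℝ) * β ^ (-1 / 2 : ℝ) by ring,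
      h1, h2, h3]
    field_simp
    ring
  rw [hsq, Ring.lie_def]
  have e1 := J2_mul_J2 h0 k l
  rw [sub_eq_iff_eq_add] at e1
  have e2 := J2_mul_J1 h0 k l
  have e3 := J2_mul_J1 h0 l k
  have e4 := J1_mul_J1 (β := β) k l
  have hJ0 : ∀ k : ℤ, J0 k = (if k = 0 then (1 : ℝ) else 0) • 1 := by
    intro k; rw [J0]; split_ifs <;> simp
  simp only [JJ2, hJ0, add_mul, mul_add, smul_mul_assoc, mul_smul_comm, e1, e2, e3, e4,
    mul_one, one_mul, smul_smul, add_comm l k]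
  by_cases h : k + l = 0
  · obtain rfl : l = -k := by omega
    simp only [add_neg_cancel, J1_zero, if_true, neg_neg]
    push_cast
    match_scalars <;> field_simp <;> ring
  · rw [if_neg h, if_neg h, if_neg h, if_neg (show ¬ k = -l by omega)]
    push_cast
    match_scalars <;> field_simp <;> ring

/-- The anomaly is the Heisenberg scalar `k/(2β)` times the linear coefficient `2nβ + (k+1)(1-β)`:
the first summand gives the zero mode of the right side, the second gives `c'`. -/
theorem virasoro_heisenberg_relations (hβ : β ≠ 0) (n k l : ℤ) :
    ⁅JJ2 β n k, JJ1 β n l⁆ = (-(l : ℝ)) • JJ1 β n (k + l) +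
      (if k = -l then (1 / 2 * (1 / β - 1)) * ((k : ℝ) * (k + 1)) else 0) •
        (1 : Module.End ℝ TSeries) := by
  rw [Ring.lie_def]
  have e2 := J2_mul_J1 hβ k l
  have e4 := J1_mul_J1 (β := β) k l
  have hJ0 : ∀ k : ℤ, J0 k = (if k = 0 then (1 : ℝ) else 0) • 1 := by
    intro k; rw [J0]; split_ifs <;> simp
  simp only [JJ2, JJ1, hJ0, add_mul, mul_add, smul_mul_assoc, mul_smul_comm, e2, e4,
    mul_one, one_mul, smul_smul]
  by_cases h : k + l = 0
  · obtain rfl : l = -k := by omega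
    simp only [add_neg_cancel, J1_zero, if_true, neg_neg]
    push_cast
    match_scalars <;> field_simp <;> ring
  · rw [if_neg h, if_neg h, if_neg (show ¬ k = -l by omega)]
    match_scalars <;> field_simp <;> ring

theorem heisenberg_relations (n k l : ℤ) :
    ⁅JJ1 β n k, JJ1 β n l⁆ =
      (if k = -l then (k : ℝ) / (2 * β) else 0) • (1 : Module.End ℝ TSeries) := by
  rw [Ring.lie_def]
  have e4 := J1_mul_J1 (β := β) k l
  have hJ0 : ∀ k : ℤ, J0 k = (if k = 0 then (1 : ℝ) else 0) • 1 := by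
    intro k; rw [J0]; split_ifs <;> simp
  simp only [JJ1, hJ0, add_mul, mul_add, smul_mul_assoc, mul_smul_comm, e4,
    mul_one, one_mul, smul_smul, ← eq_neg_iff_add_eq_zero]
  module

/-! ### Functions of polynomial growth -/

/-- The product set `U^n`. -/
abbrev cube (n : ℕ) (U : Set ℝ) : Set (Fin n → ℝ) := Set.univ.pi fun _ => U

/-- `φ` is continuous and of polynomial growth on `S ⊆ ℝ^n`. -/
def Tame {n : ℕ} (S : Set (Fin n → ℝ)) (φ : (Fin n → ℝ) → ℝ) : Prop :=
  ContinuousOn φ S ∧ ∃ C : ℝ, ∃ N : ℕ, 0 ≤ C ∧ ∀ z ∈ S, |φ z| ≤ C * ∏ k, (1 + |z k|) ^ N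

theorem one_le_prod_growth {n : ℕ} (s : Finset (Fin n)) (z : Fin n → ℝ) (N : ℕ) :
    1 ≤ ∏ k ∈ s, (1 + |z k|) ^ N :=
  Finset.prod_induction _ (1 ≤ ·) (fun _ _ => one_le_mul_of_one_le_of_one_le) le_rfl
    fun k _ => one_le_pow₀ (by linarith [abs_nonneg (z k)])

theorem one_le_growth {n : ℕ} (z : Fin n → ℝ) (N : ℕ) : 1 ≤ ∏ k, (1 + |z k|) ^ N :=
  one_le_prod_growth _ z N

theorem growth_mono {n : ℕ} (z : Fin n → ℝ) {N M : ℕ} (h : N ≤ M) :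
    ∏ k, (1 + |z k|) ^ N ≤ ∏ k, (1 + |z k|) ^ M :=
  Finset.prod_le_prod (fun k _ => by positivity) fun k _ =>
    pow_le_pow_right₀ (by linarith [abs_nonneg (z k)]) h

namespace Tame

variable {n : ℕ} {S T : Set (Fin n → ℝ)} {φ ψ : (Fin n → ℝ) → ℝ}

theorem mono (h : Tame S φ) (hTS : T ⊆ S) : Tame T φ := by
  obtain ⟨hc, C, N, hC, hb⟩ := h
  exact ⟨hc.mono hTS, C, N, hC, fun z hz => hb z (hTS hz)⟩

theorem congr (h : Tame S φ) (he : ∀ z ∈ S, ψ z = φ z) : Tame S ψ := by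
  obtain ⟨hc, C, N, hC, hb⟩ := h
  exact ⟨hc.congr he, C, N, hC, fun z hz => by rw [he z hz]; exact hb z hz⟩

theorem of_bounded (hc : ContinuousOn φ S) {C : ℝ} (hC : ∀ z ∈ S, |φ z| ≤ C) : Tame S φ :=
  ⟨hc, |C|, 0, abs_nonneg C, fun z hz => by simpa using (hC z hz).trans (le_abs_self C)⟩

theorem of_abs_le (h : Tame S φ) (hc : ContinuousOn ψ S) (hb : ∀ z ∈ S, |ψ z| ≤ |φ z|) :
    Tame S ψ := by
  obtain ⟨_, C, N, hC, h⟩ := h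
  exact ⟨hc, C, N, hC, fun z hz => (hb z hz).trans (h z hz)⟩

theorem const (a : ℝ) : Tame S fun _ => a :=
  of_bounded continuousOn_const (C := |a|) fun _ _ => le_rfl

theorem coord (k : Fin n) : Tame S fun z => z k := by
  refine ⟨(continuous_apply k).continuousOn, 1, 1, zero_le_one, fun z _ => ?_⟩
  rw [one_mul, ← Finset.mul_prod_erase _ _ (Finset.mem_univ k), pow_one]
  nlinarith [one_le_prod_growth (Finset.univ.erase k) z 1, abs_nonneg (z k)]

theorem add (hφ : Tame S φ) (hψ : Tame S ψ) : Tame S fun z => φ z + ψ z := by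
  obtain ⟨hc, C, N, hC, hb⟩ := hφ
  obtain ⟨hc', C', N', hC', hb'⟩ := hψ
  refine ⟨hc.add hc', C + C', max N N', by positivity, fun z hz => ?_⟩
  have h1 := mul_le_mul_of_nonneg_left (growth_mono z (le_max_left N N')) hC
  have h2 := mul_le_mul_of_nonneg_left (growth_mono z (le_max_right N N')) hC'
  rw [add_mul]
  linarith [abs_add_le (φ z) (ψ z), hb z hz, hb' z hz]

theorem mul (hφ : Tame S φ) (hψ : Tame S ψ) : Tame S fun z => φ z * ψ z := by
  obtain ⟨hc, C, N, hC, hb⟩ := hφ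
  obtain ⟨hc', C', N', hC', hb'⟩ := hψ
  refine ⟨hc.mul hc', C * C', N + N', by positivity, fun z hz => ?_⟩
  simp only [pow_add, Finset.prod_mul_distrib]
  rw [abs_mul, mul_mul_mul_comm]
  exact mul_le_mul (hb z hz) (hb' z hz) (abs_nonneg _)
    (mul_nonneg hC (zero_le_one.trans (one_le_growth z N)))

theorem const_mul (a : ℝ) (hφ : Tame S φ) : Tame S fun z => a * φ z := (const a).mul hφ

theorem neg (hφ : Tame S φ) : Tame S fun z => -φ z :=
  (hφ.const_mul (-1)).congr fun z _ => by ring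

theorem sub (hφ : Tame S φ) (hψ : Tame S ψ) : Tame S fun z => φ z - ψ z :=
  (hφ.add hψ.neg).congr fun z _ => by ring

theorem sum {ι : Type*} (s : Finset ι) {φ : ι → (Fin n → ℝ) → ℝ} (h : ∀ i ∈ s, Tame S (φ i)) :
    Tame S fun z => ∑ i ∈ s, φ i z := by
  classical
  induction s using Finset.induction_on with
  | empty => simpa using const 0
  | insert a s ha ih =>
    simp only [Finset.sum_insert ha]
    exact (h a (by simp)).add (ih fun i hi => h i (by simp [hi]))

theorem prod {ι : Type*} (s : Finset ι) {φ : ι → (Fin n → ℝ) → ℝ} (h : ∀ i ∈ s, Tame S (φ i)) :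
    Tame S fun z => ∏ i ∈ s, φ i z := by
  classical
  induction s using Finset.induction_on with
  | empty => simpa using const 1
  | insert a s ha ih =>
    simp only [Finset.prod_insert ha]
    exact (h a (by simp)).mul (ih fun i hi => h i (by simp [hi]))

theorem pow (hφ : Tame S φ) (e : ℕ) : Tame S fun z => φ z ^ e := by
  simpa using prod (Finset.range e) fun _ _ => hφ

/-- The growth factor is at least `1`, so its real power `b` is dominated by the integer power
`⌈b⌉₊`; positivity of `b` keeps the power continuous at zeros of `φ`. -/
theorem abs_rpow (hφ : Tame S φ) {b : ℝ} (hb : 0 < b) : Tame S fun z => |φ z| ^ b := by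
  obtain ⟨hc, C, N, hC, h⟩ := hφ
  refine ⟨hc.abs.rpow_const fun _ _ => Or.inr hb.le, C ^ b, N * ⌈b⌉₊, by positivity,
    fun z hz => ?_⟩
  have h1 := zero_le_one.trans (one_le_growth z N)
  rw [abs_of_nonneg (by positivity)]
  refine (Real.rpow_le_rpow (abs_nonneg _) (h z hz) hb.le).trans ?_
  rw [Real.mul_rpow hC h1]
  refine mul_le_mul_of_nonneg_left ?_ (by positivity)
  refine (Real.rpow_le_rpow_of_exponent_le (one_le_growth z N) (Nat.le_ceil b)).trans ?_
  rw [Real.rpow_natCast, ← Finset.prod_pow]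
  simp only [pow_mul, le_refl]

theorem poly (p : Polynomial ℝ) (k : Fin n) : Tame S fun z => p.eval (z k) := by
  simp only [Polynomial.eval_eq_sum_range]
  exact sum _ fun i _ => ((coord k).pow i).const_mul _

theorem insertNth {U : Set ℝ} {φ : (Fin (n + 1) → ℝ) → ℝ} (h : Tame (cube (n + 1) U) φ)
    (k : Fin (n + 1)) {u : ℝ} (hu : u ∈ U) :
    Tame (cube n U) fun z => φ (k.insertNth u z) := by
  obtain ⟨hc, C, N, hC, hb⟩ := h
  have hmem : ∀ z ∈ cube n U, (k.insertNth u z : Fin (n + 1) → ℝ) ∈ cube (n + 1) U := by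
    intro z hz i _
    rcases k.eq_self_or_eq_succAbove i with rfl | ⟨j, rfl⟩
    · simpa using hu
    · simpa using hz j (Set.mem_univ j)
  refine ⟨hc.comp (Continuous.continuousOn (by fun_prop)) hmem, C * (1 + |u|) ^ N, N,
    by positivity, fun z hz => ?_⟩
  have := hb _ (hmem z hz)
  rwa [Fin.prod_univ_succAbove _ k, Fin.insertNth_apply_same, ← mul_assoc,
    Finset.prod_congr rfl fun i _ => by rw [Fin.insertNth_apply_succAbove]] at this

end Tame

/-! ### Finite moments and integration over product sets. -/

theorem insertNth_mem_cube {n : ℕ} {U : Set ℝ} (k : Fin (n + 1)) {u : ℝ} (hu : u ∈ U)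
    {z : Fin n → ℝ} (hz : z ∈ cube n U) : (k.insertNth u z : Fin (n + 1) → ℝ) ∈ cube (n + 1) U := by
  intro i _
  rcases k.eq_self_or_eq_succAbove i with rfl | ⟨j, rfl⟩
  · simpa using hu
  · simpa using hz j (Set.mem_univ j)

theorem measurableSet_cube {n : ℕ} {E : Set ℝ} (hE : MeasurableSet E) :
    MeasurableSet (cube n E) := MeasurableSet.univ_pi fun _ => hE

theorem restrict_cube {n : ℕ} (E : Set ℝ) :
    (volume : Measure (Fin n → ℝ)).restrict (cube n E) =
      Measure.pi fun _ => (volume : Measure ℝ).restrict E := by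
  rw [volume_pi, Measure.restrict_pi_pi]

/-- All moments of `ρ` on `E` are finite. -/
def HasMoments (ρ : ℝ → ℝ) (E : Set ℝ) : Prop :=
  ∀ N : ℕ, IntegrableOn (fun z => (1 + |z|) ^ N * ρ z) E

namespace HasMoments

variable {ρ : ℝ → ℝ} {E : Set ℝ}

theorem mono {F : Set ℝ} (h : HasMoments ρ E) (hFE : F ⊆ E) : HasMoments ρ F :=
  fun N => (h N).mono_set hFE

theorem integrable_prod (h : HasMoments ρ E) (n N : ℕ) :
    IntegrableOn (fun z : Fin n → ℝ => ∏ k, ((1 + |z k|) ^ N * ρ (z k))) (cube n E) := by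
  rw [IntegrableOn, restrict_cube]
  exact Integrable.fintype_prod fun _ => h N

theorem aestronglyMeasurable_prod (h : HasMoments ρ E) (n : ℕ) :
    AEStronglyMeasurable (fun z : Fin n → ℝ => ∏ k, ρ (z k)) (volume.restrict (cube n E)) := by
  simpa using (h.integrable_prod n 0).aestronglyMeasurable

theorem integrableOn {n : ℕ} (h : HasMoments ρ E) (hE : MeasurableSet E) {φ : (Fin n → ℝ) → ℝ}
    (hφ : Tame (cube n E) φ) : IntegrableOn (fun z => φ z * ∏ k, ρ (z k)) (cube n E) := by
  obtain ⟨hc, C, N, hC, hb⟩ := hφ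
  refine ((h.integrable_prod n N).norm.const_mul C).mono'
    ((hc.aestronglyMeasurable (measurableSet_cube hE)).mul (h.aestronglyMeasurable_prod n)) ?_
  filter_upwards [ae_restrict_mem (measurableSet_cube hE)] with z hz
  simp only [Finset.prod_mul_distrib, norm_mul, Real.norm_eq_abs]
  rw [← mul_assoc]
  refine mul_le_mul_of_nonneg_right ((hb z hz).trans_eq ?_) (abs_nonneg _)
  rw [abs_of_nonneg (zero_le_one.trans (one_le_growth z N))]

end HasMoments

/-- Fubini's theorem on `E^{n+1}`, with the `k`-th variable as the inner one. -/
theorem setIntegral_cube_succ {n : ℕ} {E : Set ℝ} (k : Fin (n + 1)) {F : (Fin (n + 1) → ℝ) → ℝ}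
    (hF : IntegrableOn F (cube (n + 1) E)) :
    ∫ z in cube (n + 1) E, F z = ∫ z in cube n E, ∫ u in E, F (k.insertNth u z) := by
  have hmp := (measurePreserving_piFinSuccAbove
    (fun _ : Fin (n + 1) => (volume : Measure ℝ).restrict E) k).symm
  rw [IntegrableOn, restrict_cube] at hF
  rw [restrict_cube, restrict_cube, ← hmp.integral_comp']
  rw [integral_prod_symm]
  · rfl
  · exact (hmp.integrable_comp_emb (MeasurableEquiv.measurableEmbedding _)).2 hF

/-! ### One-dimensional facts about rational weights -/

/-- A positive solution of `ρ' = q ρ` does not tend to zero where `q` is continuous. -/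
theorem not_tendsto_zero_right {ρ q : ℝ → ℝ} {a b : ℝ} (hab : a < b) (hq : ContinuousAt q a)
    (hρ : ∀ x ∈ Set.Ioo a b, 0 < ρ x) (hd : ∀ x ∈ Set.Ioo a b, HasDerivAt ρ (q x * ρ x) x) :
    ¬ Tendsto ρ (𝓝[>] a) (𝓝 0) := by
  intro h0
  -- Near `a` one has `q < M`, hence `ρ e^{-Mx}` is decreasing there and its limit at `a` is at
  -- least its positive value at a later point.
  set M := |q a| + 1
  have hM : ∀ᶠ x in 𝓝[>] a, q x < M :=
    (hq.eventually_lt_const (by linarith [le_abs_self (q a)])).filter_mono nhdsWithin_le_nhds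
  obtain ⟨c, hc, hcM⟩ := (mem_nhdsGT_iff_exists_Ioo_subset).1
    (hM.and (Ioo_mem_nhdsGT hab))
  have hca : a < c := hc
  have hd' : ∀ x ∈ Set.Ioo a c, HasDerivAt (fun x => ρ x * Real.exp (-(M * x)))
      (q x * ρ x * Real.exp (-(M * x)) + ρ x * (Real.exp (-(M * x)) * -M)) x := by
    intro x hx
    refine (hd x (hcM hx).2).mul ?_
    have := ((hasDerivAt_id x).const_mul M).neg.exp
    simpa using this
  have hanti : AntitoneOn (fun x => ρ x * Real.exp (-(M * x))) (Set.Ioo a c) := by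
    refine antitoneOn_of_deriv_nonpos (convex_Ioo a c)
      (fun x hx => (hd' x hx).continuousAt.continuousWithinAt) ?_ ?_
    · rw [interior_Ioo]
      exact fun x hx => (hd' x hx).differentiableAt.differentiableWithinAt
    · rw [interior_Ioo]
      intro x hx
      rw [(hd' x hx).deriv]
      have h1 := hρ x (hcM hx).2
      have h2 : q x < M := (hcM hx).1
      have h3 := Real.exp_pos (-(M * x))
      nlinarith [mul_pos (mul_pos h1 h3) (sub_pos.2 h2)]
  set x₁ := (a + c) / 2
  have hx₁ : x₁ ∈ Set.Ioo a c := ⟨by simp only [x₁]; linarith, by simp only [x₁]; linarith⟩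
  have hlim : Tendsto (fun x => ρ x * Real.exp (-(M * x))) (𝓝[>] a)
      (𝓝 (0 * Real.exp (-(M * a)))) :=
    h0.mul ((Continuous.tendsto (by fun_prop) a).mono_left nhdsWithin_le_nhds)
  have hge := ge_of_tendsto hlim (b := ρ x₁ * Real.exp (-(M * x₁))) (by
    filter_upwards [Ioo_mem_nhdsGT hx₁.1] with x hx
    exact hanti ⟨hx.1, hx.2.trans hx₁.2⟩ hx₁ hx.2.le)
  have := mul_pos (hρ x₁ (hcM hx₁).2) (Real.exp_pos (-(M * x₁)))
  linarith

theorem not_tendsto_zero_left {ρ q : ℝ → ℝ} {a b : ℝ} (hab : a < b) (hq : ContinuousAt q b)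
    (hρ : ∀ x ∈ Set.Ioo a b, 0 < ρ x) (hd : ∀ x ∈ Set.Ioo a b, HasDerivAt ρ (q x * ρ x) x) :
    ¬ Tendsto ρ (𝓝[<] b) (𝓝 0) := by
  intro h0
  have hmem : ∀ x ∈ Set.Ioo (-b) (-a), -x ∈ Set.Ioo a b := fun x hx =>
    ⟨by linarith [hx.2], by linarith [hx.1]⟩
  refine not_tendsto_zero_right (ρ := fun x => ρ (-x)) (q := fun x => -q (-x)) (neg_lt_neg hab)
    ?_ (fun x hx => hρ _ (hmem x hx)) (fun x hx => ?_) (h0.comp (tendsto_neg_nhdsGT_neg (a := b)))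
  · exact (ContinuousAt.comp (by simpa using hq) continuous_neg.continuousAt).neg
  · have := (hd _ (hmem x hx)).comp x (hasDerivAt_neg x)
    exact this.congr_deriv (by ring)

/-- If `w = q ρ` has an integrable derivative, `ρ` is integrable and `q` vanishes at `a`, then
`w` tends to zero at `a`. -/
theorem tendsto_zero_right_of_integrable {w w' ρ q : ℝ → ℝ} {a b C : ℝ} (hab : a < b)
    (hw : ∀ x ∈ Set.Ioo a b, w x = q x * ρ x)
    (hd : ∀ x ∈ Set.Ioo a b, HasDerivAt w (w' x) x) (hw' : IntegrableOn w' (Set.Ioo a b))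
    (hρ : IntegrableOn ρ (Set.Ioo a b)) (hq : ∀ᶠ x in 𝓝[>] a, |q x| ≤ C * (x - a)) :
    Tendsto w (𝓝[>] a) (𝓝 0) := by
  set x₁ := (a + b) / 2
  have hx₁ : x₁ ∈ Set.Ioo a b := ⟨by simp only [x₁]; linarith, by simp only [x₁]; linarith⟩
  have hint : IntegrableOn w' (Set.uIcc a x₁) := by
    rw [Set.uIcc_of_le hx₁.1.le, integrableOn_Icc_iff_integrableOn_Ioo]
    exact hw'.mono_set (Set.Ioo_subset_Ioo_right hx₁.2.le)
  have hprim := (intervalIntegral.continuousOn_primitive_interval_left hint) a Set.left_mem_uIcc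
  have hFTC : ∀ x ∈ Set.Ioo a x₁, w x₁ - ∫ t in x..x₁, w' t = w x := by
    intro x hx
    rw [intervalIntegral.integral_eq_sub_of_hasDerivAt (f := w), sub_sub_cancel]
    · intro y hy
      rw [Set.uIcc_of_le hx.2.le] at hy
      exact hd y ⟨hx.1.trans_le hy.1, hy.2.trans_lt hx₁.2⟩
    · rw [intervalIntegrable_iff_integrableOn_Icc_of_le hx.2.le]
      refine hint.mono_set ?_
      rw [Set.uIcc_of_le hx₁.1.le]
      exact Set.Icc_subset_Icc_left hx.1.le
  -- Integrability of `w'` up to `a` gives the existence of the limit; the remaining question is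
  -- whether it is zero.
  set L := w x₁ - ∫ t in a..x₁, w' t
  have hL : Tendsto w (𝓝[>] a) (𝓝 L) := by
    have h1 : Tendsto (fun x => w x₁ - ∫ t in x..x₁, w' t) (𝓝[>] a) (𝓝 L) := by
      refine tendsto_const_nhds.sub (hprim.mono_left ?_)
      rw [Set.uIcc_of_le hx₁.1.le, ← nhdsWithin_Ioc_eq_nhdsGT hx₁.1]
      exact nhdsWithin_mono _ Set.Ioc_subset_Icc_self
    refine h1.congr' ?_
    filter_upwards [Ioo_mem_nhdsGT hx₁.1] with x hx using hFTC x hx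
  by_cases hL0 : L = 0
  · rwa [hL0] at hL
  -- A limit `L ≠ 0` would give `|L|/2 < |q ρ| ≤ C (x - a) |ρ|` near `a`, so the integrable function
  -- `ρ` would dominate a multiple of `1/(x - a)`.
  exfalso
  have hLpos : 0 < |L| := abs_pos.2 hL0
  have hev : ∀ᶠ x in 𝓝[>] a, |L| / 2 < |w x| := hL.abs.eventually_const_lt (by linarith)
  obtain ⟨c, hc, hcM⟩ := (mem_nhdsGT_iff_exists_Ioo_subset).1
    ((hev.and hq).and (Ioo_mem_nhdsGT hab))
  have hca : a < c := hc
  have hsub : Set.Ioo a c ⊆ Set.Ioo a b := fun x hx => (hcM hx).2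
  have hinv : IntegrableOn (fun x => (x - a)⁻¹) (Set.Ioo a c) := by
    refine ((hρ.mono_set hsub).norm.const_mul (2 * C / |L|)).mono' ?_ ?_
    · exact (Measurable.aestronglyMeasurable (by fun_prop))
    · filter_upwards [ae_restrict_mem measurableSet_Ioo] with x hx
      obtain ⟨⟨h1, h2⟩, h3⟩ := hcM hx
      have hxa : 0 < x - a := sub_pos.2 hx.1
      rw [hw x h3, abs_mul] at h1
      have := mul_le_mul_of_nonneg_right h2 (abs_nonneg (ρ x))
      rw [Real.norm_eq_abs, Real.norm_eq_abs, abs_of_pos (inv_pos.2 hxa), inv_eq_one_div,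
        div_le_iff₀ hxa, div_mul_eq_mul_div, div_mul_eq_mul_div, one_le_div hLpos]
      linarith
  rw [← intervalIntegrable_iff_integrableOn_Ioo_of_le hca.le, intervalIntegrable_sub_inv_iff] at hinv
  rcases hinv with h | h
  · exact hca.ne h
  · exact h Set.left_mem_uIcc

theorem tendsto_zero_left_of_integrable {w w' ρ q : ℝ → ℝ} {a b C : ℝ} (hab : a < b)
    (hw : ∀ x ∈ Set.Ioo a b, w x = q x * ρ x)
    (hd : ∀ x ∈ Set.Ioo a b, HasDerivAt w (w' x) x) (hw' : IntegrableOn w' (Set.Ioo a b))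
    (hρ : IntegrableOn ρ (Set.Ioo a b)) (hq : ∀ᶠ x in 𝓝[<] b, |q x| ≤ C * (b - x)) :
    Tendsto w (𝓝[<] b) (𝓝 0) := by
  have hmem : ∀ x ∈ Set.Ioo (-b) (-a), -x ∈ Set.Ioo a b := fun x hx =>
    ⟨by linarith [hx.2], by linarith [hx.1]⟩
  have hpre : Set.Ioo (-b) (-a) = (fun x : ℝ => -x) ⁻¹' Set.Ioo a b := by
    ext x; simp only [Set.mem_Ioo, Set.mem_preimage]; constructor <;> rintro ⟨h1, h2⟩ <;>
      constructor <;> linarith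
  have hI : ∀ {F : ℝ → ℝ}, IntegrableOn F (Set.Ioo a b) →
      IntegrableOn (fun x => F (-x)) (Set.Ioo (-b) (-a)) := by
    intro F hF
    rw [hpre]
    exact ((Measure.measurePreserving_neg (volume : Measure ℝ)).integrableOn_comp_preimage
      (Homeomorph.neg ℝ).measurableEmbedding).2 hF
  have h := tendsto_zero_right_of_integrable (w := fun x => w (-x)) (w' := fun x => -w' (-x))
    (ρ := fun x => ρ (-x)) (q := fun x => q (-x)) (C := C) (neg_lt_neg hab)
    (fun x hx => hw _ (hmem x hx)) (fun x hx => by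
      have := (hd _ (hmem x hx)).comp x (hasDerivAt_neg x)
      exact this.congr_deriv (by ring)) (hI hw').neg (hI hρ) (by
      filter_upwards [(tendsto_neg_nhdsGT_neg (a := b)).eventually hq] with x hx
      refine hx.trans_eq ?_
      ring)
  have h2 := h.comp (f := fun x => -x) (x := 𝓝[<] b) tendsto_neg_nhdsLT
  simpa [Function.comp_def] using h2

theorem measurableSet_range (a b : EReal) : MeasurableSet (range a b) :=
  (measurableSet_le measurable_const measurable_coe_real_ereal).inter
    (measurableSet_le measurable_coe_real_ereal measurable_const)

theorem eventually_eval_ne_zero {f : Polynomial ℝ} (hf : f ≠ 0) (z : ℝ) :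
    ∀ᶠ x in 𝓝[≠] z, f.eval x ≠ 0 := by
  have h : ({x : ℝ | f.IsRoot x} \ {z}).Finite :=
    (Polynomial.finite_setOfPred_isRoot hf).subset Set.sdiff_subset
  have h2 : ∀ᶠ x in 𝓝 z, x ∉ {x : ℝ | f.IsRoot x} \ {z} :=
    h.isClosed.isOpen_compl.mem_nhds (by simp)
  filter_upwards [nhdsWithin_le_nhds h2, self_mem_nhdsWithin] with x hx hxz h0
  exact hx ⟨h0, hxz⟩

theorem eventually_abs_eval_le {f : Polynomial ℝ} {z : ℝ} (hz : f.eval z = 0) :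
    ∃ C : ℝ, ∀ᶠ x in 𝓝 z, |f.eval x| ≤ C * |x - z| := by
  obtain ⟨C, hC⟩ := (f.hasDerivAt z).isBigO_sub.bound
  exact ⟨C, by simpa [hz] using hC⟩

namespace IsRationalWeight

variable {A B : EReal} {ρ : ℝ → ℝ} {f g : Polynomial ℝ}

theorem tendsto_comap_right {z : ℝ} :
    Tendsto id (𝓝[>] z) (comap ((↑) : ℝ → EReal) (𝓝[>] (z : EReal))) := by
  rw [tendsto_comap_iff]
  refine tendsto_nhdsWithin_iff.2 ⟨?_, ?_⟩
  · exact (continuous_coe_real_ereal.tendsto z).mono_left nhdsWithin_le_nhds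
  · filter_upwards [self_mem_nhdsWithin] with x hx
    exact EReal.coe_lt_coe_iff.2 hx

theorem tendsto_comap_left {z : ℝ} :
    Tendsto id (𝓝[<] z) (comap ((↑) : ℝ → EReal) (𝓝[<] (z : EReal))) := by
  rw [tendsto_comap_iff]
  refine tendsto_nhdsWithin_iff.2 ⟨?_, ?_⟩
  · exact (continuous_coe_real_ereal.tendsto z).mono_left nhdsWithin_le_nhds
  · filter_upwards [self_mem_nhdsWithin] with x hx
    exact EReal.coe_lt_coe_iff.2 hx

/-- The polynomial `f` vanishes at the finite end points of `[A, B]`. -/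
theorem mem_interior (hw : IsRationalWeight A B ρ f g) {z : ℝ} (hz : z ∈ range A B)
    (hf : f.eval z ≠ 0) : A < z ∧ (z : EReal) < B := by
  have hq : ContinuousAt (fun x => -(g.eval x / f.eval x)) z :=
    (g.continuous.continuousAt.div f.continuous.continuousAt hf).neg
  have hne : ∀ᶠ x in 𝓝 z, f.eval x ≠ 0 := f.continuous.continuousAt.eventually_ne hf
  have hρ : ∀ {l : Filter ℝ}, l ≤ 𝓝 z → Tendsto (fun x => f.eval x * ρ x * x ^ 0) l (𝓝 0) →
      Tendsto ρ l (𝓝 0) := by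
    intro l hl h
    have h1 := h.div ((f.continuous.tendsto z).mono_left hl) hf
    rw [zero_div] at h1
    refine h1.congr' ?_
    filter_upwards [hl hne] with x hx
    rw [Pi.div_apply, pow_zero, mul_one]
    exact mul_div_cancel_left₀ _ hx
  constructor
  -- If `z` were the end point, then `f ≠ 0` near `z` and the decay of `fρ` would make `ρ` tend to
  -- zero, which a positive solution of `ρ' = -(g/f) ρ` with continuous coefficient at `z` cannot
  -- do.
  · refine lt_of_le_of_ne hz.1 fun h => ?_
    obtain ⟨b, hzb, hbB⟩ := EReal.lt_iff_exists_real_btwn.1 (h ▸ hw.lt)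
    obtain ⟨c, hc, hcM⟩ := (mem_nhdsGT_iff_exists_Ioo_subset).1
      ((hne.filter_mono nhdsWithin_le_nhds).and (Ioo_mem_nhdsGT (EReal.coe_lt_coe_iff.1 hzb)))
    have hin : ∀ x ∈ Set.Ioo z c, A < x ∧ (x : EReal) < B ∧ f.eval x ≠ 0 := fun x hx =>
      ⟨h ▸ EReal.coe_lt_coe_iff.2 hx.1, (EReal.coe_lt_coe_iff.2 (hcM hx).2.2).trans hbB,
        (hcM hx).1⟩
    refine not_tendsto_zero_right (b := c) hc hq
      (fun x hx => hw.pos x (hin x hx).1 (hin x hx).2.1 (hin x hx).2.2)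
      (fun x hx => hw.hasDerivAt x (hin x hx).1 (hin x hx).2.1 (hin x hx).2.2)
      (hρ nhdsWithin_le_nhds ?_)
    have := hw.tendsto_left 0
    rw [h] at this
    exact this.comp tendsto_comap_right
  · refine lt_of_le_of_ne hz.2 fun h => ?_
    obtain ⟨b, hAb, hbz⟩ := EReal.lt_iff_exists_real_btwn.1 (h ▸ hw.lt)
    obtain ⟨c, hc, hcM⟩ := (mem_nhdsLT_iff_exists_Ioo_subset).1
      ((hne.filter_mono nhdsWithin_le_nhds).and (Ioo_mem_nhdsLT (EReal.coe_lt_coe_iff.1 hbz)))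
    have hin : ∀ x ∈ Set.Ioo c z, A < x ∧ (x : EReal) < B ∧ f.eval x ≠ 0 := fun x hx =>
      ⟨hAb.trans (EReal.coe_lt_coe_iff.2 (hcM hx).2.1), h ▸ EReal.coe_lt_coe_iff.2 hx.2,
        (hcM hx).1⟩
    refine not_tendsto_zero_left (a := c) hc hq
      (fun x hx => hw.pos x (hin x hx).1 (hin x hx).2.1 (hin x hx).2.2)
      (fun x hx => hw.hasDerivAt x (hin x hx).1 (hin x hx).2.1 (hin x hx).2.2)
      (hρ nhdsWithin_le_nhds ?_)
    have := hw.tendsto_right 0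
    rw [← h] at this
    exact this.comp tendsto_comap_left

/-- The factor `f` cancels the denominator of `ρ'/ρ`. This is why all test functions carry the
factor `f`: the derivative of `fρ` is a polynomial times `ρ`. -/
theorem hasDerivAt_mul (hw : IsRationalWeight A B ρ f g) {z : ℝ} (hA : A < z)
    (hB : (z : EReal) < B) (hf : f.eval z ≠ 0) :
    HasDerivAt (fun x => f.eval x * ρ x) ((f.derivative - g).eval z * ρ z) z := by
  refine ((f.hasDerivAt z).mul (hw.hasDerivAt z hA hB hf)).congr_deriv ?_
  rw [Polynomial.eval_sub]
  field_simp
  ring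

theorem tendsto_atTop (hw : IsRationalWeight A B ρ f g) (hB : B = ⊤) (k : ℕ) :
    Tendsto (fun z => f.eval z * ρ z * z ^ k) atTop (𝓝 0) := by
  refine (hw.tendsto_right k).comp (f := id) (tendsto_comap_iff.2 ?_)
  rw [hB]
  exact tendsto_nhdsWithin_iff.2 ⟨EReal.tendsto_coe_atTop,
    Eventually.of_forall fun x => EReal.coe_lt_top x⟩

theorem tendsto_atBot (hw : IsRationalWeight A B ρ f g) (hA : A = ⊥) (k : ℕ) :
    Tendsto (fun z => f.eval z * ρ z * z ^ k) atBot (𝓝 0) := by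
  refine (hw.tendsto_left k).comp (f := id) (tendsto_comap_iff.2 ?_)
  rw [hA]
  exact tendsto_nhdsWithin_iff.2 ⟨EReal.tendsto_coe_atBot,
    Eventually.of_forall fun x => EReal.bot_lt_coe x⟩

theorem eventually_le_one (hw : IsRationalWeight A B ρ f g) (k : ℕ) :
    ∀ᶠ z in atBot ⊔ atTop, z ∈ range A B → |f.eval z * ρ z * z ^ k| ≤ 1 := by
  rw [eventually_sup]
  constructor
  · by_cases hA : A = ⊥
    · have := (hw.tendsto_atBot hA k).abs.eventually_le_const (u := 1) (by simp)
      filter_upwards [this] with z hz _ using hz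
    · obtain ⟨a, ha⟩ : ∃ a : ℝ, (a : EReal) = A :=
        ⟨A.toReal, EReal.coe_toReal (hw.lt.trans_le le_top).ne hA⟩
      filter_upwards [eventually_lt_atBot a] with z hz hzr
      rw [← ha] at hzr
      exact absurd (EReal.coe_le_coe_iff.1 hzr.1) (not_le.2 hz)
  · by_cases hB : B = ⊤
    · have := (hw.tendsto_atTop hB k).abs.eventually_le_const (u := 1) (by simp)
      filter_upwards [this] with z hz _ using hz
    · obtain ⟨b, hb⟩ : ∃ b : ℝ, (b : EReal) = B :=
        ⟨B.toReal, EReal.coe_toReal hB (bot_le.trans_lt hw.lt).ne'⟩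
      filter_upwards [eventually_gt_atTop b] with z hz hzr
      rw [← hb] at hzr
      exact absurd (EReal.coe_le_coe_iff.1 hzr.2) (not_le.2 hz)

/-- Allows `f` to be divided out of the decay condition at infinity. -/
theorem exists_pos_le_eval {f : Polynomial ℝ} (hf : f ≠ 0) :
    ∃ δ > 0, ∀ᶠ z in atBot ⊔ atTop, δ ≤ |f.eval z| := by
  by_cases hd : 0 < f.degree
  · refine ⟨1, one_pos, ?_⟩
    refine (f.tendsto_norm_atTop hd (l := atBot ⊔ atTop) (z := id) ?_).eventually_ge_atTop 1
    exact tendsto_sup.2 ⟨tendsto_abs_atBot_atTop, tendsto_abs_atTop_atTop⟩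
  · rw [Polynomial.eq_C_of_degree_le_zero (not_lt.1 hd)] at hf ⊢
    refine ⟨|f.coeff 0|, abs_pos.2 fun h => hf (by rw [h, Polynomial.C_0]), ?_⟩
    simp

/-- Far out, `|f| ≥ δ` and `|f ρ z^{N+2}| ≤ 1` make `(1+|z|)^N |ρ|` at most a multiple of
`1/(1+z²)`; the two extra powers are there for integrability. On the bounded remainder the weight
`(1+|z|)^N` is bounded and integrability of `ρ` is enough. -/
theorem hasMoments (hw : IsRationalWeight A B ρ f g) {E : Set ℝ} (hE : MeasurableSet E)
    (hEF : E ⊆ range A B) (hρ : IntegrableOn ρ E) : HasMoments ρ E := by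
  intro N
  obtain ⟨δ, hδ, hev⟩ := exists_pos_le_eval hw.f_ne_zero
  have hev2 := (hev.and (hw.eventually_le_one (N + 2)))
  rw [← IsOrderBornology.cobounded_eq, ← comap_norm_atTop, eventually_comap,
    eventually_atTop] at hev2
  obtain ⟨M₀, hM₀⟩ := hev2
  set M := max M₀ 1
  have hM : ∀ z ∈ E, M ≤ |z| → (1 + |z|) ^ N * |ρ z| ≤ 2 ^ (N + 1) / δ * (1 + z ^ 2)⁻¹ := by
    intro z hzE hz
    obtain ⟨h1, h2⟩ := hM₀ |z| ((le_max_left _ _).trans hz) z rfl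
    have h3 := h2 (hEF hzE)
    have h4 : 1 ≤ |z| := (le_max_right _ _).trans hz
    rw [abs_mul, abs_mul, abs_pow] at h3
    have h5 : (1 + |z|) ^ N ≤ 2 ^ N * |z| ^ N := by
      rw [← mul_pow]
      exact pow_le_pow_left₀ (by positivity) (by linarith) N
    have h6 : δ * |ρ z| * |z| ^ (N + 2) ≤ 1 := le_trans (by gcongr) h3
    have h7 : 1 + z ^ 2 ≤ 2 * |z| ^ 2 := by rw [sq_abs]; nlinarith [sq_abs z]
    rw [← div_eq_mul_inv, div_div, le_div_iff₀ (by positivity)]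
    calc (1 + |z|) ^ N * |ρ z| * (δ * (1 + z ^ 2))
        ≤ 2 ^ N * |z| ^ N * |ρ z| * (δ * (2 * |z| ^ 2)) := by gcongr
      _ = 2 ^ (N + 1) * (δ * |ρ z| * |z| ^ (N + 2)) := by ring
      _ ≤ 2 ^ (N + 1) * 1 := by gcongr
      _ = 2 ^ (N + 1) := mul_one _
  refine ((hρ.norm.const_mul ((1 + M) ^ N)).add
    (integrable_inv_one_add_sq.integrableOn.const_mul (2 ^ (N + 1) / δ))).mono'
    ((Continuous.aestronglyMeasurable (by fun_prop)).mul hρ.aestronglyMeasurable) ?_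
  filter_upwards [ae_restrict_mem hE] with z hz
  have h0 : 0 ≤ 2 ^ (N + 1) / δ * (1 + z ^ 2)⁻¹ := by positivity
  have h1 : (0 : ℝ) < 1 + |z| := by positivity
  simp only [Pi.add_apply, norm_mul, norm_pow, Real.norm_eq_abs, abs_of_pos h1]
  rcases le_or_gt M |z| with h | h
  · have : 0 ≤ (1 + M) ^ N * |ρ z| := by
      have : 0 ≤ M := zero_le_one.trans (le_max_right _ _)
      positivity
    linarith [hM z hz h]
  · have : (1 + |z|) ^ N * |ρ z| ≤ (1 + M) ^ N * |ρ z| := by gcongr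
    linarith

/-- Off the zeros of `f` the product is differentiable. At a zero its value is `0` whatever `ρ` is
there, and both one-sided limits are `0` because `(f' - g)ρ` and `ρ` are integrable and `f` vanishes
at least linearly. -/
theorem continuousOn_mul (hw : IsRationalWeight A B ρ f g) {a b : ℝ}
    (hEF : Set.Icc a b ⊆ range A B) (hρ : IntegrableOn ρ (Set.Icc a b)) :
    ContinuousOn (fun x => f.eval x * ρ x) (Set.Icc a b) := by
  intro z hz
  by_cases hf : f.eval z = 0
  swap
  · obtain ⟨h1, h2⟩ := hw.mem_interior (hEF hz) hf
    exact (hw.hasDerivAt_mul h1 h2 hf).continuousAt.continuousWithinAt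
  obtain ⟨C, hC⟩ := eventually_abs_eval_le hf
  have hne := eventually_eval_ne_zero hw.f_ne_zero z
  have hd : ∀ {a' b' : ℝ}, Set.Ioo a' b' ⊆ {x | f.eval x ≠ 0} → Set.Ioo a' b' ⊆ Set.Icc a b →
      (∀ x ∈ Set.Ioo a' b', HasDerivAt (fun x => f.eval x * ρ x)
        ((f.derivative - g).eval x * ρ x) x) ∧
      IntegrableOn (fun x => (f.derivative - g).eval x * ρ x) (Set.Ioo a' b') ∧
      IntegrableOn ρ (Set.Ioo a' b') := by
    intro a' b' h1 h2
    refine ⟨fun x hx => ?_, ?_, hρ.mono_set h2⟩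
    · obtain ⟨h3, h4⟩ := hw.mem_interior (hEF (h2 hx)) (h1 hx)
      exact hw.hasDerivAt_mul h3 h4 (h1 hx)
    · exact (hρ.continuousOn_mul (Polynomial.continuousOn _) isCompact_Icc).mono_set h2
  rw [← Set.Icc_union_Icc_eq_Icc hz.1 hz.2]
  refine ContinuousWithinAt.union ?_ ?_
  · rcases eq_or_lt_of_le hz.1 with rfl | haz
    · simp [continuousWithinAt_singleton]
    rw [continuousWithinAt_Icc_iff_Iic haz, ← continuousWithinAt_Iio_iff_Iic]
    obtain ⟨c, hc, hcM⟩ := (mem_nhdsLT_iff_exists_Ioo_subset).1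
      ((hne.filter_mono (nhdsWithin_mono _ fun x hx => ne_of_lt hx)).and (Ioo_mem_nhdsLT haz))
    obtain ⟨h1, h2, h3⟩ := hd (a' := c) (b' := z) (fun x hx => (hcM hx).1)
      (fun x hx => ⟨(hcM hx).2.1.le, hx.2.le.trans hz.2⟩)
    have h0 : f.eval z * ρ z = 0 := by rw [hf, zero_mul]
    rw [ContinuousWithinAt, h0]
    refine tendsto_zero_left_of_integrable (C := C) hc (fun x _ => rfl) h1 h2 h3 ?_
    filter_upwards [hC.filter_mono nhdsWithin_le_nhds, self_mem_nhdsWithin] with x hx hxz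
    rwa [abs_of_neg (sub_neg.2 hxz), neg_sub] at hx
  · rcases eq_or_lt_of_le hz.2 with rfl | hzb
    · simp [continuousWithinAt_singleton]
    rw [continuousWithinAt_Icc_iff_Ici hzb, ← continuousWithinAt_Ioi_iff_Ici]
    obtain ⟨c, hc, hcM⟩ := (mem_nhdsGT_iff_exists_Ioo_subset).1
      ((hne.filter_mono (nhdsWithin_mono _ fun x hx => ne_of_gt hx)).and (Ioo_mem_nhdsGT hzb))
    obtain ⟨h1, h2, h3⟩ := hd (a' := z) (b' := c) (fun x hx => (hcM hx).1)
      (fun x hx => ⟨hz.1.trans hx.1.le, (hcM hx).2.2.le⟩)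
    have h0 : f.eval z * ρ z = 0 := by rw [hf, zero_mul]
    rw [ContinuousWithinAt, h0]
    refine tendsto_zero_right_of_integrable (C := C) hc (fun x _ => rfl) h1 h2 h3 ?_
    filter_upwards [hC.filter_mono nhdsWithin_le_nhds, self_mem_nhdsWithin] with x hx hxz
    rwa [abs_of_pos (sub_pos.2 hxz)] at hx

end IsRationalWeight

/-! ### Integration by parts on a union of intervals -/

/-- The value of `G` at a finite end point, and `0` at an infinite one. -/
noncomputable def endValue (G : ℝ → ℝ) (c : EReal) : ℝ :=
  open Classical in if c ≠ ⊥ ∧ c ≠ ⊤ then G c.toReal else 0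

theorem endValue_coe (G : ℝ → ℝ) (c : ℝ) : endValue G c = G c := by
  simp [endValue]

/-- The fundamental theorem of calculus on an interval with possibly infinite end points. -/
theorem integral_range_of_hasDerivAt {a b : EReal} (hab : a < b) {G G' : ℝ → ℝ} {s : Set ℝ}
    (hs : s.Countable)
    (hc : ∀ x y : ℝ, Set.Icc x y ⊆ range a b → ContinuousOn G (Set.Icc x y))
    (hd : ∀ x : ℝ, x ∈ range a b → x ∉ s → HasDerivAt G (G' x) x)
    (hi : IntegrableOn G' (range a b))
    (htop : b = ⊤ → Tendsto G atTop (𝓝 0)) (hbot : a = ⊥ → Tendsto G atBot (𝓝 0)) :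
    ∫ x in range a b, G' x = endValue G b - endValue G a := by
  -- The interval is exhausted by compact intervals `[lo n, hi' n]`, constant at a finite end and
  -- running off at an infinite one; `p` guarantees `lo n ≤ hi' n` for large `n`.
  obtain ⟨p, hap, hpb⟩ := EReal.lt_iff_exists_real_btwn.1 hab
  obtain ⟨lo, hlo_anti, hlo_le, hlo_p, hlo_ex, hlo_lim⟩ : ∃ lo : ℕ → ℝ, Antitone lo ∧
      (∀ n, a ≤ lo n) ∧ (∀ᶠ n in atTop, lo n ≤ p) ∧
      (∀ x : ℝ, a ≤ x → ∀ᶠ n in atTop, lo n ≤ x) ∧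
      Tendsto (fun n => G (lo n)) atTop (𝓝 (endValue G a)) := by
    rcases eq_or_ne a ⊥ with rfl | ha
    · have ht : Tendsto (fun n : ℕ => -(n : ℝ)) atTop atBot :=
        tendsto_neg_atTop_atBot.comp tendsto_natCast_atTop_atTop
      refine ⟨fun n => -n, fun m n h => by simpa using h, fun n => bot_le,
        ht.eventually_le_atBot p, fun x _ => ht.eventually_le_atBot x, ?_⟩
      simpa [endValue, Function.comp_def] using (hbot rfl).comp ht
    · have ha' := EReal.coe_toReal (hab.trans_le le_top).ne ha
      refine ⟨fun _ => a.toReal, antitone_const, fun _ => ha'.ge, Eventually.of_forall fun _ => ?_,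
        fun x hx => Eventually.of_forall fun _ => ?_, ?_⟩
      · exact EReal.coe_le_coe_iff.1 (ha'.le.trans hap.le)
      · exact EReal.coe_le_coe_iff.1 (ha'.le.trans hx)
      · rw [← ha', endValue_coe, EReal.toReal_coe]
        exact tendsto_const_nhds
  obtain ⟨hi', hhi_mono, hhi_le, hhi_p, hhi_ex, hhi_lim⟩ : ∃ hi' : ℕ → ℝ, Monotone hi' ∧
      (∀ n, hi' n ≤ b) ∧ (∀ᶠ n in atTop, p ≤ hi' n) ∧
      (∀ x : ℝ, x ≤ b → ∀ᶠ n in atTop, x ≤ hi' n) ∧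
      Tendsto (fun n => G (hi' n)) atTop (𝓝 (endValue G b)) := by
    rcases eq_or_ne b ⊤ with rfl | hb
    · have ht : Tendsto (fun n : ℕ => (n : ℝ)) atTop atTop := tendsto_natCast_atTop_atTop
      refine ⟨fun n => n, fun m n h => by simpa using h, fun n => le_top,
        ht.eventually_ge_atTop p, fun x _ => ht.eventually_ge_atTop x, ?_⟩
      simpa [endValue, Function.comp_def] using (htop rfl).comp ht
    · have hb' := EReal.coe_toReal hb (bot_le.trans_lt hab).ne'
      refine ⟨fun _ => b.toReal, monotone_const, fun _ => hb'.le, Eventually.of_forall fun _ => ?_,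
        fun x hx => Eventually.of_forall fun _ => ?_, ?_⟩
      · exact EReal.coe_le_coe_iff.1 (hpb.le.trans hb'.ge)
      · exact EReal.coe_le_coe_iff.1 (hx.trans hb'.ge)
      · rw [← hb', endValue_coe, EReal.toReal_coe]
        exact tendsto_const_nhds
  have hsub : ∀ n, Set.Icc (lo n) (hi' n) ⊆ range a b := fun n x hx =>
    ⟨(hlo_le n).trans (EReal.coe_le_coe_iff.2 hx.1),
      (EReal.coe_le_coe_iff.2 hx.2).trans (hhi_le n)⟩
  have hU : ⋃ n, Set.Icc (lo n) (hi' n) = range a b := by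
    refine Set.Subset.antisymm (Set.iUnion_subset hsub) fun x hx => ?_
    obtain ⟨n, h1, h2⟩ := ((hlo_ex x hx.1).and (hhi_ex x hx.2)).exists
    exact Set.mem_iUnion.2 ⟨n, h1, h2⟩
  have h1 := tendsto_setIntegral_of_monotone (μ := volume) (f := G')
    (s := fun n => Set.Icc (lo n) (hi' n)) (fun n => measurableSet_Icc)
    (fun m n h => Set.Icc_subset_Icc (hlo_anti h) (hhi_mono h)) (by rwa [hU])
  rw [hU] at h1
  refine tendsto_nhds_unique h1 ((hhi_lim.sub hlo_lim).congr' ?_)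
  filter_upwards [hlo_p, hhi_p] with n hn1 hn2
  have hle := hn1.trans hn2
  rw [integral_Icc_eq_integral_Ioc, ← intervalIntegral.integral_of_le hle]
  refine (integral_eq_of_hasDerivAt_off_countable_of_le G G' hle hs (hc _ _ (hsub n)) ?_ ?_).symm
  · exact fun x hx => hd x (hsub n ⟨hx.1.1.le, hx.1.2.le⟩) hx.2
  · exact (intervalIntegrable_iff_integrableOn_Icc_of_le hle).2 (hi.mono_set (hsub n))

section Intervals

variable {r : ℕ} {c : Fin (2 * r) → EReal}

theorem intervals_eq (c : Fin (2 * r) → EReal) :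
    intervals c = ⋃ i : Fin r, range (c ⟨2 * i, by omega⟩) (c ⟨2 * i + 1, by omega⟩) := rfl

theorem measurableSet_intervals (c : Fin (2 * r) → EReal) : MeasurableSet (intervals c) :=
  MeasurableSet.iUnion fun _ => measurableSet_range _ _

theorem range_subset_intervals (c : Fin (2 * r) → EReal) (i : Fin r) :
    range (c ⟨2 * i, by omega⟩) (c ⟨2 * i + 1, by omega⟩) ⊆ intervals c :=
  Set.subset_iUnion (fun i : Fin r => range (c ⟨2 * i, by omega⟩) (c ⟨2 * i + 1, by omega⟩)) i

theorem disjoint_range (hc : StrictMono c) : Pairwise fun i j : Fin r =>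
    Disjoint (range (c ⟨2 * i, by omega⟩) (c ⟨2 * i + 1, by omega⟩))
      (range (c ⟨2 * j, by omega⟩) (c ⟨2 * j + 1, by omega⟩)) := by
  have key : ∀ i j : Fin r, i < j → ∀ x : ℝ,
      x ∈ range (c ⟨2 * i, by omega⟩) (c ⟨2 * i + 1, by omega⟩) →
      x ∉ range (c ⟨2 * j, by omega⟩) (c ⟨2 * j + 1, by omega⟩) := by
    intro i j hij x hi hj
    have h : c ⟨2 * i + 1, by omega⟩ < c ⟨2 * j, by omega⟩ :=
      hc (Fin.mk_lt_mk.2 (by have : (i : ℕ) < j := hij; omega))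
    exact absurd (hi.2.trans_lt (h.trans_le hj.1)) (lt_irrefl _)
  intro i j hij
  rw [Set.disjoint_left]
  intro x hi hj
  rcases lt_or_gt_of_ne hij with h | h
  · exact key i j h x hi hj
  · exact key j i h x hj hi

/-- The orientation of an end point: `-1` for a left and `1` for a right end point. -/
noncomputable def endSign (j : Fin (2 * r)) : ℝ := if (j : ℕ) % 2 = 0 then -1 else 1

theorem sum_pairs (h : Fin (2 * r) → ℝ) :
    ∑ i : Fin r, (h ⟨2 * i + 1, by omega⟩ - h ⟨2 * i, by omega⟩) = ∑ j, endSign j * h j := by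
  have aux : ∀ (H : ℕ → ℝ) (r : ℕ), ∑ i ∈ Finset.range r, (H (2 * i + 1) - H (2 * i)) =
      ∑ j ∈ Finset.range (2 * r), (if j % 2 = 0 then -1 else 1) * H j := by
    intro H r
    induction r with
    | zero => simp
    | succ r ih =>
      rw [Finset.sum_range_succ, ih, show 2 * (r + 1) = 2 * r + 1 + 1 by ring,
        Finset.sum_range_succ, Finset.sum_range_succ, if_pos (by omega), if_neg (by omega)]
      ring
  have := aux (fun j => if hj : j < 2 * r then h ⟨j, hj⟩ else 0) r
  rw [Finset.sum_range, Finset.sum_range] at this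
  convert this using 1
  · refine Finset.sum_congr rfl fun i _ => ?_
    rw [dif_pos (by omega), dif_pos (by omega)]
  · refine Finset.sum_congr rfl fun j _ => ?_
    rw [dif_pos j.2]
    rfl

theorem sum_endValue (G : ℝ → ℝ) (c : Fin (2 * r) → EReal) :
    ∑ j, endSign j * endValue G (c j) = ∑ j ∈ finiteEnds c, endSign j * G (c j).toReal := by
  rw [finiteEnds, Finset.sum_filter]
  refine Finset.sum_congr rfl fun j _ => ?_
  rw [endValue]
  split_ifs <;> simp

theorem integral_intervals_of_hasDerivAt (hc : StrictMono c) {G G' : ℝ → ℝ} {s : Set ℝ}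
    (hs : s.Countable)
    (hcont : ∀ x y : ℝ, Set.Icc x y ⊆ intervals c → ContinuousOn G (Set.Icc x y))
    (hd : ∀ x : ℝ, x ∈ intervals c → x ∉ s → HasDerivAt G (G' x) x)
    (hi : IntegrableOn G' (intervals c))
    (htop : (∃ j, c j = ⊤) → Tendsto G atTop (𝓝 0))
    (hbot : (∃ j, c j = ⊥) → Tendsto G atBot (𝓝 0)) :
    ∫ x in intervals c, G' x = ∑ j ∈ finiteEnds c, endSign j * G (c j).toReal := by
  rw [intervals_eq, integral_iUnion_fintype (fun i => measurableSet_range _ _) (disjoint_range hc)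
    (fun i => hi.mono_set (range_subset_intervals c i)), ← sum_endValue,
    ← sum_pairs fun j => endValue G (c j)]
  refine Finset.sum_congr rfl fun i _ => ?_
  have hsub := range_subset_intervals c i
  exact integral_range_of_hasDerivAt (hc (Fin.mk_lt_mk.2 (by omega))) hs
    (fun x y h => hcont x y (h.trans hsub)) (fun x hx => hd x (hsub hx)) (hi.mono_set hsub)
    (fun h => htop ⟨_, h⟩) (fun h => hbot ⟨_, h⟩)

theorem end_mem_intervals (hc : StrictMono c) {j : Fin (2 * r)} (hj : j ∈ finiteEnds c) :
    (c j).toReal ∈ intervals c := by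
  have hj' : c j ≠ ⊥ ∧ c j ≠ ⊤ := by simpa [finiteEnds] using hj
  have hcj := EReal.coe_toReal hj'.2 hj'.1
  refine range_subset_intervals c ⟨j / 2, by omega⟩ ⟨?_, ?_⟩ <;> rw [hcj] <;>
    refine hc.monotone (Fin.mk_le_mk.2 ?_) <;> simp <;> omega

end Intervals

theorem exists_abs_eval_le (p : Polynomial ℝ) :
    ∃ C : ℝ, ∃ N : ℕ, 0 ≤ C ∧ ∀ x : ℝ, |p.eval x| ≤ C * (1 + |x|) ^ N := by
  obtain ⟨C, N, hC, h⟩ := (Tame.poly (S := Set.univ) p (0 : Fin 1)).2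
  exact ⟨C, N, hC, fun x => by simpa using h (fun _ => x) (Set.mem_univ _)⟩

theorem HasMoments.integrableOn_mul {ρ : ℝ → ℝ} {E : Set ℝ} (h : HasMoments ρ E)
    (hE : MeasurableSet E) {φ : ℝ → ℝ} (hφ : ContinuousOn φ E) {C : ℝ} {N : ℕ}
    (hb : ∀ x ∈ E, |φ x| ≤ C * (1 + |x|) ^ N) (p : Polynomial ℝ) :
    IntegrableOn (fun x => p.eval x * φ x * ρ x) E := by
  obtain ⟨C', N', hC', hp⟩ := exists_abs_eval_le p
  have hρ : AEStronglyMeasurable ρ (volume.restrict E) := by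
    simpa using (h 0).aestronglyMeasurable
  refine ((h (N' + N)).norm.const_mul (C' * C)).mono'
    (((p.continuousOn.mul hφ).aestronglyMeasurable hE).mul hρ) ?_
  filter_upwards [ae_restrict_mem hE] with x hx
  have h1 : abs (1 + |x|) = 1 + |x| := abs_of_nonneg (by positivity)
  rw [norm_mul, norm_mul, norm_mul, norm_pow]
  simp only [Real.norm_eq_abs, h1]
  rw [← mul_assoc, pow_add, mul_mul_mul_comm]
  refine mul_le_mul_of_nonneg_right ?_ (abs_nonneg _)
  exact mul_le_mul (hp x) (hb x hx) (abs_nonneg _) (by positivity)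

/-- By strict monotonicity an end point `⊤` can only be the last one, hence the right end of its
interval, whose left end lies below `⊤`. -/
theorem eventually_mem_intervals_atTop {r : ℕ} {c : Fin (2 * r) → EReal} (hc : StrictMono c)
    (h : ∃ j, c j = ⊤) : ∀ᶠ x : ℝ in atTop, x ∈ intervals c := by
  obtain ⟨j, hj⟩ := h
  have hodd : (j : ℕ) % 2 = 1 := by
    by_contra hodd
    have := hc (show j < ⟨j + 1, by omega⟩ from Fin.mk_lt_mk.2 (by omega))
    rw [hj] at this
    exact not_top_lt this
  have hlt : c ⟨j - 1, by omega⟩ < ⊤ := hj ▸ hc (show _ < j from Fin.mk_lt_mk.2 (by omega))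
  obtain ⟨p, hp, -⟩ := EReal.lt_iff_exists_real_btwn.1 hlt
  filter_upwards [eventually_ge_atTop p] with x hx
  refine range_subset_intervals c ⟨j / 2, by omega⟩ ⟨?_, ?_⟩
  · have : (⟨2 * ((⟨j / 2, by omega⟩ : Fin r) : ℕ), by simp; omega⟩ : Fin (2 * r)) =
      ⟨j - 1, by omega⟩ := Fin.ext (by simp; omega)
    rw [this]
    exact hp.le.trans (EReal.coe_le_coe_iff.2 hx)
  · have : (⟨2 * ((⟨j / 2, by omega⟩ : Fin r) : ℕ) + 1, by simp; omega⟩ : Fin (2 * r)) = j :=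
      Fin.ext (by simp; omega)
    rw [this, hj]
    exact le_top

theorem eventually_mem_intervals_atBot {r : ℕ} {c : Fin (2 * r) → EReal} (hc : StrictMono c)
    (h : ∃ j, c j = ⊥) : ∀ᶠ x : ℝ in atBot, x ∈ intervals c := by
  obtain ⟨j, hj⟩ := h
  have hodd : (j : ℕ) % 2 = 0 := by
    by_contra hodd
    have := hc (show ⟨j - 1, by omega⟩ < j from Fin.mk_lt_mk.2 (by omega))
    rw [hj] at this
    exact not_lt_bot this
  have hlt : ⊥ < c ⟨j + 1, by omega⟩ := hj ▸ hc (show j < _ from Fin.mk_lt_mk.2 (by omega))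
  obtain ⟨p, -, hp⟩ := EReal.lt_iff_exists_real_btwn.1 hlt
  filter_upwards [eventually_le_atBot p] with x hx
  refine range_subset_intervals c ⟨j / 2, by omega⟩ ⟨?_, ?_⟩
  · have : (⟨2 * ((⟨j / 2, by omega⟩ : Fin r) : ℕ), by simp; omega⟩ : Fin (2 * r)) = j :=
      Fin.ext (by simp; omega)
    rw [this, hj]
    exact bot_le
  · have : (⟨2 * ((⟨j / 2, by omega⟩ : Fin r) : ℕ) + 1, by simp; omega⟩ : Fin (2 * r)) =
      ⟨j + 1, by omega⟩ := Fin.ext (by simp; omega)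
    rw [this]
    exact (EReal.coe_le_coe_iff.2 hx).trans hp.le

theorem tendsto_mul_of_growth {w φ : ℝ → ℝ} {l : Filter ℝ} {C : ℝ} {N : ℕ}
    (hl : ∀ᶠ x in l, 1 ≤ |x|) (hw : Tendsto (fun x => w x * x ^ N) l (𝓝 0))
    (hφ : ∀ᶠ x in l, |φ x| ≤ C * (1 + |x|) ^ N) : Tendsto (fun x => w x * φ x) l (𝓝 0) := by
  refine squeeze_zero_norm' (a := fun x => |C| * 2 ^ N * |w x * x ^ N|) ?_
    (by simpa using hw.abs.const_mul (|C| * 2 ^ N))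
  filter_upwards [hl, hφ] with x h1 h2
  have h3 : (1 + |x|) ^ N ≤ 2 ^ N * |x| ^ N := by
    rw [← mul_pow]
    exact pow_le_pow_left₀ (by positivity) (by linarith) N
  rw [Real.norm_eq_abs, abs_mul, abs_mul, abs_pow]
  calc |w x| * |φ x| ≤ |w x| * (|C| * (2 ^ N * |x| ^ N)) := by
        refine mul_le_mul_of_nonneg_left (h2.trans ?_) (abs_nonneg _)
        exact mul_le_mul (le_abs_self C) h3 (by positivity) (abs_nonneg _)
    _ = _ := by ring

theorem IsRationalWeight.eq_top {A B : EReal} {ρ : ℝ → ℝ} {f g : Polynomial ℝ}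
    (_hw : IsRationalWeight A B ρ f g) {E : Set ℝ} (hE : E ⊆ range A B)
    (h : ∀ᶠ x : ℝ in atTop, x ∈ E) : B = ⊤ := by
  rw [EReal.eq_top_iff_forall_lt]
  intro y
  obtain ⟨x, h1, h2⟩ := (h.and (eventually_gt_atTop y)).exists
  exact (EReal.coe_lt_coe_iff.2 h2).trans_le (hE h1).2

theorem IsRationalWeight.eq_bot {A B : EReal} {ρ : ℝ → ℝ} {f g : Polynomial ℝ}
    (_hw : IsRationalWeight A B ρ f g) {E : Set ℝ} (hE : E ⊆ range A B)
    (h : ∀ᶠ x : ℝ in atBot, x ∈ E) : A = ⊥ := by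
  rw [EReal.eq_bot_iff_forall_lt]
  intro y
  obtain ⟨x, h1, h2⟩ := (h.and (eventually_lt_atBot y)).exists
  exact (hE h1).1.trans_lt (EReal.coe_lt_coe_iff.2 h2)

/-- Integration by parts on `E` against a rational weight. -/
theorem integral_intervals_by_parts {A B : EReal} {ρ : ℝ → ℝ} {f g : Polynomial ℝ}
    (hw : IsRationalWeight A B ρ f g) {r : ℕ} {c : Fin (2 * r) → EReal} (hc : StrictMono c)
    (hEF : intervals c ⊆ range A B) (hρ : IntegrableOn ρ (intervals c)) {φ φ' : ℝ → ℝ}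
    (hφ : ∀ x ∈ intervals c, HasDerivAt φ (φ' x) x) (hφ' : ContinuousOn φ' (intervals c))
    {C : ℝ} {N : ℕ} (hb : ∀ x ∈ intervals c, |φ x| ≤ C * (1 + |x|) ^ N)
    (hb' : ∀ x ∈ intervals c, |φ' x| ≤ C * (1 + |x|) ^ N) :
    ∫ x in intervals c, (f.eval x * φ' x + (f.derivative - g).eval x * φ x) * ρ x =
      ∑ j ∈ finiteEnds c, endSign j *
        (f.eval (c j).toReal * ρ (c j).toReal * φ (c j).toReal) := by
  have hE := measurableSet_intervals c
  have hm := hw.hasMoments hE hEF hρ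
  have hφc : ContinuousOn φ (intervals c) := fun x hx => (hφ x hx).continuousAt.continuousWithinAt
  -- The primitive `f ρ φ` is continuous on compact intervals in `E` and differentiable off the
  -- finitely many zeros of `f`. An infinite end of `E` is an infinite end of `F`, where `fρ` beats
  -- the polynomial growth of `φ`.
  refine integral_intervals_of_hasDerivAt hc (G := fun x => f.eval x * ρ x * φ x)
    (Polynomial.finite_setOfPred_isRoot hw.f_ne_zero).countable ?_ ?_ ?_ ?_ ?_
  · intro x y hxy
    exact (hw.continuousOn_mul (hxy.trans hEF) (hρ.mono_set hxy)).mul (hφc.mono hxy)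
  · intro x hx hf
    obtain ⟨h1, h2⟩ := hw.mem_interior (hEF hx) hf
    refine ((hw.hasDerivAt_mul h1 h2 hf).mul (hφ x hx)).congr_deriv ?_
    ring
  · refine ((hm.integrableOn_mul hE hφ' hb' f).add
      (hm.integrableOn_mul hE hφc hb (f.derivative - g))).congr_fun (fun x _ => ?_) hE
    simp only [Pi.add_apply]
    ring
  · intro h
    have hev := eventually_mem_intervals_atTop hc h
    exact tendsto_mul_of_growth (tendsto_abs_atTop_atTop.eventually_ge_atTop 1)
      (hw.tendsto_atTop (hw.eq_top hEF hev) N) (hev.mono fun x hx => hb x hx)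
  · intro h
    have hev := eventually_mem_intervals_atBot hc h
    exact tendsto_mul_of_growth (tendsto_abs_atBot_atTop.eventually_ge_atTop 1)
      (hw.tendsto_atBot (hw.eq_bot hEF hev) N) (hev.mono fun x hx => hb x hx)

/-! ### The Vandermonde determinant and its regularized powers -/

/-- The pairs `i < j` of indices. -/
def pairs (n : ℕ) : Finset (Fin n × Fin n) := Finset.univ.filter fun p => p.1 < p.2

theorem vandermonde_eq {n : ℕ} (z : Fin n → ℝ) :
    vandermonde z = ∏ p ∈ pairs n, (z p.1 - z p.2) := by
  rw [vandermonde, pairs, Finset.prod_filter, ← Finset.univ_product_univ, Finset.prod_product]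
  refine Finset.prod_congr rfl fun i _ => ?_
  rw [← Finset.prod_filter]
  refine Finset.prod_congr ?_ fun _ _ => rfl
  ext j; simp

/-- The partial derivatives of the Vandermonde determinant. -/
noncomputable def vandermondeDeriv {n : ℕ} (k : Fin n) (z : Fin n → ℝ) : ℝ :=
  ∑ p ∈ pairs n, (∏ q ∈ (pairs n).erase p, (z q.1 - z q.2)) *
    ((if p.1 = k then 1 else 0) - if p.2 = k then 1 else 0)

theorem hasDerivAt_update_apply {n : ℕ} (z : Fin n → ℝ) (k i : Fin n) (x : ℝ) :
    HasDerivAt (fun u => Function.update z k u i) (if i = k then 1 else 0) x := by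
  by_cases h : i = k
  · subst h; simpa using hasDerivAt_id' x
  · simpa [h] using hasDerivAt_const x (z i)

theorem hasDerivAt_vandermonde {n : ℕ} (z : Fin n → ℝ) (k : Fin n) :
    HasDerivAt (fun u => vandermonde (Function.update z k u)) (vandermondeDeriv k z) (z k) := by
  simp only [vandermonde_eq]
  have := HasDerivAt.fun_finsetProd (u := pairs n)
    (f := fun p u => Function.update z k u p.1 - Function.update z k u p.2) (x := z k)
    (fun p _ => (hasDerivAt_update_apply z k p.1 (z k)).sub
      (hasDerivAt_update_apply z k p.2 (z k)))
  simpa [vandermondeDeriv] using this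

/-- The divided difference `(h(x) - h(y)) / (x - y)`, as a polynomial. -/
noncomputable def dividedDiff (h : Polynomial ℝ) (x y : ℝ) : ℝ :=
  h.sum fun i a => a * ∑ j ∈ Finset.range i, x ^ j * y ^ (i - 1 - j)

theorem dividedDiff_mul (h : Polynomial ℝ) (x y : ℝ) :
    dividedDiff h x y * (x - y) = h.eval x - h.eval y := by
  rw [dividedDiff, Polynomial.eval_eq_sum, Polynomial.eval_eq_sum, Polynomial.sum, Polynomial.sum,
    Polynomial.sum, Finset.sum_mul, ← Finset.sum_sub_distrib]
  refine Finset.sum_congr rfl fun i _ => ?_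
  rw [mul_assoc, (Commute.all x y).geom_sum₂_mul, mul_sub]

/-- Differentiating the factor `z_i - z_j` leaves `h(z_i) - h(z_j)`, which the divided difference
turns back into a multiple of the missing factor. Nothing is divided by `Δ`, so the identity also
holds at coinciding points. -/
theorem sum_mul_vandermondeDeriv {n : ℕ} (h : Polynomial ℝ) (z : Fin n → ℝ) :
    ∑ k, h.eval (z k) * vandermondeDeriv k z =
      vandermonde z * ∑ p ∈ pairs n, dividedDiff h (z p.1) (z p.2) := by
  simp only [vandermondeDeriv, Finset.mul_sum]
  rw [Finset.sum_comm]
  refine Finset.sum_congr rfl fun p hp => ?_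
  rw [vandermonde_eq, ← Finset.mul_prod_erase _ _ hp, mul_right_comm, mul_comm (z p.1 - z p.2),
    dividedDiff_mul]
  simp only [mul_sub, mul_ite, mul_one, mul_zero,
    Finset.sum_sub_distrib, Finset.sum_ite_eq, Finset.mem_univ, if_true]
  ring

section Tame

variable {n : ℕ} {S : Set (Fin n → ℝ)}

theorem tame_vandermonde : Tame S vandermonde :=
  (Tame.prod (pairs n) fun p _ => (Tame.coord p.1).sub (Tame.coord p.2)).congr
    fun z _ => vandermonde_eq z

theorem tame_vandermondeDeriv (k : Fin n) : Tame S (vandermondeDeriv k) :=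
  Tame.sum (pairs n) fun p _ => (Tame.prod ((pairs n).erase p) fun q _ =>
    (Tame.coord q.1).sub (Tame.coord q.2)).mul (Tame.const _)

theorem tame_dividedDiff (h : Polynomial ℝ) (i j : Fin n) :
    Tame S fun z => dividedDiff h (z i) (z j) :=
  Tame.sum _ fun _ _ => (Tame.sum _ fun _ _ =>
    ((Tame.coord i).pow _).mul ((Tame.coord j).pow _)).const_mul _

theorem Tame.abs {φ : (Fin n → ℝ) → ℝ} (h : Tame S φ) : Tame S fun z => |φ z| :=
  h.of_abs_le h.1.abs fun z _ => (abs_abs (φ z)).le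

theorem tame_abs_vandermonde_rpow {β : ℝ} (hβ : 0 < β) :
    Tame S fun z => |vandermonde z| ^ (2 * β) :=
  tame_vandermonde.abs_rpow (by positivity)

/-- The regularization `(Δ² + ε)^β` of `|Δ|^{2β}`. -/
noncomputable def regVandermonde (β ε : ℝ) (z : Fin n → ℝ) : ℝ := (vandermonde z ^ 2 + ε) ^ β

theorem tame_regVandermonde {β ε : ℝ} (hβ : 0 < β) (hε : 0 < ε) :
    Tame S (regVandermonde β ε) :=
  (((tame_vandermonde.pow 2).add (Tame.const ε)).abs_rpow hβ).congr fun z _ => by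
    rw [regVandermonde, abs_of_pos (by positivity)]

/-- The exponent may be negative, but `Δ² + ε ≥ ε` bounds the function by `ε⁻¹ (Δ² + ε)^β`. This
bound is not uniform in `ε`; it only serves integrability at fixed `ε`. -/
theorem tame_regVandermonde_sub_one {β ε : ℝ} (hβ : 0 < β) (hε : 0 < ε) :
    Tame S (regVandermonde (β - 1) ε) := by
  refine ((tame_regVandermonde hβ hε).const_mul ε⁻¹).of_abs_le ?_ fun z _ => ?_
  · exact ((tame_vandermonde.pow 2).add (Tame.const ε)).1.rpow_const fun z _ =>
      Or.inl (by positivity)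
  · have h : 0 < vandermonde z ^ 2 + ε := by positivity
    rw [regVandermonde, regVandermonde, abs_of_pos (by positivity), abs_of_pos (by positivity),
      Real.rpow_sub_one h.ne', div_eq_inv_mul]
    gcongr
    nlinarith [sq_nonneg (vandermonde z)]

theorem hasDerivAt_regVandermonde (β : ℝ) {ε : ℝ} (hε : 0 < ε) (z : Fin n → ℝ) (k : Fin n) :
    HasDerivAt (fun u => regVandermonde β ε (Function.update z k u))
      (2 * β * regVandermonde (β - 1) ε z * vandermonde z * vandermondeDeriv k z) (z k) := by
  have h1 := ((hasDerivAt_vandermonde z k).pow 2).add_const ε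
  have h2 := h1.rpow_const (p := β) (Or.inl (ne_of_gt
    (show 0 < vandermonde (Function.update z k (z k)) ^ 2 + ε by positivity)))
  refine h2.congr_deriv ?_
  simp [regVandermonde]
  ring

theorem regVandermonde_mono {β ε : ℝ} (hβ : 0 < β) (hε : 0 < ε) (hε1 : ε ≤ 1) (z : Fin n → ℝ) :
    regVandermonde β ε z ≤ regVandermonde β 1 z :=
  Real.rpow_le_rpow (by positivity) (by linarith) hβ.le

theorem abs_regVandermonde (β : ℝ) {ε : ℝ} (hε : 0 < ε) (z : Fin n → ℝ) :
    |regVandermonde β ε z| = regVandermonde β ε z :=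
  abs_of_pos (Real.rpow_pos_of_pos (by positivity) _)

/-- The singular power enters the summed equation only with the factor `Δ²`. This bound, followed by
monotonicity in `ε`, supplies a dominating function independent of `ε`, also for `β < 1`. -/
theorem regVandermonde_sub_one_mul (β : ℝ) {ε : ℝ} (hε : 0 < ε) (z : Fin n → ℝ) :
    regVandermonde (β - 1) ε z * vandermonde z ^ 2 ≤ regVandermonde β ε z := by
  have h : 0 < vandermonde z ^ 2 + ε := by positivity
  rw [regVandermonde, regVandermonde, Real.rpow_sub_one h.ne', div_mul_eq_mul_div,
    div_le_iff₀ h]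
  gcongr
  linarith

theorem abs_vandermonde_rpow (β : ℝ) (z : Fin n → ℝ) :
    |vandermonde z| ^ (2 * β) = (vandermonde z ^ 2) ^ β := by
  rw [Real.rpow_mul (abs_nonneg _), Real.rpow_two, sq_abs]

theorem tendsto_regVandermonde {β : ℝ} (hβ : 0 < β) (z : Fin n → ℝ) :
    Tendsto (fun N : ℕ => regVandermonde β (1 / ((N : ℝ) + 1)) z) atTop
      (𝓝 (|vandermonde z| ^ (2 * β))) := by
  rw [abs_vandermonde_rpow]
  have h := (tendsto_one_div_add_atTop_nhds_zero_nat (𝕜 := ℝ)).const_add (vandermonde z ^ 2)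
  rw [add_zero] at h
  exact h.rpow_const (Or.inr hβ.le)

/-- On `Δ = 0` every member of the sequence is zero, and so is `0^{2β}` because `β > 0`; elsewhere
the limit is by continuity. -/
theorem tendsto_regVandermonde_sub_one_mul {β : ℝ} (hβ : 0 < β) (z : Fin n → ℝ) :
    Tendsto (fun N : ℕ => regVandermonde (β - 1) (1 / ((N : ℝ) + 1)) z * vandermonde z ^ 2) atTop
      (𝓝 (|vandermonde z| ^ (2 * β))) := by
  by_cases h0 : vandermonde z = 0
  · simp [h0, Real.zero_rpow (show 2 * β ≠ 0 by positivity)]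
  have h1 : vandermonde z ^ 2 ≠ 0 := pow_ne_zero 2 h0
  rw [abs_vandermonde_rpow]
  have h := (tendsto_one_div_add_atTop_nhds_zero_nat (𝕜 := ℝ)).const_add (vandermonde z ^ 2)
  rw [add_zero] at h
  have h2 := (h.rpow_const (p := β - 1) (Or.inl h1)).mul_const (vandermonde z ^ 2)
  rwa [Real.rpow_sub_one h1, div_mul_cancel₀ _ h1] at h2

end Tame

/-! ### The loop equations -/

theorem HasMoments.tendsto_integral {n : ℕ} {ρ : ℝ → ℝ} {E : Set ℝ} (h : HasMoments ρ E)
    (hE : MeasurableSet E) {a : ℕ → (Fin n → ℝ) → ℝ} {a₀ b : (Fin n → ℝ) → ℝ}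
    (ha : ∀ N, Tame (cube n E) (a N)) (hb : Tame (cube n E) b)
    (hab : ∀ N, ∀ z ∈ cube n E, |a N z| ≤ |b z|)
    (hlim : ∀ z ∈ cube n E, Tendsto (fun N => a N z) atTop (𝓝 (a₀ z))) :
    Tendsto (fun N => ∫ z in cube n E, a N z * ∏ k, ρ (z k)) atTop
      (𝓝 (∫ z in cube n E, a₀ z * ∏ k, ρ (z k))) := by
  have hm := measurableSet_cube (n := n) hE
  refine tendsto_integral_of_dominated_convergence _
    (fun N => (h.integrableOn hE (ha N)).aestronglyMeasurable) (h.integrableOn hE hb).norm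
    (fun N => ?_) ?_
  · filter_upwards [ae_restrict_mem hm] with z hz
    simp only [norm_mul, Real.norm_eq_abs]
    exact mul_le_mul_of_nonneg_right (hab N z hz) (abs_nonneg _)
  · filter_upwards [ae_restrict_mem hm] with z hz using (hlim z hz).mul_const _

section Loop

variable {A B : EReal} {ρ : ℝ → ℝ} {f g : Polynomial ℝ} {r n : ℕ} {c : Fin (2 * r) → EReal}

/-- Integration by parts on `E^{n+1}` in the `k`-th variable. -/
theorem integral_cube_by_parts (hw : IsRationalWeight A B ρ f g) (hc : StrictMono c)
    (hEF : intervals c ⊆ range A B) (hρ : IntegrableOn ρ (intervals c)) (k : Fin (n + 1))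
    {φ φ' : (Fin (n + 1) → ℝ) → ℝ} (hφ : Tame (cube (n + 1) (intervals c)) φ)
    (hφ' : Tame (cube (n + 1) (intervals c)) φ')
    (hd : ∀ z ∈ cube (n + 1) (intervals c),
      HasDerivAt (fun u => φ (Function.update z k u)) (φ' z) (z k)) :
    ∫ z in cube (n + 1) (intervals c),
        (f.eval (z k) * φ' z + (f.derivative - g).eval (z k) * φ z) * ∏ i, ρ (z i) =
      ∑ j ∈ finiteEnds c, endSign j * (f.eval (c j).toReal * ρ (c j).toReal) *
        ∫ z in cube n (intervals c), φ (k.insertNth (c j).toReal z) * ∏ i, ρ (z i) := by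
  have hE := measurableSet_intervals c
  have hm := hw.hasMoments hE hEF hρ
  rw [setIntegral_cube_succ k (hm.integrableOn hE
    (((Tame.poly f k).mul hφ').add ((Tame.poly (f.derivative - g) k).mul hφ)))]
  simp only [← integral_const_mul]
  rw [← integral_finsetSum]
  swap
  · intro j hj
    exact (hm.integrableOn hE (hφ.insertNth k (end_mem_intervals hc hj))).const_mul _
  refine setIntegral_congr_fun (measurableSet_cube hE) fun z hz => ?_
  -- Adding the absolute values yields one pair `(C, N)` valid for both functions; with the other
  -- variables fixed, their growth factors become part of the constant.
  obtain ⟨-, C, N, hC, hb⟩ := hφ.abs.add hφ'.abs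
  have hb1 : ∀ x ∈ intervals c, |φ (k.insertNth x z)| + |φ' (k.insertNth x z)| ≤
      (C * ∏ i, (1 + |z i|) ^ N) * (1 + |x|) ^ N := by
    intro x hx
    have := hb _ (insertNth_mem_cube k hx hz)
    rw [abs_of_nonneg (by positivity), Fin.prod_univ_succAbove _ k, Fin.insertNth_apply_same,
      Finset.prod_congr rfl fun i _ => by rw [Fin.insertNth_apply_succAbove]] at this
    linarith
  have hcont : ContinuousOn (fun x => φ' (k.insertNth x z)) (intervals c) :=
    hφ'.1.comp (Continuous.continuousOn (by fun_prop)) fun x hx => insertNth_mem_cube k hx hz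
  have h := integral_intervals_by_parts hw hc hEF hρ (φ := fun x => φ (k.insertNth x z))
    (φ' := fun x => φ' (k.insertNth x z)) (C := C * ∏ i, (1 + |z i|) ^ N) (N := N)
    (fun x hx => by
      have := hd _ (insertNth_mem_cube k hx hz)
      simpa using this) hcont
    (fun x hx => by linarith [hb1 x hx, abs_nonneg (φ' (k.insertNth x z))])
    (fun x hx => by linarith [hb1 x hx, abs_nonneg (φ (k.insertNth x z))])
  simp only [Fin.prod_univ_succAbove _ k, Fin.insertNth_apply_same, Fin.insertNth_apply_succAbove,
    ← mul_assoc]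
  rw [integral_mul_const, h, Finset.sum_mul]
  refine Finset.sum_congr rfl fun j _ => ?_
  ring

/-- Integration by parts in `z_k` is applied to `p(z_k) (Δ² + ε)^β Ψ` and summed over `k`. Only the
sum brings in `sum_mul_vandermondeDeriv`, which produces the second factor `Δ` beside `(Δ² +
ε)^{β-1}` that the limit needs. -/
theorem regularized_loop_equation {β ε : ℝ} (hβ : 0 < β) (hε : 0 < ε)
    (hw : IsRationalWeight A B ρ f g) (hc : StrictMono c)
    (hEF : intervals c ⊆ range A B) (hρ : IntegrableOn ρ (intervals c))
    {Ψ : (Fin (n + 1) → ℝ) → ℝ} {Ψ' : Fin (n + 1) → (Fin (n + 1) → ℝ) → ℝ}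
    (hΨ : Tame (cube (n + 1) (intervals c)) Ψ)
    (hΨ' : ∀ k, Tame (cube (n + 1) (intervals c)) (Ψ' k))
    (hd : ∀ k, ∀ z ∈ cube (n + 1) (intervals c),
      HasDerivAt (fun u => Ψ (Function.update z k u)) (Ψ' k z) (z k)) (p : Polynomial ℝ) :
    (∫ z in cube (n + 1) (intervals c), (regVandermonde β ε z *
        ((∑ k, (p * f).eval (z k) * Ψ' k z) +
          (∑ k, ((p * f).derivative - p * g).eval (z k)) * Ψ z)) * ∏ i, ρ (z i)) +
      ∫ z in cube (n + 1) (intervals c), (regVandermonde (β - 1) ε z * vandermonde z ^ 2 *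
        (2 * β * (∑ q ∈ pairs (n + 1), dividedDiff (p * f) (z q.1) (z q.2)) * Ψ z)) *
          ∏ i, ρ (z i) =
      ∑ j ∈ finiteEnds c, endSign j * ((p * f).eval (c j).toReal * ρ (c j).toReal) *
        ∑ k : Fin (n + 1), ∫ z in cube n (intervals c),
          (regVandermonde β ε (k.insertNth (c j).toReal z) * Ψ (k.insertNth (c j).toReal z)) *
            ∏ i, ρ (z i) := by
  have hE := measurableSet_intervals c
  have hm := hw.hasMoments hE hEF hρ
  have hD := tame_regVandermonde (n := n + 1) (S := cube (n + 1) (intervals c)) hβ hε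
  have hD' := tame_regVandermonde_sub_one (n := n + 1) (S := cube (n + 1) (intervals c)) hβ hε
  have hV := tame_vandermonde (n := n + 1) (S := cube (n + 1) (intervals c))
  have hV' := fun k => tame_vandermondeDeriv (n := n + 1) (S := cube (n + 1) (intervals c)) k
  set φ : Fin (n + 1) → (Fin (n + 1) → ℝ) → ℝ := fun k z =>
    p.eval (z k) * (regVandermonde β ε z * Ψ z) with hφdef
  set φ' : Fin (n + 1) → (Fin (n + 1) → ℝ) → ℝ := fun k z =>
    p.derivative.eval (z k) * (regVandermonde β ε z * Ψ z) + p.eval (z k) *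
      (2 * β * regVandermonde (β - 1) ε z * vandermonde z * vandermondeDeriv k z * Ψ z +
        regVandermonde β ε z * Ψ' k z) with hφ'def
  have hφ : ∀ k, Tame (cube (n + 1) (intervals c)) (φ k) := fun k =>
    (Tame.poly p k).mul (hD.mul hΨ)
  have hφ' : ∀ k, Tame (cube (n + 1) (intervals c)) (φ' k) := fun k =>
    ((Tame.poly _ k).mul (hD.mul hΨ)).add ((Tame.poly p k).mul
      (((((hD'.const_mul (2 * β)).mul hV).mul (hV' k)).mul hΨ).add (hD.mul (hΨ' k))))
  have hdφ : ∀ k, ∀ z ∈ cube (n + 1) (intervals c),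
      HasDerivAt (fun u => φ k (Function.update z k u)) (φ' k z) (z k) := by
    intro k z hz
    have h1 := (hasDerivAt_regVandermonde β hε z k).fun_mul (hd k z hz)
    have h2 := (p.hasDerivAt (z k)).fun_mul h1
    simpa [hφdef, hφ'def] using h2
  have hsum := Finset.sum_congr (rfl : (Finset.univ : Finset (Fin (n + 1))) = Finset.univ)
    fun k _ => integral_cube_by_parts hw hc hEF hρ k (hφ k) (hφ' k) (hdφ k)
  rw [← integral_finsetSum] at hsum
  swap
  · intro k _
    exact hm.integrableOn hE
      (((Tame.poly f k).mul (hφ' k)).add ((Tame.poly (f.derivative - g) k).mul (hφ k)))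
  rw [← integral_add]
  rotate_left
  · exact hm.integrableOn hE (hD.mul
      ((Tame.sum _ fun k _ => (Tame.poly (p * f) k).mul (hΨ' k)).add
        ((Tame.sum _ fun k _ => Tame.poly _ k).mul hΨ)))
  · exact hm.integrableOn hE ((hD'.mul (hV.pow 2)).mul
      (((Tame.sum _ fun q _ => tame_dividedDiff (p * f) q.1 q.2).const_mul (2 * β)).mul hΨ))
  rw [Finset.sum_comm] at hsum
  refine Eq.trans (integral_congr_ae (ae_of_all _ fun z => ?_)) (hsum.trans ?_)
  · beta_reduce
    rw [← Finset.sum_mul, ← add_mul]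
    congr 1
    have hs := sum_mul_vandermondeDeriv (p * f) z
    rw [show regVandermonde (β - 1) ε z * vandermonde z ^ 2 * (2 * β *
      (∑ q ∈ pairs (n + 1), dividedDiff (p * f) (z q.1) (z q.2)) * Ψ z) =
      2 * β * regVandermonde (β - 1) ε z * vandermonde z * Ψ z * (vandermonde z *
      ∑ q ∈ pairs (n + 1), dividedDiff (p * f) (z q.1) (z q.2)) by ring, ← hs, mul_add,
      Finset.mul_sum, Finset.mul_sum, Finset.sum_mul, Finset.mul_sum, ← Finset.sum_add_distrib,
      ← Finset.sum_add_distrib]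
    refine Finset.sum_congr rfl fun k _ => ?_
    simp only [hφdef, hφ'def, Polynomial.eval_mul, Polynomial.eval_sub, Polynomial.eval_add,
      Polynomial.derivative_mul]
    ring
  · refine Finset.sum_congr rfl fun j _ => ?_
    rw [Finset.mul_sum]
    refine Finset.sum_congr rfl fun k _ => ?_
    simp only [hφdef, Fin.insertNth_apply_same, mul_assoc, Polynomial.eval_mul, integral_const_mul]
    ring

/-- The loop equations of the `β`-ensemble. -/
theorem loop_equation {β : ℝ} (hβ : 0 < β)
    (hw : IsRationalWeight A B ρ f g) (hc : StrictMono c)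
    (hEF : intervals c ⊆ range A B) (hρ : IntegrableOn ρ (intervals c))
    {Ψ : (Fin (n + 1) → ℝ) → ℝ} {Ψ' : Fin (n + 1) → (Fin (n + 1) → ℝ) → ℝ}
    (hΨ : Tame (cube (n + 1) (intervals c)) Ψ)
    (hΨ' : ∀ k, Tame (cube (n + 1) (intervals c)) (Ψ' k))
    (hd : ∀ k, ∀ z ∈ cube (n + 1) (intervals c),
      HasDerivAt (fun u => Ψ (Function.update z k u)) (Ψ' k z) (z k)) (p : Polynomial ℝ) :
    ∫ z in cube (n + 1) (intervals c), (|vandermonde z| ^ (2 * β) *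
        ((∑ k, (p * f).eval (z k) * Ψ' k z) +
          ((∑ k, ((p * f).derivative - p * g).eval (z k)) +
            2 * β * ∑ q ∈ pairs (n + 1), dividedDiff (p * f) (z q.1) (z q.2)) * Ψ z)) *
          ∏ i, ρ (z i) =
      ∑ j ∈ finiteEnds c, endSign j * ((p * f).eval (c j).toReal * ρ (c j).toReal) *
        ∑ k : Fin (n + 1), ∫ z in cube n (intervals c),
          (|vandermonde (k.insertNth (c j).toReal z : Fin (n + 1) → ℝ)| ^ (2 * β) *
            Ψ (k.insertNth (c j).toReal z)) * ∏ i, ρ (z i) := by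
  have hE := measurableSet_intervals c
  have hm := hw.hasMoments hE hEF hρ
  have hε : ∀ N : ℕ, (0 : ℝ) < 1 / ((N : ℝ) + 1) := fun N => by positivity
  have hε1 : ∀ N : ℕ, 1 / ((N : ℝ) + 1) ≤ 1 := fun N => by
    rw [div_le_one (by positivity)]
    linarith [(Nat.cast_nonneg N : (0 : ℝ) ≤ N)]
  have hX : Tame (cube (n + 1) (intervals c)) fun z => (∑ k, (p * f).eval (z k) * Ψ' k z) +
      (∑ k, ((p * f).derivative - p * g).eval (z k)) * Ψ z :=
    (Tame.sum _ fun k _ => (Tame.poly (p * f) k).mul (hΨ' k)).add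
      ((Tame.sum _ fun k _ => Tame.poly _ k).mul hΨ)
  have hY : Tame (cube (n + 1) (intervals c)) fun z =>
      2 * β * (∑ q ∈ pairs (n + 1), dividedDiff (p * f) (z q.1) (z q.2)) * Ψ z :=
    ((Tame.sum _ fun q _ => tame_dividedDiff (p * f) q.1 q.2).const_mul (2 * β)).mul hΨ
  have hΔ := tame_abs_vandermonde_rpow (n := n + 1) (S := cube (n + 1) (intervals c)) hβ
  -- Along `ε = 1/(N+1) ≤ 1` everything is dominated by the integrand at `ε = 1`.
  have hle1 : ∀ (N : ℕ) (x : ℝ) (z : Fin (n + 1) → ℝ),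
      |regVandermonde β (1 / ((N : ℝ) + 1)) z * x| ≤ |regVandermonde β 1 z * x| := by
    intro N x z
    rw [abs_mul, abs_mul, abs_regVandermonde _ (hε N), abs_regVandermonde _ one_pos]
    exact mul_le_mul_of_nonneg_right (regVandermonde_mono hβ (hε N) (hε1 N) z) (abs_nonneg x)
  have hle2 : ∀ (N : ℕ) (x : ℝ) (z : Fin (n + 1) → ℝ),
      |regVandermonde (β - 1) (1 / ((N : ℝ) + 1)) z * vandermonde z ^ 2 * x| ≤
        |regVandermonde β 1 z * x| := by
    intro N x z
    rw [abs_mul, abs_mul, abs_mul, abs_regVandermonde _ (hε N), abs_regVandermonde _ one_pos,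
      abs_of_nonneg (sq_nonneg (vandermonde z))]
    exact mul_le_mul_of_nonneg_right ((regVandermonde_sub_one_mul β (hε N) z).trans
      (regVandermonde_mono hβ (hε N) (hε1 N) z)) (abs_nonneg x)
  have h1 := hm.tendsto_integral hE
    (fun N => (tame_regVandermonde hβ (hε N)).mul hX) ((tame_regVandermonde hβ one_pos).mul hX)
    (fun N z _ => hle1 N _ z) (fun z _ => (tendsto_regVandermonde hβ z).mul_const _)
  have h2 := hm.tendsto_integral hE
    (fun N => ((tame_regVandermonde_sub_one hβ (hε N)).mul (tame_vandermonde.pow 2)).mul hY)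
    ((tame_regVandermonde hβ one_pos).mul hY)
    (fun N z _ => hle2 N _ z) (fun z _ => (tendsto_regVandermonde_sub_one_mul hβ z).mul_const _)
  have h3 : ∀ j ∈ finiteEnds c, ∀ k : Fin (n + 1), Tendsto (fun N : ℕ =>
      ∫ z in cube n (intervals c), (regVandermonde β (1 / ((N : ℝ) + 1))
        (k.insertNth (c j).toReal z) * Ψ (k.insertNth (c j).toReal z)) * ∏ i, ρ (z i)) atTop
      (𝓝 (∫ z in cube n (intervals c),
          (|vandermonde (k.insertNth (c j).toReal z : Fin (n + 1) → ℝ)| ^ (2 * β) *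
            Ψ (k.insertNth (c j).toReal z)) * ∏ i, ρ (z i))) := by
    intro j hj k
    have hcj := end_mem_intervals hc hj
    exact hm.tendsto_integral hE
      (fun N => ((tame_regVandermonde hβ (hε N)).mul hΨ).insertNth k hcj)
      (((tame_regVandermonde hβ one_pos).mul hΨ).insertNth k hcj)
      (fun N z _ => hle1 N _ _) (fun z _ => (tendsto_regVandermonde hβ _).mul_const _)
  have h4 := tendsto_finsetSum (finiteEnds c) fun j hj =>
    (tendsto_finsetSum Finset.univ fun k _ => h3 j hj k).const_mul
      (endSign j * ((p * f).eval (c j).toReal * ρ (c j).toReal))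
  have h5 := tendsto_nhds_unique ((h1.add h2).congr fun N =>
    regularized_loop_equation hβ (hε N) hw hc hEF hρ hΨ hΨ' hd p) h4
  rw [← h5, ← integral_add (hm.integrableOn hE (hΔ.mul hX)) (hm.integrableOn hE (hΔ.mul hY))]
  refine integral_congr_ae (ae_of_all _ fun z => ?_)
  beta_reduce
  ring

end Loop

/-! ### Derivatives of integrals over `E^n` with respect to an end point of `E` -/

/-- The first order change, `σ` times the signed indicator function of `(c, s]`, of the indicator
function of `E` when an end point of `E` is moved from `c` to `s`. -/
noncomputable def jump (σ c s x : ℝ) : ℝ :=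
  σ * ((Set.Ioc c s).indicator 1 x - (Set.Ioc s c).indicator 1 x)

theorem measurable_indicator_one {E : Set ℝ} (hE : MeasurableSet E) :
    Measurable (E.indicator (1 : ℝ → ℝ)) := measurable_one.indicator hE

theorem measurable_jump (σ c s : ℝ) : Measurable (jump σ c s) :=
  ((measurable_indicator_one measurableSet_Ioc).sub
    (measurable_indicator_one measurableSet_Ioc)).const_mul σ

theorem jump_self (σ c x : ℝ) : jump σ c c x = 0 := by simp [jump]

theorem jump_of_le {σ c s : ℝ} (h : c ≤ s) (x : ℝ) :
    jump σ c s x = (Set.Ioc c s).indicator (fun _ => σ) x := by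
  rw [jump, Set.Ioc_eq_empty (not_lt.2 h)]
  by_cases hx : x ∈ Set.Ioc c s <;> simp [hx]

theorem jump_of_ge {σ c s : ℝ} (h : s ≤ c) (x : ℝ) :
    jump σ c s x = (Set.Ioc s c).indicator (fun _ => -σ) x := by
  rw [jump, Set.Ioc_eq_empty (not_lt.2 h)]
  by_cases hx : x ∈ Set.Ioc s c <;> simp [hx]

theorem abs_jump_le {σ : ℝ} (hσ : |σ| ≤ 1) (c s x : ℝ) :
    |jump σ c s x| ≤ (Set.uIoc c s).indicator 1 x := by
  rcases le_total c s with h | h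
  · rw [jump_of_le h, Set.uIoc_of_le h]
    by_cases hx : x ∈ Set.Ioc c s <;> simp [hx, hσ]
  · rw [jump_of_ge h, Set.uIoc_of_ge h]
    by_cases hx : x ∈ Set.Ioc s c <;> simp [hx, hσ]

theorem abs_jump_le_one {σ : ℝ} (hσ : |σ| ≤ 1) (c s x : ℝ) : |jump σ c s x| ≤ 1 := by
  refine (abs_jump_le hσ c s x).trans ?_
  by_cases hx : x ∈ Set.uIoc c s <;> simp [hx]

theorem uIoc_subset_Icc {c s δ : ℝ} (hs : s ∈ Set.Ioo (c - δ) (c + δ)) :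
    Set.uIoc c s ⊆ Set.Icc (c - δ) (c + δ) := by
  intro x hx
  obtain ⟨h1, h2⟩ := hs
  rcases le_total c s with h | h
  · rw [Set.uIoc_of_le h] at hx
    exact ⟨by linarith [hx.1], by linarith [hx.2]⟩
  · rw [Set.uIoc_of_ge h] at hx
    exact ⟨by linarith [hx.1], by linarith [hx.2]⟩

theorem integral_jump_mul {E : Set ℝ} (σ : ℝ) {c s : ℝ} (hs : Set.uIoc c s ⊆ E) (h : ℝ → ℝ) :
    ∫ x in E, jump σ c s x * h x = σ * ∫ x in c..s, h x := by
  rcases le_total c s with hcs | hcs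
  · rw [Set.uIoc_of_le hcs] at hs
    simp only [jump_of_le hcs, intervalIntegral.integral_of_le hcs, ← integral_const_mul]
    rw [← Set.inter_eq_right.2 hs, ← setIntegral_indicator measurableSet_Ioc]
    congr 1 with x
    rw [Set.inter_eq_right.2 hs]
    by_cases hx : x ∈ Set.Ioc c s <;> simp [hx]
  · rw [Set.uIoc_of_ge hcs] at hs
    simp only [jump_of_ge hcs, intervalIntegral.integral_of_ge hcs]
    rw [mul_neg, ← neg_mul, ← integral_const_mul]
    rw [← Set.inter_eq_right.2 hs, ← setIntegral_indicator measurableSet_Ioc]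
    congr 1 with x
    rw [Set.inter_eq_right.2 hs]
    by_cases hx : x ∈ Set.Ioc s c <;> simp [hx]

theorem integral_abs_jump_mul_le {E : Set ℝ} {σ : ℝ} (hσ : |σ| ≤ 1) {c s M : ℝ} {h : ℝ → ℝ}
    (hs : Set.uIoc c s ⊆ E) (hi : IntegrableOn h E) (hM : ∀ x ∈ Set.uIoc c s, |h x| ≤ M) :
    ∫ x in E, |jump σ c s x| * |h x| ≤ M * |s - c| := by
  have h1 : IntegrableOn (fun x => |h x|) E := hi.norm
  calc ∫ x in E, |jump σ c s x| * |h x|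
      ≤ ∫ x in E, (Set.uIoc c s).indicator (fun x => |h x|) x := by
        refine integral_mono (h1.bdd_mul (c := 1)
          (measurable_jump σ c s).abs.aestronglyMeasurable (ae_of_all _ fun x => ?_))
          (h1.indicator measurableSet_uIoc) fun x => ?_
        · simpa using abs_jump_le_one hσ c s x
        · have := mul_le_mul_of_nonneg_right (abs_jump_le hσ c s x) (abs_nonneg (h x))
          by_cases hx : x ∈ Set.uIoc c s <;> simpa [hx] using this
    _ = ∫ x in Set.uIoc c s, |h x| := by
        rw [setIntegral_indicator measurableSet_uIoc, Set.inter_eq_right.2 hs]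
    _ ≤ M * |s - c| := by
        have := norm_setIntegral_le_of_norm_le_const (μ := volume) (s := Set.uIoc c s)
          (f := fun x => |h x|) (C := M) (by rw [Real.volume_uIoc]; exact ENNReal.ofReal_lt_top)
          (fun x hx => by simpa using hM x hx)
        rw [Real.norm_eq_abs, measureReal_def, Real.volume_uIoc,
          ENNReal.toReal_ofReal (abs_nonneg _)] at this
        exact (le_abs_self _).trans this

theorem indicator_cube {n : ℕ} (E : Set ℝ) (F : (Fin n → ℝ) → ℝ) (z : Fin n → ℝ) :
    (cube n E).indicator F z = (∏ k, E.indicator 1 (z k)) * F z := by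
  by_cases h : z ∈ cube n E
  · rw [Set.indicator_of_mem h, Finset.prod_eq_one fun k _ => by
      rw [Set.indicator_of_mem (h k (Set.mem_univ k))]; rfl, one_mul]
  · obtain ⟨k, hk⟩ : ∃ k, z k ∉ E := by simpa [cube] using h
    rw [Set.indicator_of_notMem h, Finset.prod_eq_zero (Finset.mem_univ k)
      (Set.indicator_of_notMem hk _), zero_mul]

theorem setIntegral_cube_eq {n : ℕ} {E E' : Set ℝ} (hE : MeasurableSet E) (h : E ⊆ E')
    (F : (Fin n → ℝ) → ℝ) :
    ∫ z in cube n E, F z = ∫ z in cube n E', (∏ k, E.indicator 1 (z k)) * F z := by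
  simp only [← indicator_cube]
  rw [setIntegral_indicator (measurableSet_cube hE),
    Set.inter_eq_right.2 (Set.pi_mono fun _ _ => h)]

/-- Fubini's theorem on `E^{n+1}`, with the `k`-th variable as the outer one. -/
theorem setIntegral_cube_succ' {n : ℕ} {E : Set ℝ} (k : Fin (n + 1)) {F : (Fin (n + 1) → ℝ) → ℝ}
    (hF : IntegrableOn F (cube (n + 1) E)) :
    ∫ z in cube (n + 1) E, F z = ∫ u in E, ∫ z in cube n E, F (k.insertNth u z) := by
  have hmp := (measurePreserving_piFinSuccAbove
    (fun _ : Fin (n + 1) => (volume : Measure ℝ).restrict E) k).symm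
  rw [IntegrableOn, restrict_cube] at hF
  rw [restrict_cube, restrict_cube, ← hmp.integral_comp']
  rw [integral_prod]
  · rfl
  · exact (hmp.integrable_comp_emb (MeasurableEquiv.measurableEmbedding _)).2 hF

/-- The weight in the expansion of `∏ (d(z_k) + 1_E(z_k))` belonging to a set of indices. -/
noncomputable def mixed {n : ℕ} (E : Set ℝ) (σ c s : ℝ) (T : Finset (Fin n)) (z : Fin n → ℝ) : ℝ :=
  (∏ k ∈ T, jump σ c s (z k)) * ∏ k ∈ Finset.univ \ T, E.indicator 1 (z k)

theorem measurable_mixed {n : ℕ} {E : Set ℝ} (hE : MeasurableSet E) (σ c s : ℝ)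
    (T : Finset (Fin n)) : Measurable (mixed E σ c s T) :=
  (Finset.measurable_fun_prod _ fun k _ => (measurable_jump σ c s).comp (measurable_pi_apply k)).mul
    (Finset.measurable_fun_prod _ fun k _ =>
      (measurable_indicator_one hE).comp (measurable_pi_apply k))

theorem abs_mixed_le {n : ℕ} (E : Set ℝ) (σ c s : ℝ) (T : Finset (Fin n)) (z : Fin n → ℝ) :
    |mixed E σ c s T z| ≤ ∏ k, if k ∈ T then |jump σ c s (z k)| else 1 := by
  rw [mixed, abs_mul, Finset.abs_prod, Finset.abs_prod, Finset.prod_ite, Finset.prod_const_one,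
    mul_one, Finset.filter_univ_mem]
  refine mul_le_of_le_one_right (Finset.prod_nonneg fun _ _ => abs_nonneg _) ?_
  refine Finset.prod_le_one (fun _ _ => abs_nonneg _) fun k _ => ?_
  by_cases hx : z k ∈ E <;> simp [hx]

theorem abs_mixed_le_one {n : ℕ} (E : Set ℝ) {σ : ℝ} (hσ : |σ| ≤ 1) (c s : ℝ)
    (T : Finset (Fin n)) (z : Fin n → ℝ) : |mixed E σ c s T z| ≤ 1 := by
  refine (abs_mixed_le E σ c s T z).trans (Finset.prod_le_one (fun k _ => ?_) fun k _ => ?_)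
  · split_ifs <;> positivity
  · split_ifs
    · exact abs_jump_le_one hσ c s _
    · exact le_rfl

section

variable {n : ℕ} {ρ : ℝ → ℝ} {E E' : Set ℝ} {σ c δ : ℝ}

theorem integrableOn_mixed (hE : MeasurableSet E) (hσ : |σ| ≤ 1) (s : ℝ) (T : Finset (Fin n))
    {F : (Fin n → ℝ) → ℝ} (hF : IntegrableOn F (cube n E')) :
    IntegrableOn (fun z => mixed E σ c s T z * F z) (cube n E') :=
  hF.bdd_mul (c := 1) (measurable_mixed hE σ c s T).aestronglyMeasurable
    (ae_of_all _ fun z => abs_mixed_le_one E hσ c s T z)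

theorem hasDerivAt_of_sq_bound {h : ℝ → ℝ} {C : ℝ} (h0 : h c = 0)
    (hb : ∀ᶠ s in 𝓝 c, |h s| ≤ C * |s - c| ^ 2) : HasDerivAt h 0 c := by
  rw [hasDerivAt_iff_isLittleO]
  simp only [h0, sub_zero, smul_zero]
  have h1 : h =O[𝓝 c] fun s => (s - c) ^ 2 :=
    Asymptotics.IsBigO.of_bound C (by simpa using hb)
  refine h1.trans_isLittleO ?_
  have h2 : (fun s : ℝ => s - c) =o[𝓝 c] fun _ => (1 : ℝ) := by
    rw [Asymptotics.isLittleO_one_iff]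
    exact (continuous_id.sub continuous_const).tendsto' c 0 (by simp)
  simpa [sq] using h2.mul_isBigO (Asymptotics.isBigO_refl (fun s : ℝ => s - c) (𝓝 c))

theorem exists_bound_mul_growth (hρ : ContinuousOn ρ (Set.Icc (c - δ) (c + δ))) (N : ℕ) :
    ∃ M, 0 ≤ M ∧ ∀ x ∈ Set.Icc (c - δ) (c + δ), |(1 + |x|) ^ N * ρ x| ≤ M := by
  obtain ⟨M, hM⟩ := isCompact_Icc.exists_bound_of_continuousOn
    (f := fun x => (1 + |x|) ^ N * ρ x) ((Continuous.continuousOn (by fun_prop)).mul hρ)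
  exact ⟨|M|, abs_nonneg M, fun x hx => (hM x hx).trans (le_abs_self M)⟩

/-- Terms with two or more factors `d` do not contribute to the derivative. -/
theorem hasDerivAt_mixed_of_two_le (hδ : 0 < δ) (hK : Set.Icc (c - δ) (c + δ) ⊆ E')
    (hE : MeasurableSet E) (hE' : MeasurableSet E') (hm : HasMoments ρ E')
    (hρ : ContinuousOn ρ (Set.Icc (c - δ) (c + δ))) (hσ : |σ| ≤ 1)
    {φ : (Fin n → ℝ) → ℝ} (hφ : Tame (cube n E') φ) {T : Finset (Fin n)} (hT : 2 ≤ T.card) :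
    HasDerivAt (fun s => ∫ z in cube n E', mixed E σ c s T z * (φ z * ∏ k, ρ (z k))) 0 c := by
  have hint := hm.integrableOn hE' hφ
  obtain ⟨-, C, N, hC, hb⟩ := hφ
  obtain ⟨M, hM0, hM⟩ := exists_bound_mul_growth hρ N
  set W := ∫ x in E', |(1 + |x|) ^ N * ρ x|
  have hW : 0 ≤ W := integral_nonneg fun _ => abs_nonneg _
  have hTne : T.Nonempty := Finset.card_pos.1 (by omega)
  refine hasDerivAt_of_sq_bound (C := C * (M ^ T.card * W ^ (Finset.univ \ T).card)) ?_ ?_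
  · obtain ⟨k, hk⟩ := hTne
    have : ∀ z, mixed E σ c c T z = 0 := fun z => by
      rw [mixed, Finset.prod_eq_zero hk (jump_self σ c (z k)), zero_mul]
    simp [this]
  · filter_upwards [Ioo_mem_nhds (show c - δ < c by linarith) (show c < c + δ by linarith),
      Ioo_mem_nhds (show c - 1 < c by linarith) (show c < c + 1 by linarith)] with s hs hs1
    have hsub := uIoc_subset_Icc hs
    have hs1' : |s - c| ≤ 1 := abs_le.2 ⟨by linarith [hs1.1], by linarith [hs1.2]⟩
    -- A product majorant, so that the integral factorizes: each index in `T` contributes at most `M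
    -- |s - c|`, each other index at most the constant `W`.
    set G : Fin n → ℝ → ℝ := fun k x =>
      (if k ∈ T then |jump σ c s x| else 1) * |(1 + |x|) ^ N * ρ x| with hG
    have hGi : ∀ k, IntegrableOn (G k) E' := by
      intro k
      by_cases hk : k ∈ T
      · simp only [hG, if_pos hk]
        exact (hm N).abs.bdd_mul (c := 1) (measurable_jump σ c s).abs.aestronglyMeasurable
          (ae_of_all _ fun x => by simpa using abs_jump_le_one hσ c s x)
      · simp only [hG, if_neg hk, one_mul]
        exact (hm N).abs
    have hprod : IntegrableOn (fun z : Fin n → ℝ => ∏ k, G k (z k)) (cube n E') := by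
      rw [IntegrableOn, restrict_cube]
      exact Integrable.fintype_prod hGi
    have h1 : |∫ z in cube n E', mixed E σ c s T z * (φ z * ∏ k, ρ (z k))| ≤
        ∫ z in cube n E', C * ∏ k, G k (z k) := by
      refine (norm_integral_le_integral_norm _).trans (setIntegral_mono_on
        (integrableOn_mixed hE hσ s T hint).norm (hprod.const_mul C) (measurableSet_cube hE')
        fun z hz => ?_)
      rw [norm_mul, norm_mul]
      simp only [Real.norm_eq_abs, hG, Finset.prod_mul_distrib, abs_mul, Finset.abs_prod]
      have h2 := mul_le_mul (abs_mixed_le E σ c s T z) (hb z hz) (abs_nonneg _)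
        (Finset.prod_nonneg fun k _ => by split_ifs <;> positivity)
      have h3 : ∏ k, |(1 + |z k|) ^ N| = ∏ k, (1 + |z k|) ^ N :=
        Finset.prod_congr rfl fun k _ => abs_of_nonneg (by positivity)
      rw [h3]
      calc _ ≤ _ := le_of_eq (mul_assoc _ _ _).symm
        _ ≤ _ := mul_le_mul_of_nonneg_right h2 (Finset.prod_nonneg fun _ _ => abs_nonneg _)
        _ = _ := by ring
    refine h1.trans ?_
    rw [integral_const_mul, restrict_cube, integral_fintype_prod_eq_prod, mul_assoc]
    refine mul_le_mul_of_nonneg_left ?_ hC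
    have h4 : ∀ k, ∫ x in E', G k x ≤ if k ∈ T then M * |s - c| else W := by
      intro k
      by_cases hk : k ∈ T
      · simp only [hG, if_pos hk]
        exact integral_abs_jump_mul_le hσ (hsub.trans hK) (hm N) fun x hx => hM x (hsub hx)
      · simp only [hG, if_neg hk, one_mul]
        exact le_rfl
    refine (Finset.prod_le_prod (fun k _ => integral_nonneg fun x => ?_) fun k _ => h4 k).trans ?_
    · simp only [hG]
      split_ifs <;> positivity
    · rw [Finset.prod_ite, Finset.filter_univ_mem, Finset.prod_const, Finset.prod_const, mul_pow,
        show (Finset.univ.filter fun k => k ∉ T) = Finset.univ \ T by ext; simp]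
      have : |s - c| ^ T.card ≤ |s - c| ^ 2 := pow_le_pow_of_le_one (abs_nonneg _) hs1' hT
      calc _ ≤ M ^ T.card * |s - c| ^ 2 * W ^ (Finset.univ \ T).card := by gcongr
        _ = _ := by ring

/-- The marginal of an integrand on `E^{n+1}` in the `k`-th variable is continuous. -/
theorem continuousOn_marginal (hE : MeasurableSet E) (hm : HasMoments ρ E)
    (hEE' : E ⊆ E') (hK : Set.Icc (c - δ) (c + δ) ⊆ E')
    {φ : (Fin (n + 1) → ℝ) → ℝ} (hφ : Tame (cube (n + 1) E') φ) (k : Fin (n + 1)) :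
    ContinuousOn (fun u => ∫ z in cube n E, φ (k.insertNth u z) * ∏ i, ρ (z i))
      (Set.Icc (c - δ) (c + δ)) := by
  have hsec : ∀ u ∈ Set.Icc (c - δ) (c + δ), Tame (cube n E) fun z => φ (k.insertNth u z) :=
    fun u hu => (hφ.insertNth k (hK hu)).mono (Set.pi_mono fun _ _ => hEE')
  obtain ⟨hcont, C, N, hC, hb⟩ := hφ
  obtain ⟨D, hD⟩ := isCompact_Icc.exists_bound_of_continuousOn
    (f := fun x : ℝ => (1 + |x|) ^ N) (s := Set.Icc (c - δ) (c + δ))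
    (Continuous.continuousOn (by fun_prop))
  refine continuousOn_of_dominated
    (bound := fun z => C * D * ‖∏ i, ((1 + |z i|) ^ N * ρ (z i))‖) ?_ ?_ ?_ ?_
  · exact fun u hu => (hm.integrableOn hE (hsec u hu)).aestronglyMeasurable
  · intro u hu
    filter_upwards [ae_restrict_mem (measurableSet_cube hE)] with z hz
    have h1 := hb _ (insertNth_mem_cube k (hK hu) (Set.pi_mono (fun _ _ => hEE') hz))
    rw [Fin.prod_univ_succAbove _ k, Fin.insertNth_apply_same,
      Finset.prod_congr rfl fun i _ => by rw [Fin.insertNth_apply_succAbove]] at h1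
    have h2 := (le_abs_self _).trans (hD u hu)
    have h3 := zero_le_one.trans (one_le_growth z N)
    rw [norm_mul, Finset.prod_mul_distrib, norm_mul, Real.norm_eq_abs, Real.norm_eq_abs,
      Real.norm_eq_abs, abs_of_nonneg h3, ← mul_assoc]
    refine mul_le_mul_of_nonneg_right (h1.trans ?_) (abs_nonneg _)
    rw [← mul_assoc]
    gcongr
  · exact (hm.integrable_prod n N).norm.const_mul _
  · filter_upwards [ae_restrict_mem (measurableSet_cube hE)] with z hz
    refine ContinuousOn.mul_const ?_ _
    exact hcont.comp (Continuous.continuousOn (by fun_prop)) fun u hu =>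
      insertNth_mem_cube k (hK hu) (Set.pi_mono (fun _ _ => hEE') hz)

/-- The terms with one factor `d`. -/
theorem hasDerivAt_mixed_singleton (hδ : 0 < δ) (hK : Set.Icc (c - δ) (c + δ) ⊆ E')
    (hE : MeasurableSet E) (hEE' : E ⊆ E') (hE' : MeasurableSet E') (hm : HasMoments ρ E')
    (hρ : ContinuousOn ρ (Set.Icc (c - δ) (c + δ))) (hσ : |σ| ≤ 1)
    {φ : (Fin (n + 1) → ℝ) → ℝ} (hφ : Tame (cube (n + 1) E') φ) (k : Fin (n + 1)) :
    HasDerivAt (fun s => ∫ z in cube (n + 1) E', mixed E σ c s {k} z * (φ z * ∏ i, ρ (z i)))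
      (σ * (ρ c * ∫ z in cube n E, φ (k.insertNth c z) * ∏ i, ρ (z i))) c := by
  have hK' : ContinuousOn
      (fun u => ρ u * ∫ z in cube n E, φ (k.insertNth u z) * ∏ i, ρ (z i))
      (Set.Icc (c - δ) (c + δ)) :=
    hρ.mul (continuousOn_marginal hE (hm.mono hEE') hEE' hK hφ k)
  have hc : c ∈ Set.Ioo (c - δ) (c + δ) := ⟨by linarith, by linarith⟩
  have hnhds := Ioo_mem_nhds hc.1 hc.2
  -- With the other variables integrated out, the single jump leaves `σ` times the integral from `c`
  -- to `s` of the continuous function `ρ` times the marginal.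
  have hFTC := intervalIntegral.integral_hasDerivAt_right (a := c) (b := c)
    (f := fun u => ρ u * ∫ z in cube n E, φ (k.insertNth u z) * ∏ i, ρ (z i))
    IntervalIntegrable.refl
    ((hK'.mono Set.Ioo_subset_Icc_self).stronglyMeasurableAtFilter isOpen_Ioo c hc)
    (hK'.continuousAt (mem_of_superset hnhds Set.Ioo_subset_Icc_self))
  refine (hFTC.const_mul σ).congr_of_eventuallyEq ?_
  filter_upwards [hnhds] with s hs
  have hsub := (uIoc_subset_Icc hs).trans hK
  rw [← integral_jump_mul σ hsub, setIntegral_cube_succ' k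
    (integrableOn_mixed hE hσ s _ (hm.integrableOn hE' hφ))]
  congr 1 with u
  rw [setIntegral_cube_eq hE hEE', ← integral_const_mul, ← integral_const_mul]
  congr 1 with z
  have : Finset.univ \ {k} = Finset.univ.map k.succAboveEmb := by
    rw [Fin.univ_succAbove n k]
    ext i
    simp [Fin.exists_succAbove_eq_iff, or_iff_not_imp_left]
  rw [mixed, Finset.prod_singleton, Fin.insertNth_apply_same, this, Finset.prod_map,
    Fin.prod_univ_succAbove _ k]
  simp only [Fin.insertNth_apply_same, Fin.succAboveEmb_apply, Fin.insertNth_apply_succAbove]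
  ring

/-- The derivative of an integral over `E^{n+1}` with respect to an end point of `E`. -/
theorem hasDerivAt_integral_cube {Es : ℝ → Set ℝ} (hδ : 0 < δ)
    (hK : Set.Icc (c - δ) (c + δ) ⊆ E')
    (hE : MeasurableSet E) (hEE' : E ⊆ E') (hE' : MeasurableSet E') (hEs : ∀ s, MeasurableSet (Es s))
    (hEsE' : ∀ᶠ s in 𝓝 c, Es s ⊆ E')
    (hind : ∀ᶠ s in 𝓝 c, ∀ x, x ≠ s → x ≠ c →
      (Es s).indicator (1 : ℝ → ℝ) x = jump σ c s x + E.indicator 1 x)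
    (hm : HasMoments ρ E') (hρ : ContinuousOn ρ (Set.Icc (c - δ) (c + δ))) (hσ : |σ| ≤ 1)
    {φ : (Fin (n + 1) → ℝ) → ℝ} (hφ : Tame (cube (n + 1) E') φ) :
    HasDerivAt (fun s => ∫ z in cube (n + 1) (Es s), φ z * ∏ i, ρ (z i))
      (∑ k : Fin (n + 1), σ * (ρ c * ∫ z in cube n E, φ (k.insertNth c z) * ∏ i, ρ (z i))) c := by
  -- Expanding `∏ (jump + 1_E)` over the set `T` of indices that take the jump: the empty set gives
  -- a constant, singletons give the derivative, larger sets give zero.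
  have hterm : ∀ T ∈ (Finset.univ : Finset (Finset (Fin (n + 1)))),
      HasDerivAt (fun s => ∫ z in cube (n + 1) E', mixed E σ c s T z * (φ z * ∏ i, ρ (z i)))
      (∑ k, if T = {k} then
        σ * (ρ c * ∫ z in cube n E, φ (k.insertNth c z) * ∏ i, ρ (z i)) else 0) c := by
    intro T _
    rcases lt_trichotomy T.card 1 with h | h | h
    · have hT : T = ∅ := Finset.card_eq_zero.1 (by omega)
      subst hT
      have hne : ∀ k : Fin (n + 1), (∅ : Finset (Fin (n + 1))) ≠ {k} := fun k h =>
        Finset.singleton_ne_empty k h.symm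
      simp only [hne, if_false, Finset.sum_const_zero]
      have : ∀ s, mixed E σ c s (∅ : Finset (Fin (n + 1))) = mixed E σ c c ∅ := fun s => by
        ext z; simp [mixed]
      simp only [this]
      exact hasDerivAt_const _ _
    · obtain ⟨k, rfl⟩ := Finset.card_eq_one.1 h
      simp only [Finset.singleton_inj, Finset.sum_ite_eq, Finset.mem_univ, if_true]
      exact hasDerivAt_mixed_singleton hδ hK hE hEE' hE' hm hρ hσ hφ k
    · have hne : ∀ k : Fin (n + 1), T ≠ {k} := by
        rintro k rfl
        simp at h
      simp only [hne, if_false, Finset.sum_const_zero]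
      exact hasDerivAt_mixed_of_two_le hδ hK hE hE' hm hρ hσ hφ h
  have hsum := HasDerivAt.fun_sum hterm
  rw [Finset.sum_comm] at hsum
  simp only [Finset.sum_ite_eq', Finset.mem_univ, if_true] at hsum
  refine hsum.congr_of_eventuallyEq ?_
  filter_upwards [hEsE', hind] with s hs hinds
  rw [setIntegral_cube_eq (hEs s) hs, ← integral_finsetSum]
  swap
  · exact fun T _ => integrableOn_mixed hE hσ s T (hm.integrableOn hE' hφ)
  -- The indicator identity may fail when a coordinate equals `s` or `c`; these hyperplanes are
  -- null.
  have hae : ∀ x : ℝ, ∀ᵐ z ∂(volume : Measure (Fin (n + 1) → ℝ)).restrict (cube (n + 1) E'),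
      ∀ i, z i ≠ x := by
    intro x
    refine ae_restrict_of_ae (ae_all_iff.2 fun i => ?_)
    exact Measure.ae_eval_ne (α := fun _ => ℝ) (fun _ => volume) i x
  refine integral_congr_ae ?_
  filter_upwards [hae s, hae c] with z hzs hzc
  rw [Finset.prod_congr rfl fun k _ => hinds (z k) (hzs k) (hzc k), Finset.prod_add,
    Finset.powerset_univ, Finset.sum_mul]
  rfl

end

/-! ### Moving one end point of a union of intervals. -/

theorem indicator_range_right {a : EReal} {c s x : ℝ} (hc : a < c) (hs : a < s) :
    (range a s).indicator (1 : ℝ → ℝ) x = jump 1 c s x + (range a c).indicator 1 x := by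
  classical
  have hr : ∀ t : ℝ, x ∈ range a t ↔ a ≤ x ∧ x ≤ t := fun t => by
    simp only [range, Set.mem_ofPred_eq, EReal.coe_le_coe_iff]
  have hlt : ∀ t : ℝ, a < t → t < x → a ≤ x := fun t h1 h2 =>
    (h1.trans (EReal.coe_lt_coe_iff.2 h2)).le
  simp only [jump, Set.indicator_apply, hr, Set.mem_Ioc, Pi.one_apply, one_mul]
  rcases le_or_gt x c with h1 | h1 <;> rcases le_or_gt x s with h2 | h2
  · simp [h1, h2, not_lt.2 h1, not_lt.2 h2]
  · simp [h1, h2, not_lt.2 h1, not_le.2 h2, hlt s hs h2]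
  · simp [h1, h2, not_le.2 h1, not_lt.2 h2, hlt c hc h1]
  · simp [not_le.2 h1, not_le.2 h2]

/-- The jump is supported on an interval open on the left and closed on the right, which fits a
right end exactly; at a left end the points `c` and `s` have to be excluded. -/
theorem indicator_range_left {d : EReal} {c s x : ℝ} (hc : c < d) (hs : s < d) (hxc : x ≠ c)
    (hxs : x ≠ s) :
    (range s d).indicator (1 : ℝ → ℝ) x = jump (-1) c s x + (range c d).indicator 1 x := by
  classical
  have hr : ∀ t : ℝ, x ∈ range t d ↔ t ≤ x ∧ x ≤ d := fun t => by
    simp only [range, Set.mem_ofPred_eq, EReal.coe_le_coe_iff]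
  have hlt : ∀ t : ℝ, t < d → x < t → x ≤ d := fun t h1 h2 =>
    ((EReal.coe_lt_coe_iff.2 h2).trans h1).le
  simp only [jump, Set.indicator_apply, hr, Set.mem_Ioc, Pi.one_apply]
  rcases lt_or_gt_of_ne hxc with h1 | h1 <;> rcases lt_or_gt_of_ne hxs with h2 | h2
  · simp [not_lt.2 h1.le, not_lt.2 h2.le, not_le.2 h1, not_le.2 h2]
  · simp [h1.le, h2, h2.le, not_lt.2 h1.le, not_le.2 h1, hlt c hc h1]
  · simp [h1, h1.le, h2.le, not_le.2 h2, not_lt.2 h2.le, hlt s hs h2]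
  · simp [not_le.2 h1, not_le.2 h2, h1.le, h2.le]

section

variable {r n : ℕ} {c : Fin (2 * r) → EReal}

theorem coe_toReal_end {j : Fin (2 * r)} (hj : j ∈ finiteEnds c) :
    ((c j).toReal : EReal) = c j := by
  have hj' : c j ≠ ⊥ ∧ c j ≠ ⊤ := by simpa [finiteEnds] using hj
  exact EReal.coe_toReal hj'.2 hj'.1

theorem eventually_between (hc : StrictMono c) {j : Fin (2 * r)} (hj : j ∈ finiteEnds c) :
    ∀ᶠ s : ℝ in 𝓝 (c j).toReal, ∀ i, (i < j → c i < s) ∧ (j < i → (s : EReal) < c i) := by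
  have ht : Tendsto (fun s : ℝ => (s : EReal)) (𝓝 (c j).toReal) (𝓝 (c j)) :=
    continuous_coe_real_ereal.tendsto' _ _ (coe_toReal_end hj)
  refine eventually_all.2 fun i => ?_
  rcases lt_trichotomy i j with h | h | h
  · filter_upwards [ht.eventually_const_lt (hc h)] with s hs
    exact ⟨fun _ => hs, fun h' => absurd h h'.not_gt⟩
  · exact Eventually.of_forall fun s => ⟨fun h' => absurd h h'.ne, fun h' => absurd h h'.ne'⟩
  · filter_upwards [ht.eventually_lt_const (hc h)] with s hs
    exact ⟨fun h' => absurd h' h.not_gt, fun _ => hs⟩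

theorem eventually_strictMono_update (hc : StrictMono c) {j : Fin (2 * r)}
    (hj : j ∈ finiteEnds c) :
    ∀ᶠ s : ℝ in 𝓝 (c j).toReal, StrictMono (Function.update c j (s : EReal)) := by
  filter_upwards [eventually_between hc hj] with s hs a b hab
  by_cases ha : a = j
  · subst ha
    rw [Function.update_self, Function.update_of_ne hab.ne']
    exact (hs b).2 hab
  · by_cases hb : b = j
    · subst hb
      rw [Function.update_self, Function.update_of_ne hab.ne]
      exact (hs a).1 hab
    · rw [Function.update_of_ne ha, Function.update_of_ne hb]
      exact hc hab

/-- Only the interval numbered `j / 2` changes. A point in another interval lies in neither version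
of that one, by disjointness before and after the move, so the jump vanishes there. -/
theorem indicator_intervals_update (hc : StrictMono c) {j : Fin (2 * r)} (hj : j ∈ finiteEnds c)
    {s x : ℝ} (hs : StrictMono (Function.update c j (s : EReal))) (hxs : x ≠ s)
    (hxc : x ≠ (c j).toReal) :
    (intervals (Function.update c j (s : EReal))).indicator (1 : ℝ → ℝ) x =
      jump (endSign j) (c j).toReal s x + (intervals c).indicator 1 x := by
  classical
  have hcj := coe_toReal_end hj
  set i₀ : Fin r := ⟨j / 2, by omega⟩ with hi₀
  have hone : (range (Function.update c j (s : EReal) ⟨2 * i₀, by omega⟩)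
      (Function.update c j (s : EReal) ⟨2 * i₀ + 1, by omega⟩)).indicator (1 : ℝ → ℝ) x =
      jump (endSign j) (c j).toReal s x +
        (range (c ⟨2 * i₀, by omega⟩) (c ⟨2 * i₀ + 1, by omega⟩)).indicator 1 x := by
    rcases Nat.mod_two_eq_zero_or_one j with h | h
    · have e1 : (⟨2 * i₀, by omega⟩ : Fin (2 * r)) = j := Fin.ext (by simp [hi₀]; omega)
      have hlt : j < ⟨2 * i₀ + 1, by omega⟩ := Fin.mk_lt_mk.2 (by simp [hi₀]; omega)
      have h1 := hc hlt
      have h2 := hs hlt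
      rw [Function.update_self, Function.update_of_ne hlt.ne'] at h2
      rw [e1, Function.update_self, Function.update_of_ne hlt.ne', endSign, if_pos h]
      rw [← hcj] at h1
      rw [indicator_range_left h1 h2 hxc hxs, hcj]
    · have e1 : (⟨2 * i₀ + 1, by omega⟩ : Fin (2 * r)) = j := Fin.ext (by simp [hi₀]; omega)
      have hlt : ⟨2 * i₀, by omega⟩ < j := Fin.mk_lt_mk.2 (by simp [hi₀]; omega)
      have h1 := hc hlt
      have h2 := hs hlt
      rw [Function.update_self, Function.update_of_ne hlt.ne] at h2
      rw [e1, Function.update_self, Function.update_of_ne hlt.ne, endSign, if_neg (by omega)]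
      rw [← hcj] at h1
      rw [indicator_range_right h1 h2, hcj]
  have hother : ∀ i, i ≠ i₀ → range (Function.update c j (s : EReal) ⟨2 * i, by omega⟩)
      (Function.update c j (s : EReal) ⟨2 * i + 1, by omega⟩) =
      range (c ⟨2 * i, by omega⟩) (c ⟨2 * i + 1, by omega⟩) := by
    intro i hi
    have hi' : (i : ℕ) ≠ j / 2 := fun h => hi (Fin.ext h)
    rw [Function.update_of_ne (Fin.ne_of_val_ne (by simp; omega)),
      Function.update_of_ne (Fin.ne_of_val_ne (by simp; omega))]
  by_cases hP : ∃ i, i ≠ i₀ ∧ x ∈ range (c ⟨2 * i, by omega⟩) (c ⟨2 * i + 1, by omega⟩)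
  · obtain ⟨i, hi, hx⟩ := hP
    have h1 := Set.disjoint_left.1 (disjoint_range hc hi) hx
    have hx' := hx
    rw [← hother i hi] at hx'
    have h2 := Set.disjoint_left.1 (disjoint_range hs hi) hx'
    rw [Set.indicator_of_notMem h1, Set.indicator_of_notMem h2, add_zero] at hone
    rw [Set.indicator_of_mem (range_subset_intervals _ i hx'),
      Set.indicator_of_mem (range_subset_intervals _ i hx), ← hone, zero_add]
  · push Not at hP
    have h1 : x ∈ intervals c ↔ x ∈ range (c ⟨2 * i₀, by omega⟩) (c ⟨2 * i₀ + 1, by omega⟩) := by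
      refine ⟨fun h => ?_, fun h => range_subset_intervals _ i₀ h⟩
      obtain ⟨i, hi⟩ := Set.mem_iUnion.1 h
      by_cases hii : i = i₀
      · rwa [hii] at hi
      · exact absurd hi (hP i hii)
    have h2 : x ∈ intervals (Function.update c j (s : EReal)) ↔
        x ∈ range (Function.update c j (s : EReal) ⟨2 * i₀, by omega⟩)
          (Function.update c j (s : EReal) ⟨2 * i₀ + 1, by omega⟩) := by
      refine ⟨fun h => ?_, fun h => range_subset_intervals _ i₀ h⟩
      obtain ⟨i, hi⟩ := Set.mem_iUnion.1 h
      by_cases hii : i = i₀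
      · rwa [hii] at hi
      · refine absurd ?_ (hP i hii)
        rw [← hother i hii]
        exact hi
    rw [Set.indicator_apply, Set.indicator_apply, h1, h2, ← Set.indicator_apply,
      ← Set.indicator_apply, hone]

/-- The derivative with respect to an end point where `f` does not vanish. -/
theorem hasDerivAt_end {A B : EReal} {ρ : ℝ → ℝ} {f g : Polynomial ℝ}
    (hw : IsRationalWeight A B ρ f g) (hc : StrictMono c)
    (hEF : intervals c ⊆ range A B) (hρ : IntegrableOn ρ (intervals c)) {U : Set ℝ}
    (hU : IsOpen U) (hEU : intervals c ⊆ U) {φ : (Fin (n + 1) → ℝ) → ℝ}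
    (hφ : Tame (cube (n + 1) U) φ) {j : Fin (2 * r)} (hj : j ∈ finiteEnds c)
    (hf : f.eval (c j).toReal ≠ 0) :
    HasDerivAt (fun s : ℝ => ∫ z in cube (n + 1) (intervals (Function.update c j (s : EReal))),
        φ z * ∏ i, ρ (z i))
      (∑ k : Fin (n + 1), endSign j * (ρ (c j).toReal *
        ∫ z in cube n (intervals c), φ (k.insertNth (c j).toReal z) * ∏ i, ρ (z i)))
      (c j).toReal := by
  have hjE := end_mem_intervals hc hj
  obtain ⟨hA, hB⟩ := hw.mem_interior (hEF hjE) hf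
  have hnhds : ∀ᶠ x : ℝ in 𝓝 (c j).toReal, (A < x ∧ (x : EReal) < B) ∧ f.eval x ≠ 0 ∧ x ∈ U := by
    have hcoe := continuous_coe_real_ereal.tendsto (c j).toReal
    exact ((hcoe.eventually_const_lt hA).and (hcoe.eventually_lt_const hB)).and
      ((f.continuous.continuousAt.eventually_ne hf).and (hU.mem_nhds (hEU hjE)))
  obtain ⟨δ, hδ, hball⟩ := Metric.nhds_basis_closedBall.mem_iff.1 hnhds
  rw [Real.closedBall_eq_Icc] at hball
  have hρc : ContinuousOn ρ (Set.Icc ((c j).toReal - δ) ((c j).toReal + δ)) := fun x hx =>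
    (hw.hasDerivAt x (hball hx).1.1 (hball hx).1.2
      (hball hx).2.1).continuousAt.continuousWithinAt
  have hE := measurableSet_intervals c
  have hm := hw.hasMoments hE hEF hρ
  -- Moving the end outward leaves `E`, where nothing is known about integrability. Adding a small
  -- compact interval around `c_j`, on which `f ≠ 0` and hence `ρ` is continuous, gives a fixed
  -- domain for all nearby positions.
  have hm' : HasMoments ρ (intervals c ∪ Set.Icc ((c j).toReal - δ) ((c j).toReal + δ)) :=
    fun N => (hm N).union (ContinuousOn.integrableOn_Icc
      ((Continuous.continuousOn (by fun_prop)).mul hρc))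
  have hsm := eventually_strictMono_update hc hj
  have hind : ∀ᶠ s : ℝ in 𝓝 (c j).toReal, ∀ x, x ≠ s → x ≠ (c j).toReal →
      (intervals (Function.update c j (s : EReal))).indicator (1 : ℝ → ℝ) x =
        jump (endSign j) (c j).toReal s x + (intervals c).indicator 1 x := by
    filter_upwards [hsm] with s hs x hxs hxc
    exact indicator_intervals_update hc hj hs hxs hxc
  have hsign : |(endSign j : ℝ)| ≤ 1 := by
    rw [endSign]; split_ifs <;> simp
  refine hasDerivAt_integral_cube hδ Set.subset_union_right hE Set.subset_union_left
    (hE.union measurableSet_Icc) (fun s => measurableSet_intervals _) ?_ hind hm' hρc hsign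
    (hφ.mono (Set.pi_mono fun _ _ => Set.union_subset hEU fun x hx => (hball hx).2.2))
  filter_upwards [hind, Ioo_mem_nhds (show (c j).toReal - δ < (c j).toReal by linarith)
    (show (c j).toReal < (c j).toReal + δ by linarith)] with s hs hsδ x hx
  by_cases hxs : x = s
  · exact Or.inr (hxs ▸ Set.Ioo_subset_Icc_self hsδ)
  by_cases hxc : x = (c j).toReal
  · exact Or.inl (hxc ▸ hjE)
  have h := hs x hxs hxc
  rw [Set.indicator_of_mem hx] at h
  by_contra hxE
  rw [Set.mem_union, not_or] at hxE
  have h2 := abs_jump_le hsign (c j).toReal s x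
  rw [Set.indicator_of_notMem fun h => hxE.2 (uIoc_subset_Icc hsδ h)] at h2
  rw [Set.indicator_of_notMem hxE.1, abs_nonpos_iff.1 h2] at h
  simp at h

/-- If `E = F`, then `f` vanishes at all finite end points. -/
theorem eval_end_eq_zero {A B : EReal} {ρ : ℝ → ℝ} {f g : Polynomial ℝ}
    (hw : IsRationalWeight A B ρ f g) (hc : StrictMono c)
    (hEF : intervals c = range A B) {j : Fin (2 * r)} (hj : j ∈ finiteEnds c) :
    f.eval (c j).toReal = 0 := by
  by_contra hf
  have hjE := end_mem_intervals hc hj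
  -- If `f` did not vanish at `c_j`, this point would be interior to `F = E`. But points just
  -- outside `c_j` cannot lie in `E`, since every other end point stays on its own side.
  obtain ⟨hA, hB⟩ := hw.mem_interior (hEF ▸ hjE) hf
  have hcj := coe_toReal_end hj
  have hcoe := continuous_coe_real_ereal.tendsto (c j).toReal
  have hev : ∀ᶠ x : ℝ in 𝓝 (c j).toReal, x ∈ intervals c ∧
      ∀ i, (i < j → c i < x) ∧ (j < i → (x : EReal) < c i) := by
    filter_upwards [hcoe.eventually_const_lt hA, hcoe.eventually_lt_const hB,
      eventually_between hc hj] with x h1 h2 h3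
    exact ⟨hEF ▸ ⟨h1.le, h2.le⟩, h3⟩
  rcases Nat.mod_two_eq_zero_or_one j with h | h
  · obtain ⟨x, ⟨hxE, hx⟩, hxj⟩ := ((hev.filter_mono nhdsWithin_le_nhds).and
      (self_mem_nhdsWithin (s := Set.Iio (c j).toReal))).exists
    obtain ⟨i, h1, h2⟩ := Set.mem_iUnion.1 hxE
    have hxj' : (x : EReal) < c j := hcj ▸ EReal.coe_lt_coe_iff.2 hxj
    have hlt : (⟨2 * i, by omega⟩ : Fin (2 * r)) < j := hc.lt_iff_lt.1 (h1.trans_lt hxj')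
    have hlt' : (⟨2 * i + 1, by omega⟩ : Fin (2 * r)) < j :=
      Fin.mk_lt_of_lt_val (by have := Fin.lt_def.1 hlt; simp only at this; omega)
    exact absurd ((hx _).1 hlt') (not_lt.2 h2)
  · obtain ⟨x, ⟨hxE, hx⟩, hxj⟩ := ((hev.filter_mono nhdsWithin_le_nhds).and
      (self_mem_nhdsWithin (s := Set.Ioi (c j).toReal))).exists
    obtain ⟨i, h1, h2⟩ := Set.mem_iUnion.1 hxE
    have hxj' : c j < (x : EReal) := hcj ▸ EReal.coe_lt_coe_iff.2 hxj
    have hlt : j < (⟨2 * i + 1, by omega⟩ : Fin (2 * r)) := hc.lt_iff_lt.1 (hxj'.trans_le h2)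
    have hlt' : j < (⟨2 * i, by omega⟩ : Fin (2 * r)) :=
      Fin.lt_def.2 (by have := Fin.lt_def.1 hlt; simp only at this ⊢; omega)
    exact absurd ((hx _).2 hlt') (not_lt.2 h1)

end

/-! ### The loop equations in terms of power sums -/

/-- The power sum `p_a(z) = ∑_k z_k^a`. -/
noncomputable def psum {n : ℕ} (a : ℕ) (z : Fin n → ℝ) : ℝ := ∑ k, z k ^ a

theorem psum_zero {n : ℕ} (z : Fin n → ℝ) : psum 0 z = n := by simp [psum]

theorem tame_psum {n : ℕ} {S : Set (Fin n → ℝ)} (a : ℕ) : Tame S (psum a) :=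
  Tame.sum _ fun k _ => (Tame.coord k).pow a

theorem two_mul_sum_pairs {n : ℕ} (G : ℝ → ℝ → ℝ) (hG : ∀ x y, G x y = G y x) (z : Fin n → ℝ) :
    2 * ∑ q ∈ pairs n, G (z q.1) (z q.2) = (∑ i, ∑ j, G (z i) (z j)) - ∑ i, G (z i) (z i) := by
  have h : ∀ i, ∑ j, G (z i) (z j) = (∑ j, if i < j then G (z i) (z j) else 0) +
      (∑ j, if j < i then G (z j) (z i) else 0) + G (z i) (z i) := by
    intro i
    have : G (z i) (z i) = ∑ j, if j = i then G (z i) (z i) else 0 := by simp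
    rw [this, ← Finset.sum_add_distrib, ← Finset.sum_add_distrib]
    refine Finset.sum_congr rfl fun j _ => ?_
    rcases lt_trichotomy i j with h | h | h
    · simp [h, h.not_gt, h.ne']
    · simp [h]
    · simp [h, h.not_gt, h.ne, hG (z i)]
  simp only [h, Finset.sum_add_distrib]
  rw [pairs, Finset.sum_filter, ← Finset.univ_product_univ, Finset.sum_product,
    Finset.sum_comm (f := fun i j => if j < i then G (z j) (z i) else 0)]
  ring

theorem dividedDiff_add (h₁ h₂ : Polynomial ℝ) (x y : ℝ) :
    dividedDiff (h₁ + h₂) x y = dividedDiff h₁ x y + dividedDiff h₂ x y :=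
  Polynomial.sum_add_index h₁ h₂ _ (fun i => by simp) fun i a b => by ring

theorem dividedDiff_monomial (i : ℕ) (a x y : ℝ) :
    dividedDiff (Polynomial.monomial i a) x y =
      a * ∑ j ∈ Finset.range i, x ^ j * y ^ (i - 1 - j) :=
  Polynomial.sum_monomial_index a _ (by simp)

/-- Twice the sum over pairs is the full double sum minus the diagonal. As the divided difference of
`z^i` is `∑ x^b y^{i-1-b}`, the double sum factors into power sums and the diagonal is `i p_{i-1}`.
-/
theorem sum_pairs_monomial {n : ℕ} (i : ℕ) (a : ℝ) (z : Fin n → ℝ) :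
    2 * ∑ q ∈ pairs n, dividedDiff (Polynomial.monomial i a) (z q.1) (z q.2) =
      a * ((∑ b ∈ Finset.range i, psum b z * psum (i - 1 - b) z) - i * psum (i - 1) z) := by
  simp only [dividedDiff_monomial]
  rw [two_mul_sum_pairs fun x y => a * ∑ j ∈ Finset.range i, x ^ j * y ^ (i - 1 - j)]
  · rw [mul_sub]
    congr 1
    · simp only [← Finset.mul_sum]
      congr 1
      simp only [psum, Finset.sum_mul_sum]
      exact (Finset.sum_congr rfl fun i _ => Finset.sum_comm).trans Finset.sum_comm
    · rw [← Finset.mul_sum, psum, Finset.mul_sum (a := (i : ℝ))]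
      congr 1
      refine Finset.sum_congr rfl fun k _ => ?_
      rw [Finset.sum_congr rfl fun j hj => by
        rw [← pow_add, show j + (i - 1 - j) = i - 1 by rw [Finset.mem_range] at hj; omega]]
      simp
  · intro x y
    congr 1
    rw [← Finset.sum_range_reflect]
    refine Finset.sum_congr rfl fun j hj => ?_
    rw [Finset.mem_range] at hj
    rw [show i - 1 - (i - 1 - j) = j by omega, mul_comm]

/-- The symmetric function multiplying `Ψ` in the loop equation of the monomial `z^i`. -/
noncomputable def loopSymbol {n : ℕ} (β : ℝ) (i : ℕ) (z : Fin n → ℝ) : ℝ :=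
  i * psum (i - 1) z +
    β * ((∑ b ∈ Finset.range i, psum b z * psum (i - 1 - b) z) - i * psum (i - 1) z)

theorem tame_loopSymbol {n : ℕ} {S : Set (Fin n → ℝ)} (β : ℝ) (i : ℕ) :
    Tame S (loopSymbol β i) :=
  ((tame_psum _).const_mul _).add (((Tame.sum _ fun b _ => (tame_psum b).mul (tame_psum _)).sub
    ((tame_psum _).const_mul _)).const_mul β)

/-- Both sides are linear in `h`, so monomials suffice. For `h = z^m f` each coefficient `a_i` then
multiplies the expression belonging to the single operator of index `m + i - 1`. -/
theorem loop_expression {n : ℕ} (β : ℝ) (h : Polynomial ℝ) (z w : Fin n → ℝ) (ψ : ℝ) :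
    (∑ k, h.eval (z k) * w k) + ((∑ k, h.derivative.eval (z k)) +
        2 * β * ∑ q ∈ pairs n, dividedDiff h (z q.1) (z q.2)) * ψ =
      h.sum fun i a => a * ((∑ k, z k ^ i * w k) + loopSymbol β i z * ψ) := by
  induction h using Polynomial.induction_on' with
  | add p q hp hq =>
    rw [Polynomial.sum_add_index p q _ (fun i => by simp) fun i a b => by ring, ← hp, ← hq]
    simp only [Polynomial.eval_add, Polynomial.derivative_add, dividedDiff_add, add_mul,
      Finset.sum_add_distrib]
    ring
  | monomial i a =>
    have h := sum_pairs_monomial i a z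
    rw [Polynomial.sum_monomial_index a _ (by simp), mul_comm 2 β, mul_assoc β, h, loopSymbol]
    have h1 : ∑ k, ((Polynomial.monomial i) a).eval (z k) * w k = a * ∑ k, z k ^ i * w k := by
      simp only [Polynomial.eval_monomial, Finset.mul_sum, mul_assoc]
    have h2 : ∑ k, ((Polynomial.monomial i) a).derivative.eval (z k) =
        a * (i * psum (i - 1) z) := by
      simp only [Polynomial.derivative_monomial, Polynomial.eval_monomial, psum, Finset.mul_sum,
        mul_assoc]
    rw [h1, h2]
    ring

theorem sum_X_pow_mul (m : ℕ) (f : Polynomial ℝ) (F : ℕ → ℝ → ℝ) (h0 : ∀ i, F i 0 = 0)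
    (hadd : ∀ i a b, F i (a + b) = F i a + F i b) :
    (Polynomial.X ^ m * f).sum F = f.sum fun i a => F (m + i) a := by
  induction f using Polynomial.induction_on' with
  | add p q hp hq =>
    rw [mul_add, Polynomial.sum_add_index _ _ _ h0 hadd, hp, hq,
      Polynomial.sum_add_index _ _ _ (fun i => h0 _) fun i => hadd _]
  | monomial i a =>
    rw [Polynomial.X_pow_mul_monomial, Polynomial.sum_monomial_index _ _ (h0 _),
      Polynomial.sum_monomial_index a (fun i a => F (m + i) a) (h0 _), add_comm]

/-- The integral of `Q` against the density of the `β`-ensemble on `E^n`. -/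
noncomputable def ensembleIntegral (n : ℕ) (β : ℝ) (ρ : ℝ → ℝ) (E : Set ℝ)
    (Q : (Fin n → ℝ) → ℝ) : ℝ :=
  ∫ z in cube n E, |vandermonde z| ^ (2 * β) * Q z * ∏ k, ρ (z k)

section

variable {n : ℕ} {β : ℝ} {ρ : ℝ → ℝ} {E : Set ℝ}

theorem ensembleIntegral_const_mul (a : ℝ) (Q : (Fin n → ℝ) → ℝ) :
    ensembleIntegral n β ρ E (fun z => a * Q z) = a * ensembleIntegral n β ρ E Q := by
  rw [ensembleIntegral, ensembleIntegral, ← integral_const_mul]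
  congr 1 with z
  ring

theorem ensembleIntegral_sum (hβ : 0 < β) (hm : HasMoments ρ E) (hE : MeasurableSet E)
    {ι : Type*} (s : Finset ι) {Q : ι → (Fin n → ℝ) → ℝ} (hQ : ∀ i ∈ s, Tame (cube n E) (Q i)) :
    ensembleIntegral n β ρ E (fun z => ∑ i ∈ s, Q i z) =
      ∑ i ∈ s, ensembleIntegral n β ρ E (Q i) := by
  simp only [ensembleIntegral]
  rw [← integral_finsetSum]
  · congr 1 with z
    rw [Finset.mul_sum, Finset.sum_mul]
  · exact fun i hi => hm.integrableOn hE ((tame_abs_vandermonde_rpow hβ).mul (hQ i hi))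

theorem ensembleIntegral_add (hβ : 0 < β) (hm : HasMoments ρ E) (hE : MeasurableSet E)
    {Q R : (Fin n → ℝ) → ℝ} (hQ : Tame (cube n E) Q) (hR : Tame (cube n E) R) :
    ensembleIntegral n β ρ E (fun z => Q z + R z) =
      ensembleIntegral n β ρ E Q + ensembleIntegral n β ρ E R := by
  have h := fun {Q} (hQ : Tame (cube n E) Q) =>
    hm.integrableOn hE ((tame_abs_vandermonde_rpow hβ).mul hQ)
  simp only [ensembleIntegral]
  rw [← integral_add (h hQ) (h hR)]
  congr 1 with z
  ring

theorem ensembleIntegral_congr (hE : MeasurableSet E) {Q R : (Fin n → ℝ) → ℝ}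
    (h : ∀ z ∈ cube n E, Q z = R z) : ensembleIntegral n β ρ E Q = ensembleIntegral n β ρ E R :=
  setIntegral_congr_fun (measurableSet_cube hE) fun z hz => by simp only [h z hz]

end

/-- The derivatives of the integral with respect to the end points, and the loop equations. -/
theorem exists_end_derivatives {β : ℝ} (hβ : 0 < β) {A B : EReal} {ρ : ℝ → ℝ}
    {f g : Polynomial ℝ} (hw : IsRationalWeight A B ρ f g) {r : ℕ} {c : Fin (2 * r) → EReal}
    (hc : StrictMono c) (hEF : intervals c ⊆ range A B) (hρ : IntegrableOn ρ (intervals c))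
    {U : Set ℝ} (hU : IsOpen U) (hEU : intervals c ⊆ U) {n : ℕ} {Ψ : (Fin n → ℝ) → ℝ}
    {Ψ' : Fin n → (Fin n → ℝ) → ℝ} (hΨ : Tame (cube n U) Ψ) (hΨ' : ∀ k, Tame (cube n U) (Ψ' k))
    (hd : ∀ k, ∀ z ∈ cube n U,
      HasDerivAt (fun u => Ψ (Function.update z k u)) (Ψ' k z) (z k)) :
    ∃ L : Fin (2 * r) → ℝ, (∀ j ∈ finiteEnds c, f.eval (c j).toReal ≠ 0 →
      HasDerivAt (fun s : ℝ => ensembleIntegral n β ρ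
        (intervals (Function.update c j (s : EReal))) Ψ) (L j) (c j).toReal) ∧
      ∀ m : ℕ, (f.sum fun i a => a * ensembleIntegral n β ρ (intervals c) fun z =>
          (∑ k, z k ^ (m + i) * Ψ' k z) + loopSymbol β (m + i) z * Ψ z) -
        (g.sum fun i b => b * ensembleIntegral n β ρ (intervals c) fun z =>
          psum (m + i) z * Ψ z) =
        ∑ j ∈ finiteEnds c, (c j).toReal ^ m * f.eval (c j).toReal * L j := by
  have hE := measurableSet_intervals c
  have hm := hw.hasMoments hE hEF hρ
  have hsub : cube n (intervals c) ⊆ cube n U := Set.pi_mono fun _ _ => hEU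
  have hΨE := hΨ.mono hsub
  have hΨE' := fun k => (hΨ' k).mono hsub
  -- It is enough to treat a general multiplier `p`; the stated form is `p = X ^ m`, split into
  -- monomials of `f` and `g`.
  suffices h : ∃ L : Fin (2 * r) → ℝ, (∀ j ∈ finiteEnds c, f.eval (c j).toReal ≠ 0 →
      HasDerivAt (fun s : ℝ => ensembleIntegral n β ρ
        (intervals (Function.update c j (s : EReal))) Ψ) (L j) (c j).toReal) ∧
      ∀ p : Polynomial ℝ, ∫ z in cube n (intervals c), (|vandermonde z| ^ (2 * β) *
        ((∑ k, (p * f).eval (z k) * Ψ' k z) +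
          ((∑ k, ((p * f).derivative - p * g).eval (z k)) +
            2 * β * ∑ q ∈ pairs n, dividedDiff (p * f) (z q.1) (z q.2)) * Ψ z)) *
          ∏ i, ρ (z i) =
        ∑ j ∈ finiteEnds c, (p * f).eval (c j).toReal * L j by
    obtain ⟨L, hL, hL'⟩ := h
    refine ⟨L, hL, fun m => ?_⟩
    have h1 := hL' (Polynomial.X ^ m)
    simp only [Polynomial.eval_mul, Polynomial.eval_pow, Polynomial.eval_X] at h1
    rw [← h1]
    have hT : ∀ i, Tame (cube n (intervals c)) fun z =>
        (∑ k, z k ^ i * Ψ' k z) + loopSymbol β i z * Ψ z := fun i =>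
      (Tame.sum _ fun k _ => ((Tame.coord k).pow i).mul (hΨE' k)).add
        ((tame_loopSymbol β i).mul hΨE)
    have hT' : ∀ i, Tame (cube n (intervals c)) fun z => psum i z * Ψ z := fun i =>
      (tame_psum i).mul hΨE
    rw [sub_eq_add_neg, Polynomial.sum, Polynomial.sum, ← neg_one_mul, Finset.mul_sum]
    simp only [← ensembleIntegral_const_mul]
    rw [← ensembleIntegral_sum hβ hm hE _ fun i _ => (hT _).const_mul _,
      ← ensembleIntegral_sum hβ hm hE _ fun i _ => ((hT' _).const_mul _).const_mul _,
      ← ensembleIntegral_add hβ hm hE (Tame.sum _ fun i _ => (hT _).const_mul _)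
        (Tame.sum _ fun i _ => ((hT' _).const_mul _).const_mul _)]
    rw [ensembleIntegral]
    congr 1 with z
    congr 2
    have h2 := loop_expression β (Polynomial.X ^ m * f) z (fun k => Ψ' k z) (Ψ z)
    rw [sum_X_pow_mul m f _ (fun i => by simp) fun i a b => by ring, Polynomial.sum] at h2
    rw [← h2]
    have h3 : ∑ k, z k ^ m * g.eval (z k) = ∑ i ∈ g.support, g.coeff i * psum (m + i) z := by
      simp only [Polynomial.eval_eq_sum, Polynomial.sum, Finset.mul_sum, psum]
      rw [Finset.sum_comm]
      exact Finset.sum_congr rfl fun i _ => Finset.sum_congr rfl fun k _ => by ring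
    have h4 : ∑ i ∈ g.support, -1 * (g.coeff i * (psum (m + i) z * Ψ z)) =
        -((∑ i ∈ g.support, g.coeff i * psum (m + i) z) * Ψ z) := by
      rw [Finset.sum_mul, ← Finset.sum_neg_distrib]
      exact Finset.sum_congr rfl fun i _ => by ring
    rw [h4, ← h3]
    simp only [Polynomial.eval_sub, Finset.sum_sub_distrib, Polynomial.eval_mul,
      Polynomial.eval_pow, Polynomial.eval_X]
    ring
  -- For `n = 0` the domain is a single point independent of `E`, and both sides are zero.
  rcases n with _ | n
  · refine ⟨0, fun j _ _ => ?_, fun p => ?_⟩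
    · have : ∀ s : ℝ, ensembleIntegral 0 β ρ (intervals (Function.update c j (s : EReal))) Ψ =
          ensembleIntegral 0 β ρ (intervals c) Ψ := fun s => by
        rw [ensembleIntegral, ensembleIntegral]
        congr 2
        ext z; simp [cube]
      simp only [this]
      exact hasDerivAt_const _ _
    · simp [pairs]
  -- This number is the derivative only where `f(c_j) ≠ 0`; elsewhere its value is immaterial
  -- because it is multiplied by `f(c_j)`.
  · refine ⟨fun j => ∑ k : Fin (n + 1), endSign j * (ρ (c j).toReal *
        ∫ z in cube n (intervals c),
          (|vandermonde (k.insertNth (c j).toReal z : Fin (n + 1) → ℝ)| ^ (2 * β) *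
            Ψ (k.insertNth (c j).toReal z)) * ∏ i, ρ (z i)), fun j hj hf => ?_, fun p => ?_⟩
    -- Openness of `U` is needed here: a slightly moved end point must stay where `Ψ` is controlled.
    · exact hasDerivAt_end hw hc hEF hρ hU hEU ((tame_abs_vandermonde_rpow hβ).mul hΨ) hj hf
    · rw [loop_equation hβ hw hc hEF hρ hΨE hΨE' (fun k z hz => hd k z (hsub hz)) p]
      refine Finset.sum_congr rfl fun j _ => ?_
      rw [Finset.mul_sum, Finset.mul_sum]
      exact Finset.sum_congr rfl fun k _ => by ring

theorem loopSymbol_zero {n : ℕ} (β : ℝ) (z : Fin n → ℝ) : loopSymbol β 0 z = 0 := by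
  simp [loopSymbol]

theorem loopSymbol_one {n : ℕ} (β : ℝ) (z : Fin n → ℝ) :
    loopSymbol β 1 z = n * (n * β + 1 - β) := by
  simp [loopSymbol, psum_zero]; ring

/-- The extreme terms `b = 0` and `b = q` contain `p_0 = n` and give `2nβ p_q`; the diagonal
correction and the derivative of the monomial combine to `(q+1)(1-β) p_q`. -/
theorem loopSymbol_succ {n : ℕ} (β : ℝ) (q : ℕ+) (z : Fin n → ℝ) :
    loopSymbol β (q + 1) z = β * (∑ i ∈ Finset.Ioo 0 (q : ℕ), psum i z * psum (q - i) z) +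
      (2 * n * β + (q + 1) * (1 - β)) * psum q z := by
  have h : ∑ b ∈ Finset.range (q + 1), psum b z * psum (q - b) z =
      (∑ i ∈ Finset.Ioo 0 (q : ℕ), psum i z * psum (q - i) z) + 2 * n * psum q z := by
    obtain ⟨q', hq⟩ : ∃ q', (q : ℕ) = q' + 1 := ⟨q - 1, (Nat.succ_pred_eq_of_pos q.pos).symm⟩
    have h1 : Finset.Ioo 0 (q : ℕ) = (Finset.range q').image (· + 1) := by
      ext i
      simp only [Finset.mem_Ioo, Finset.mem_image, Finset.mem_range]
      exact ⟨fun h => ⟨i - 1, by omega, by omega⟩, fun ⟨a, h, h'⟩ => by omega⟩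
    rw [h1, Finset.sum_image (fun _ _ _ _ h => by simpa using h), hq, Finset.sum_range_succ,
      Finset.sum_range_succ', tsub_self, tsub_zero, psum_zero]
    ring
  rw [loopSymbol, Nat.add_sub_cancel, h]
  push_cast
  ring

theorem sum_Ioo_intCast (q : ℕ) (F : ℤ → ℝ) :
    ∑ i ∈ Finset.Ioo (0 : ℤ) q, F i = ∑ i ∈ Finset.Ioo 0 q, F i := by
  have h : Finset.Ioo (0 : ℤ) q = (Finset.Ioo 0 q).image (↑) := by
    ext i
    simp only [Finset.mem_Ioo, Finset.mem_image]
    exact ⟨fun h => ⟨i.toNat, by omega, by omega⟩, fun ⟨a, h, h'⟩ => by omega⟩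
  rw [h, Finset.sum_image fun _ _ _ _ h => by simpa using h]

theorem hasDerivAt_psum {n : ℕ} (a : ℕ) (z : Fin n → ℝ) (k : Fin n) :
    HasDerivAt (fun u => psum a (Function.update z k u)) (a * z k ^ (a - 1)) (z k) := by
  have h : (fun u => psum a (Function.update z k u)) =
      fun u => u ^ a + ∑ j ∈ Finset.univ.erase k, z j ^ a := by
    funext u
    rw [psum, ← Finset.add_sum_erase _ _ (Finset.mem_univ k), Function.update_self]
    congr 1
    exact Finset.sum_congr rfl fun j hj => by
      rw [Function.update_of_ne (Finset.ne_of_mem_erase hj)]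
  rw [h]
  exact (hasDerivAt_pow a (z k)).add_const _

/-! ### The formal power series -/

/-- The coefficient of `t^m` in `exp (∑_i t_i p_i(z))`. -/
noncomputable def expCoeff {n : ℕ} (m : ℕ+ →₀ ℕ) (z : Fin n → ℝ) : ℝ :=
  m.prod fun i e => psum i z ^ e / (e.factorial : ℝ)

theorem expCoeff_erase {n : ℕ} (m : ℕ+ →₀ ℕ) (i : ℕ+) (z : Fin n → ℝ) :
    expCoeff m z = psum i z ^ m i / ((m i).factorial : ℝ) * expCoeff (m.erase i) z :=
  (Finsupp.mul_prod_erase' m i (fun i e => psum i z ^ e / (e.factorial : ℝ)) (by simp)).symm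

/-- Coefficientwise form of `∂/∂t_i exp(∑ t_j p_j) = p_i exp(∑ t_j p_j)`. -/
theorem psum_mul_expCoeff {n : ℕ} (m : ℕ+ →₀ ℕ) (i : ℕ+) (z : Fin n → ℝ) :
    psum i z * expCoeff m z = (m i + 1) * expCoeff (m + Finsupp.single i 1) z := by
  rw [expCoeff_erase m i, expCoeff_erase (m + Finsupp.single i 1) i, Finsupp.erase_add,
    Finsupp.erase_single, add_zero, Finsupp.add_apply, Finsupp.single_eq_same, pow_succ,
    Nat.factorial_succ]
  have := Nat.cast_ne_zero (R := ℝ).2 (m i).factorial_ne_zero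
  have : (m i : ℝ) + 1 ≠ 0 := by positivity
  push_cast
  field_simp

theorem tame_expCoeff {n : ℕ} {S : Set (Fin n → ℝ)} (m : ℕ+ →₀ ℕ) : Tame S (expCoeff m) :=
  Tame.prod _ fun i _ => (((tame_psum (i : ℕ)).pow (m i)).const_mul
    ((m i).factorial : ℝ)⁻¹).congr fun z _ => by ring

/-- The derivative of `expCoeff m` with respect to `z_k`. -/
noncomputable def expCoeffDeriv {n : ℕ} (m : ℕ+ →₀ ℕ) (k : Fin n) (z : Fin n → ℝ) : ℝ :=
  ∑ i ∈ m.support, i * z k ^ ((i : ℕ) - 1) * expCoeff (m - Finsupp.single i 1) z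

theorem tame_expCoeffDeriv {n : ℕ} {S : Set (Fin n → ℝ)} (m : ℕ+ →₀ ℕ) (k : Fin n) :
    Tame S (expCoeffDeriv m k) :=
  Tame.sum _ fun _ _ => (((Tame.coord k).pow _).const_mul _).mul (tame_expCoeff _)

theorem hasDerivAt_expCoeff {n : ℕ} (m : ℕ+ →₀ ℕ) (k : Fin n) (z : Fin n → ℝ) :
    HasDerivAt (fun u => expCoeff m (Function.update z k u)) (expCoeffDeriv m k z) (z k) := by
  have h := HasDerivAt.fun_finsetProd (u := m.support) (x := z k)
    (f := fun i u => psum i (Function.update z k u) ^ m i / ((m i).factorial : ℝ)) fun i _ =>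
      ((hasDerivAt_psum i z k).fun_pow (m i)).div_const _
  refine h.congr_deriv (Finset.sum_congr rfl fun i hi => ?_)
  have hi' : m i ≠ 0 := by simpa using hi
  obtain ⟨e, he⟩ := Nat.exists_eq_succ_of_ne_zero hi'
  have h1 : (m - Finsupp.single i 1).erase i = m.erase i := by
    ext j
    by_cases hj : j = i
    · simp [hj]
    · simp [hj]
  have h2 : expCoeff (m.erase i) z =
      ∏ j ∈ m.support.erase i, psum j z ^ m j / ((m j).factorial : ℝ) := by
    rw [expCoeff, Finsupp.prod, Finsupp.support_erase]
    exact Finset.prod_congr rfl fun j hj => by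
      rw [Finsupp.erase_ne (Finset.ne_of_mem_erase hj)]
  rw [expCoeff_erase _ i, h1, h2, Function.update_eq_self]
  simp only [Finsupp.tsub_apply, Finsupp.single_eq_same, he, smul_eq_mul, Nat.succ_eq_add_one,
    Nat.add_sub_cancel, Nat.factorial_succ]
  have := Nat.cast_ne_zero (R := ℝ).2 e.factorial_ne_zero
  have : (e : ℝ) + 1 ≠ 0 := by positivity
  push_cast
  field_simp

/-- The vector field `∑ z_k^p ∂/∂z_k` acts on the exponential as `∑ i t_i p_{p+i-1}`, which is the
shift by `p - 1` in `eulerT`. -/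
theorem sum_pow_mul_expCoeffDeriv {n : ℕ} (m : ℕ+ →₀ ℕ) (p : ℕ) (z : Fin n → ℝ) :
    ∑ k, z k ^ p * expCoeffDeriv m k z =
      ∑ i ∈ m.support, i * (psum (p + (i - 1)) z * expCoeff (m - Finsupp.single i 1) z) := by
  simp only [expCoeffDeriv, Finset.mul_sum, psum, Finset.sum_mul]
  rw [Finset.sum_comm]
  exact Finset.sum_congr rfl fun i _ => Finset.sum_congr rfl fun k _ => by rw [pow_add]; ring

section

variable {n : ℕ} {β : ℝ} {ρ : ℝ → ℝ} {E : Set ℝ}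

theorem coeff_formalIntegral (m : ℕ+ →₀ ℕ) :
    MvPowerSeries.coeff m (formalIntegral n β ρ E) = ensembleIntegral n β ρ E (expCoeff m) := rfl

theorem coeff_dT_formalIntegral (i : ℕ+) (m : ℕ+ →₀ ℕ) :
    MvPowerSeries.coeff m (dT i (formalIntegral n β ρ E)) =
      ensembleIntegral n β ρ E fun z => psum i z * expCoeff m z := by
  rw [dT_of_pos, coeff_pderiv, coeff_formalIntegral, ← ensembleIntegral_const_mul]
  simp only [psum_mul_expCoeff]

theorem coeff_dT_dT_formalIntegral (i j : ℕ+) (m : ℕ+ →₀ ℕ) :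
    MvPowerSeries.coeff m (dT i (dT j (formalIntegral n β ρ E))) =
      ensembleIntegral n β ρ E fun z => psum i z * psum j z * expCoeff m z := by
  rw [dT_of_pos i, coeff_pderiv, coeff_dT_formalIntegral, ← ensembleIntegral_const_mul]
  congr 1 with z
  rw [mul_left_comm, ← psum_mul_expCoeff]
  ring

theorem coeff_dT_of_eq {k : ℤ} {a : ℕ} (h : k = a) (ha : 0 < a) (m : ℕ+ →₀ ℕ) :
    MvPowerSeries.coeff m (dT k (formalIntegral n β ρ E)) =
      ensembleIntegral n β ρ E fun z => psum a z * expCoeff m z := by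
  lift a to ℕ+ using ha
  rw [h, coeff_dT_formalIntegral]

theorem coeff_dT_dT_of_eq {k l : ℤ} {a b : ℕ} (h : k = a) (ha : 0 < a) (h' : l = b) (hb : 0 < b)
    (m : ℕ+ →₀ ℕ) : MvPowerSeries.coeff m (dT k (dT l (formalIntegral n β ρ E))) =
      ensembleIntegral n β ρ E fun z => psum a z * psum b z * expCoeff m z := by
  lift a to ℕ+ using ha
  lift b to ℕ+ using hb
  rw [h, h', coeff_dT_dT_formalIntegral]

theorem coeff_JJ1_formalIntegral (q : ℕ) (m : ℕ+ →₀ ℕ) :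
    MvPowerSeries.coeff m (JJ1 β n q (formalIntegral n β ρ E)) =
      ensembleIntegral n β ρ E fun z => psum q z * expCoeff m z := by
  rcases Nat.eq_zero_or_pos q with rfl | hq
  · simp [JJ1, J1_zero, J0, psum_zero, ensembleIntegral_const_mul, coeff_formalIntegral]
  · lift q to ℕ+ using hq
    have h := coeff_dT_formalIntegral (n := n) (β := β) (ρ := ρ) (E := E) q m
    simpa [JJ1, J1_of_pos, J0] using h

theorem coeff_eulerT_formalIntegral (hβ : 0 < β) (hm : HasMoments ρ E) (hE : MeasurableSet E)
    (p : ℕ) (m : ℕ+ →₀ ℕ) :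
    MvPowerSeries.coeff m (eulerT (p : ℤ) (formalIntegral n β ρ E)) =
      ensembleIntegral n β ρ E fun z => ∑ k, z k ^ (p + 1) * expCoeffDeriv m k z := by
  simp only [sum_pow_mul_expCoeffDeriv]
  rw [ensembleIntegral_sum hβ hm hE _ fun i _ =>
    ((tame_psum _).mul (tame_expCoeff _)).const_mul _, coeff_eulerT]
  refine Finset.sum_congr rfl fun i hi => ?_
  have hi' : m i ≠ 0 := by simpa using hi
  rw [ensembleIntegral_const_mul, coeff_mT, if_neg hi']
  have := i.pos
  rw [coeff_dT_of_eq (a := p + 1 + ((i : ℕ) - 1)) (by omega) (by omega)]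

/-- For `p = 0` the term `i = 1` contains `p_0 = n`, which is not produced by a derivative since
`∂/∂t_0 = 0`; it has to be added as `n t_1`. In the operator of index `-1` this term is supplied by
`2nβ` times `t_1/(2β)`. -/
theorem coeff_eulerT_neg_one_formalIntegral (hβ : 0 < β) (hm : HasMoments ρ E)
    (hE : MeasurableSet E) (m : ℕ+ →₀ ℕ) :
    MvPowerSeries.coeff m (eulerT (-1) (formalIntegral n β ρ E) +
        (n : ℝ) • mT 1 (formalIntegral n β ρ E)) =
      ensembleIntegral n β ρ E fun z => ∑ k, z k ^ 0 * expCoeffDeriv m k z := by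
  simp only [sum_pow_mul_expCoeffDeriv]
  rw [ensembleIntegral_sum hβ hm hE _ fun i _ =>
    ((tame_psum _).mul (tame_expCoeff _)).const_mul _, map_add, coeff_eulerT, map_smul]
  have h1 : MvPowerSeries.coeff m (mT 1 (formalIntegral n β ρ E)) =
      if m 1 = 0 then 0 else
        MvPowerSeries.coeff (m - Finsupp.single 1 1) (formalIntegral n β ρ E) :=
    coeff_mT 1 _ m
  have h2 : (n : ℝ) • MvPowerSeries.coeff m (mT 1 (formalIntegral n β ρ E)) =
      ∑ i ∈ m.support, if i = 1 then (n : ℝ) *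
        MvPowerSeries.coeff (m - Finsupp.single 1 1) (formalIntegral n β ρ E) else 0 := by
    rw [h1, Finset.sum_ite_eq']
    by_cases h : m 1 = 0 <;> simp [h]
  rw [h2, ← Finset.sum_add_distrib]
  refine Finset.sum_congr rfl fun i hi => ?_
  have hi' : m i ≠ 0 := by simpa using hi
  rw [ensembleIntegral_const_mul, coeff_mT, if_neg hi']
  by_cases h : i = 1
  · subst h
    rw [dT_of_nonpos (by simp)]
    simp [psum_zero, ensembleIntegral_const_mul, coeff_formalIntegral]
  · have hi1 : 1 < (i : ℕ) := by
      have : (i : ℕ) ≠ 1 := fun h' => h (PNat.eq h')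
      have := i.pos
      omega
    rw [coeff_dT_of_eq (a := 0 + ((i : ℕ) - 1)) (by omega) (by omega), if_neg h, add_zero]

/-- The exponent `p` belongs to the operator index `p - 1`. The cases `p = 0`, `p = 1`, `p ≥ 2`
differ in what the linear and double-derivative parts contribute: `n t_1`, a constant, and genuine
derivatives. -/
theorem coeff_JJ2_formalIntegral (hβ : 0 < β) (hm : HasMoments ρ E) (hE : MeasurableSet E)
    (p : ℕ) (m : ℕ+ →₀ ℕ) :
    MvPowerSeries.coeff m (JJ2 β n (p - 1) (formalIntegral n β ρ E)) =
      ensembleIntegral n β ρ E fun z =>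
        (∑ k, z k ^ p * expCoeffDeriv m k z) + loopSymbol β p z * expCoeff m z := by
  have hβ' := hβ.ne'
  rw [ensembleIntegral_add hβ hm hE (Tame.sum _ fun k _ => ((Tame.coord k).pow p).mul
    (tame_expCoeffDeriv m k)) ((tame_loopSymbol β p).mul (tame_expCoeff m))]
  rcases p with _ | _ | q
  · rw [← coeff_eulerT_neg_one_formalIntegral hβ hm hE]
    have h0 : ensembleIntegral n β ρ E (fun z => loopSymbol β 0 z * expCoeff m z) = 0 := by
      simp [loopSymbol_zero, ensembleIntegral]
    have h1 : Finset.Ioo (0 : ℤ) (-(-1)) = ∅ := by decide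
    have h2 := J1_neg (β := β) (1 : ℕ+)
    rw [h0, add_zero]
    congr 1
    simp only [PNat.one_coe, Nat.cast_one] at h2
    simp only [JJ2, J2, J0, Nat.cast_zero, zero_sub, h1, h2]
    rw [show Finset.Ioo (0 : ℤ) (-1) = ∅ by decide]
    simp [smul_smul, hβ']
    congr 1
    field_simp
  · rw [← coeff_eulerT_formalIntegral hβ hm hE]
    simp only [zero_add, loopSymbol_one]
    rw [ensembleIntegral_const_mul, ← coeff_formalIntegral]
    simp [JJ2, J2, J0, J1_zero, smul_smul, hβ']
  · rw [← coeff_eulerT_formalIntegral hβ hm hE]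
    obtain ⟨q', hq⟩ : ∃ q' : ℕ+, (q' : ℕ) = q + 1 := ⟨⟨q + 1, q.succ_pos⟩, rfl⟩
    have h : ensembleIntegral n β ρ E (fun z => loopSymbol β (q + 1 + 1) z * expCoeff m z) =
        β * ∑ i ∈ Finset.Ioo 0 (q' : ℕ), ensembleIntegral n β ρ E (fun z =>
            psum i z * psum (q' - i) z * expCoeff m z) +
          (2 * n * β + (q' + 1) * (1 - β)) *
            ensembleIntegral n β ρ E fun z => psum q' z * expCoeff m z := by
      have hT : ∀ i ∈ Finset.Ioo 0 (q' : ℕ), Tame (cube n E) fun z =>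
          psum i z * psum (q' - i) z * expCoeff m z := fun i _ =>
        ((tame_psum i).mul (tame_psum _)).mul (tame_expCoeff m)
      have hT' : Tame (cube n E) fun z => psum q' z * expCoeff m z :=
        (tame_psum _).mul (tame_expCoeff m)
      rw [← ensembleIntegral_sum hβ hm hE _ hT, ← ensembleIntegral_const_mul,
        ← ensembleIntegral_const_mul, ← ensembleIntegral_add hβ hm hE
          ((Tame.sum _ hT).const_mul _) (hT'.const_mul _)]
      congr 1 with z
      rw [← hq, loopSymbol_succ, ← Finset.sum_mul]
      ring
    have h1 : (((q + 1 + 1 : ℕ) : ℤ) - 1) = (q' : ℕ) := by omega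
    have h2 : ∑ i ∈ Finset.Ioo (0 : ℤ) (q' : ℕ), MvPowerSeries.coeff m
          (dT i (dT ((q' : ℕ) - i) (formalIntegral n β ρ E))) =
        ∑ i ∈ Finset.Ioo 0 (q' : ℕ), ensembleIntegral n β ρ E (fun z =>
            psum i z * psum (q' - i) z * expCoeff m z) := by
      rw [sum_Ioo_intCast]
      refine Finset.sum_congr rfl fun i hi => ?_
      rw [Finset.mem_Ioo] at hi
      exact coeff_dT_dT_of_eq rfl hi.1 (by omega) (by omega) m
    have h3 : Finset.Ioo (0 : ℤ) (-((q' : ℕ) : ℤ)) = ∅ := Finset.Ioo_eq_empty (by omega)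
    have h4 : ((q' : ℕ) : ℤ) ≠ 0 := by exact_mod_cast q'.ne_zero
    rw [h, h1, JJ2, J2, J0, if_neg h4, h3, J1_of_pos, ← h2, ← coeff_dT_formalIntegral,
      show ((q + 1 : ℕ) : ℤ) = (q' : ℕ) by rw [hq]]
    simp only [Finset.sum_empty, smul_zero, add_zero, LinearMap.add_apply, LinearMap.smul_apply,
      map_add, map_smul, LinearMap.sum_apply, map_sum, Module.End.mul_apply, smul_eq_mul]
    push_cast
    field_simp
    ring

theorem coeff_virasoroOp_formalIntegral (hβ : 0 < β) (hm : HasMoments ρ E)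
    (hE : MeasurableSet E) (f g : Polynomial ℝ) {k : ℤ} (hk : -1 ≤ k) (m : ℕ+ →₀ ℕ) :
    MvPowerSeries.coeff m (virasoroOp f g β n k (formalIntegral n β ρ E)) =
      (f.sum fun i a => a * ensembleIntegral n β ρ E fun z =>
          (∑ l, z l ^ ((k + 1).toNat + i) * expCoeffDeriv m l z) +
            loopSymbol β ((k + 1).toNat + i) z * expCoeff m z) -
        (g.sum fun i b => b * ensembleIntegral n β ρ E fun z =>
          psum ((k + 1).toNat + i) z * expCoeff m z) := by
  simp only [virasoroOp, Polynomial.sum, LinearMap.sub_apply, LinearMap.sum_apply, map_sub,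
    map_sum, LinearMap.smul_apply, map_smul, smul_eq_mul]
  congr 1
  · refine Finset.sum_congr rfl fun i _ => ?_
    rw [← coeff_JJ2_formalIntegral hβ hm hE, show k + (i : ℤ) =
      (((k + 1).toNat + i : ℕ) : ℤ) - 1 by push_cast; omega]
  · refine Finset.sum_congr rfl fun i _ => ?_
    rw [← coeff_JJ1_formalIntegral, show k + (i : ℤ) + 1 =
      (((k + 1).toNat + i : ℕ) : ℤ) by push_cast; omega]

end

/-- Where `f` vanishes, both summands are zero whether or not the derivative exists. -/
theorem boundaryOp_eq {r : ℕ} (f : Polynomial ℝ) {k : ℤ} (hk : -1 ≤ k)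
    {Φ : (Fin (2 * r) → EReal) → ℝ} {c : Fin (2 * r) → EReal} {L : Fin (2 * r) → ℝ}
    (hL : ∀ j ∈ finiteEnds c, f.eval (c j).toReal ≠ 0 →
      HasDerivAt (fun s : ℝ => Φ (Function.update c j (s : EReal))) (L j) (c j).toReal) :
    boundaryOp f k Φ c =
      ∑ j ∈ finiteEnds c, (c j).toReal ^ (k + 1).toNat * f.eval (c j).toReal * L j := by
  refine Finset.sum_congr rfl fun j hj => ?_
  rw [← zpow_natCast, show (((k + 1).toNat : ℕ) : ℤ) = k + 1 by omega]
  by_cases hf : f.eval (c j).toReal = 0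
  · simp [hf]
  · rw [dEnd, (hL j hj hf).deriv]

theorem boundaryOp_eq_zero {A B : EReal} {ρ : ℝ → ℝ} {f g : Polynomial ℝ}
    (hw : IsRationalWeight A B ρ f g) {r : ℕ} {c : Fin (2 * r) → EReal} (hc : StrictMono c)
    (hEF : intervals c = range A B) (k : ℤ) (Φ : (Fin (2 * r) → EReal) → ℝ) :
    boundaryOp f k Φ c = 0 :=
  Finset.sum_eq_zero fun j hj => by rw [eval_end_eq_zero hw hc hEF hj, mul_zero, zero_mul]

/-- The Virasoro constraints for the formal power series. -/
theorem formalIntegral_virasoro {β : ℝ} (hβ : 0 < β) {A B : EReal} {ρ : ℝ → ℝ}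
    {f g : Polynomial ℝ} (hw : IsRationalWeight A B ρ f g) {r : ℕ} {c : Fin (2 * r) → EReal}
    (hc : StrictMono c) (hEF : intervals c ⊆ range A B) (hρ : IntegrableOn ρ (intervals c))
    (n : ℕ) (m : ℕ+ →₀ ℕ) :
    (∀ j ∈ finiteEnds c, f.eval (c j).toReal ≠ 0 → HasEndDeriv j (fun c' =>
      MvPowerSeries.coeff m (formalIntegral n β ρ (intervals c'))) c) ∧
    ∀ k : ℤ, -1 ≤ k → -boundaryOp f k (fun c' =>
        MvPowerSeries.coeff m (formalIntegral n β ρ (intervals c'))) c +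
      MvPowerSeries.coeff m (virasoroOp f g β n k (formalIntegral n β ρ (intervals c))) = 0 := by
  obtain ⟨L, hL, hL'⟩ := exists_end_derivatives hβ hw hc hEF hρ isOpen_univ
    (Set.subset_univ _) (tame_expCoeff (n := n) m) (tame_expCoeffDeriv m)
    fun k z _ => hasDerivAt_expCoeff m k z
  refine ⟨fun j hj hf => (hL j hj hf).differentiableAt, fun k hk => ?_⟩
  rw [boundaryOp_eq f hk hL, coeff_virasoroOp_formalIntegral hβ (hw.hasMoments
    (measurableSet_intervals c) hEF hρ) (measurableSet_intervals c) f g hk, hL' (k + 1).toNat,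
    neg_add_cancel]

/-! ### The potential `∑_i t_i z^i` -/

/-- The function `∑_{i ≥ 1} t_i z^i`. -/
noncomputable def potential (t : ℕ+ → ℝ) (z : ℝ) : ℝ := ∑' i : ℕ+, t i * z ^ (i : ℕ)

/-- The derivative `∑_{i ≥ 1} i t_i z^{i-1}` of the potential. -/
noncomputable def potentialDeriv (t : ℕ+ → ℝ) (z : ℝ) : ℝ :=
  ∑' i : ℕ+, (i : ℝ) * t i * z ^ ((i : ℕ) - 1)

section

variable {t : ℕ+ → ℝ} {R R' : ℝ}

theorem abs_mul_pow_le {z : ℝ} (hz : |z| ≤ R) (i : ℕ+) :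
    |t i * z ^ (i : ℕ)| ≤ |t i| * R ^ (i : ℕ) := by
  rw [abs_mul, abs_pow]
  gcongr

theorem summable_mul_pow (ht : Summable fun i : ℕ+ => |t i| * R ^ (i : ℕ)) {z : ℝ}
    (hz : |z| ≤ R) : Summable fun i : ℕ+ => t i * z ^ (i : ℕ) :=
  ht.of_norm_bounded fun i => abs_mul_pow_le hz i

theorem abs_potential_le (ht : Summable fun i : ℕ+ => |t i| * R ^ (i : ℕ)) {z : ℝ}
    (hz : |z| ≤ R) : |potential t z| ≤ ∑' i : ℕ+, |t i| * R ^ (i : ℕ) := by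
  rw [potential, ← Real.norm_eq_abs]
  exact tsum_of_norm_bounded ht.hasSum fun i => abs_mul_pow_le hz i

theorem summable_update (ht : Summable fun i : ℕ+ => |t i| * R ^ (i : ℕ)) (j : ℕ+) (s : ℝ) :
    Summable fun i : ℕ+ => |Function.update t j s i| * R ^ (i : ℕ) := by
  have h : (fun i : ℕ+ => |Function.update t j s i| * R ^ (i : ℕ)) = fun i : ℕ+ =>
      |t i| * R ^ (i : ℕ) + if i = j then (|s| - |t j|) * R ^ (j : ℕ) else 0 := by
    funext i
    by_cases h : i = j
    · subst h; simp; ring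
    · simp [h]
  rw [h]
  exact ht.add (hasSum_ite_eq j _).summable

/-- The potential is affine in each single `t_j`, so differentiation in `t_j` reduces to that of
`exp ((s - t_j) p_j)`. -/
theorem potential_update (ht : Summable fun i : ℕ+ => |t i| * R ^ (i : ℕ)) (j : ℕ+) (s : ℝ)
    {z : ℝ} (hz : |z| ≤ R) :
    potential (Function.update t j s) z = potential t z + (s - t j) * z ^ (j : ℕ) := by
  have h : (fun i : ℕ+ => Function.update t j s i * z ^ (i : ℕ)) = fun i : ℕ+ =>
      t i * z ^ (i : ℕ) + if i = j then (s - t j) * z ^ (j : ℕ) else 0 := by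
    funext i
    by_cases h : i = j
    · subst h; simp; ring
    · simp [h]
  rw [potential, h]
  exact ((summable_mul_pow ht hz).hasSum.add (hasSum_ite_eq j _)).tsum_eq

/-- The factor `i` is paid for by shrinking the radius, since `i (R'/R)^i` is bounded. -/
theorem summable_deriv_bound (h0 : 0 < R') (hR : R' < R)
    (ht : Summable fun i : ℕ+ => |t i| * R ^ (i : ℕ)) :
    Summable fun i : ℕ+ => (i : ℝ) * |t i| * R' ^ ((i : ℕ) - 1) := by
  have hR0 := h0.trans hR
  obtain ⟨C, hC⟩ := (tendsto_pow_const_mul_const_pow_of_abs_lt_one 1 (r := R' / R) (by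
    rw [abs_of_pos (by positivity), div_lt_one hR0]; exact hR)).bddAbove_range
  refine (ht.mul_left (C / R')).of_nonneg_of_le (fun i => by positivity) fun i => ?_
  have h1 := hC ⟨i, rfl⟩
  have h2 : (i : ℝ) * |t i| * R' ^ ((i : ℕ) - 1) =
      (i : ℝ) ^ 1 * (R' / R) ^ (i : ℕ) * (|t i| * R ^ (i : ℕ) / R') := by
    obtain ⟨e, he⟩ : ∃ e, (i : ℕ) = e + 1 := ⟨i - 1, (Nat.succ_pred_eq_of_pos i.pos).symm⟩
    rw [he, Nat.add_sub_cancel, div_pow, pow_succ R']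
    field_simp
  rw [h2, div_mul_eq_mul_div, mul_div_assoc C]
  exact mul_le_mul_of_nonneg_right h1 (by positivity)

theorem abs_deriv_term_le {z : ℝ} (hz : |z| ≤ R') (i : ℕ+) :
    |(i : ℝ) * t i * z ^ ((i : ℕ) - 1)| ≤ (i : ℝ) * |t i| * R' ^ ((i : ℕ) - 1) := by
  rw [abs_mul, abs_mul, abs_pow, Nat.abs_cast]
  gcongr

theorem abs_potentialDeriv_le (h0 : 0 < R') (hR : R' < R)
    (ht : Summable fun i : ℕ+ => |t i| * R ^ (i : ℕ)) {z : ℝ} (hz : |z| ≤ R') :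
    |potentialDeriv t z| ≤ ∑' i : ℕ+, (i : ℝ) * |t i| * R' ^ ((i : ℕ) - 1) := by
  rw [potentialDeriv, ← Real.norm_eq_abs]
  exact tsum_of_norm_bounded (summable_deriv_bound h0 hR ht).hasSum fun i => abs_deriv_term_le hz i

theorem hasSum_potentialDeriv (h0 : 0 < R') (hR : R' < R)
    (ht : Summable fun i : ℕ+ => |t i| * R ^ (i : ℕ)) {z : ℝ} (hz : |z| ≤ R') :
    HasSum (fun i : ℕ+ => (i : ℝ) * t i * z ^ ((i : ℕ) - 1)) (potentialDeriv t z) :=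
  ((summable_deriv_bound h0 hR ht).of_norm_bounded fun i => abs_deriv_term_le hz i).hasSum

theorem continuousOn_potentialDeriv (h0 : 0 < R') (hR : R' < R)
    (ht : Summable fun i : ℕ+ => |t i| * R ^ (i : ℕ)) :
    ContinuousOn (potentialDeriv t) (Metric.ball 0 R') :=
  continuousOn_tsum (fun i => by fun_prop) (summable_deriv_bound h0 hR ht) fun i z hz =>
    abs_deriv_term_le (by simpa using (mem_ball_zero_iff.1 hz).le) i

theorem hasDerivAt_potential (h0 : 0 < R') (hR : R' < R)
    (ht : Summable fun i : ℕ+ => |t i| * R ^ (i : ℕ)) {z : ℝ} (hz : z ∈ Metric.ball 0 R') :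
    HasDerivAt (potential t) (potentialDeriv t z) z :=
  hasDerivAt_tsum_of_isPreconnected (g := fun (i : ℕ+) z => t i * z ^ (i : ℕ))
    (g' := fun (i : ℕ+) z => (i : ℝ) * t i * z ^ ((i : ℕ) - 1)) (summable_deriv_bound h0 hR ht) Metric.isOpen_ball
    (convex_ball 0 R').isPreconnected
    (fun i y _ => ((hasDerivAt_pow (i : ℕ) y).const_mul (t i)).congr_deriv (by ring))
    (fun i y hy => abs_deriv_term_le (by simpa using (mem_ball_zero_iff.1 hy).le) i)
    (Metric.mem_ball_self h0) (summable_mul_pow ht (by simpa using (h0.trans hR).le)) hz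

end

/-! ### The exponential of the potential -/

/-- The function `∏_k e^{∑_i t_i z_k^i}`. -/
noncomputable def expPotential {n : ℕ} (t : ℕ+ → ℝ) (z : Fin n → ℝ) : ℝ :=
  Real.exp (∑ k, potential t (z k))

theorem integral_eq_ensembleIntegral (n : ℕ) (β : ℝ) (ρ : ℝ → ℝ) (E : Set ℝ) (t : ℕ+ → ℝ) :
    integral n β ρ E t = ensembleIntegral n β ρ E (expPotential t) := by
  simp only [integral, ensembleIntegral, expPotential, Finset.prod_mul_distrib, Real.exp_sum,
    mul_assoc, potential]

section

variable {n : ℕ} {t : ℕ+ → ℝ} {R R' : ℝ}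

theorem expPotential_update (ht : Summable fun i : ℕ+ => |t i| * R ^ (i : ℕ)) (j : ℕ+) (s : ℝ)
    {z : Fin n → ℝ} (hz : ∀ k, |z k| ≤ R) :
    expPotential (Function.update t j s) z =
      Real.exp ((s - t j) * psum j z) * expPotential t z := by
  simp only [expPotential, potential_update ht j s (hz _), Finset.sum_add_distrib,
    ← Finset.mul_sum, Real.exp_add, psum]
  ring

theorem abs_lt_of_mem_cube {z : Fin n → ℝ} (hz : z ∈ cube n (Metric.ball 0 R')) (k : Fin n) :
    |z k| < R' := by simpa using hz k trivial

theorem tame_potential (h0 : 0 < R') (hR : R' < R)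
    (ht : Summable fun i : ℕ+ => |t i| * R ^ (i : ℕ)) (k : Fin n) :
    Tame (cube n (Metric.ball 0 R')) fun z => potential t (z k) :=
  Tame.of_bounded (fun _ hz => ((hasDerivAt_potential h0 hR ht (hz k trivial)).continuousAt.comp
    (f := fun z : Fin n → ℝ => z k) (continuous_apply k).continuousAt).continuousWithinAt)
    fun _ hz => abs_potential_le ht ((abs_lt_of_mem_cube hz k).trans hR).le

theorem tame_potentialDeriv (h0 : 0 < R') (hR : R' < R)
    (ht : Summable fun i : ℕ+ => |t i| * R ^ (i : ℕ)) (k : Fin n) :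
    Tame (cube n (Metric.ball 0 R')) fun z => potentialDeriv t (z k) :=
  Tame.of_bounded ((continuousOn_potentialDeriv h0 hR ht).comp
    (continuous_apply k).continuousOn fun _ hz => hz k trivial)
    fun _ hz => abs_potentialDeriv_le h0 hR ht (abs_lt_of_mem_cube hz k).le

theorem tame_expPotential (h0 : 0 < R') (hR : R' < R)
    (ht : Summable fun i : ℕ+ => |t i| * R ^ (i : ℕ)) :
    Tame (cube n (Metric.ball 0 R')) (expPotential t) := by
  refine Tame.of_bounded (C := Real.exp (∑ _k : Fin n, ∑' i : ℕ+, |t i| * R ^ (i : ℕ)))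
    (Real.continuous_exp.comp_continuousOn
      (Tame.sum Finset.univ fun k _ => tame_potential h0 hR ht k).1) fun z hz => ?_
  rw [expPotential, abs_of_pos (Real.exp_pos _)]
  exact Real.exp_le_exp.2 (Finset.sum_le_sum fun k _ => (le_abs_self _).trans
    (abs_potential_le ht ((abs_lt_of_mem_cube hz k).trans hR).le))

theorem hasDerivAt_expPotential (h0 : 0 < R') (hR : R' < R)
    (ht : Summable fun i : ℕ+ => |t i| * R ^ (i : ℕ)) (k : Fin n) {z : Fin n → ℝ}
    (hz : z ∈ cube n (Metric.ball 0 R')) :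
    HasDerivAt (fun u => expPotential t (Function.update z k u))
      (potentialDeriv t (z k) * expPotential t z) (z k) := by
  have h : (fun u => expPotential t (Function.update z k u)) =
      fun u => Real.exp (potential t u + ∑ j ∈ Finset.univ.erase k, potential t (z j)) := by
    funext u
    rw [expPotential, ← Finset.add_sum_erase _ _ (Finset.mem_univ k), Function.update_self]
    congr 2
    exact Finset.sum_congr rfl fun j hj => by
      rw [Function.update_of_ne (Finset.ne_of_mem_erase hj)]
  rw [h]
  refine ((hasDerivAt_potential h0 hR ht (hz k trivial)).add_const _).exp.congr_deriv ?_
  rw [Finset.add_sum_erase _ (fun j => potential t (z j)) (Finset.mem_univ k), expPotential,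
    mul_comm]

theorem abs_psum_le (a : ℕ) {z : Fin n → ℝ} (hz : ∀ k, |z k| ≤ R') : |psum a z| ≤ n * R' ^ a := by
  refine (Finset.abs_sum_le_sum_abs _ _).trans ?_
  have : ∀ k ∈ Finset.univ, |z k ^ a| ≤ R' ^ a := fun k _ => by
    rw [abs_pow]
    exact pow_le_pow_left₀ (abs_nonneg _) (hz k) a
  simpa using Finset.sum_le_sum this

theorem hasSum_psum (h0 : 0 < R') (hR : R' < R)
    (ht : Summable fun i : ℕ+ => |t i| * R ^ (i : ℕ)) (p : ℕ) {z : Fin n → ℝ}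
    (hz : ∀ k, |z k| ≤ R') :
    HasSum (fun i : ℕ+ => (i : ℝ) * t i * psum (p + (i - 1)) z)
      (∑ k, z k ^ p * potentialDeriv t (z k)) := by
  have h := hasSum_sum (s := Finset.univ) fun k _ =>
    (hasSum_potentialDeriv h0 hR ht (hz k)).mul_left (z k ^ p)
  refine h.congr_fun fun i => ?_
  rw [psum, Finset.mul_sum]
  exact Finset.sum_congr rfl fun k _ => by rw [pow_add]; ring

end

/-! ### Derivatives with respect to `t` -/

section

variable {n : ℕ} {β : ℝ} {ρ : ℝ → ℝ} {E : Set ℝ}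

/-- Boundedness of `p` gives a dominating function: for `|s - s₀| ≤ 1` the differentiated
exponential is at most `M e^M`. -/
theorem hasDerivAt_ensembleIntegral_exp (hβ : 0 < β) (hm : HasMoments ρ E) (hE : MeasurableSet E)
    {p Q : (Fin n → ℝ) → ℝ} (hp : Tame (cube n E) p) (hQ : Tame (cube n E) Q) {M : ℝ}
    (hM : ∀ z ∈ cube n E, |p z| ≤ M) (s₀ : ℝ) :
    HasDerivAt (fun s => ensembleIntegral n β ρ E fun z => Real.exp ((s - s₀) * p z) * Q z)
      (ensembleIntegral n β ρ E fun z => p z * Q z) s₀ := by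
  have hS := measurableSet_cube (n := n) hE
  have hw := hm.integrableOn hE ((tame_abs_vandermonde_rpow hβ).mul hQ)
  have hexp : ∀ s, ∀ z ∈ cube n E, |s - s₀| ≤ 1 → Real.exp ((s - s₀) * p z) ≤ Real.exp M := by
    intro s z hz hs
    refine Real.exp_le_exp.2 ((le_abs_self _).trans ?_)
    rw [abs_mul]
    nlinarith [hM z hz, abs_nonneg (p z)]
  have hmeas : ∀ s, AEStronglyMeasurable (fun z => Real.exp ((s - s₀) * p z))
      (volume.restrict (cube n E)) := fun s =>
    (Real.continuous_exp.comp_continuousOn (hp.1.const_smul (s - s₀))).aestronglyMeasurable hS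
  have h := hasDerivAt_integral_of_dominated_loc_of_deriv_le (μ := volume.restrict (cube n E))
    (s := Metric.ball s₀ 1) (x₀ := s₀)
    (F := fun s z => |vandermonde z| ^ (2 * β) * (Real.exp ((s - s₀) * p z) * Q z) * ∏ k, ρ (z k))
    (F' := fun s z => |vandermonde z| ^ (2 * β) * (Real.exp ((s - s₀) * p z) * p z * Q z) *
      ∏ k, ρ (z k))
    (bound := fun z => Real.exp M * M * ‖|vandermonde z| ^ (2 * β) * Q z * ∏ k, ρ (z k)‖)
    (Metric.ball_mem_nhds _ one_pos)
    (Eventually.of_forall fun s => ((hmeas s).mul hw.aestronglyMeasurable).congr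
      (Eventually.of_forall fun z => by simp only [Pi.mul_apply]; ring))
    (hw.congr (Eventually.of_forall fun z => by simp))
    ((((hmeas s₀).mul (hp.1.aestronglyMeasurable hS)).mul hw.aestronglyMeasurable).congr
      (Eventually.of_forall fun z => by simp only [Pi.mul_apply]; ring))
    ((ae_restrict_iff' hS).2 (Eventually.of_forall fun z hz s hs => ?_))
    (hw.norm.const_mul _)
    (Eventually.of_forall fun z s _ => ?_)
  · simpa [ensembleIntegral] using h.2
  · have h1 := hexp s z hz (by simpa [Real.dist_eq] using (Metric.mem_ball.1 hs).le)
    rw [show |vandermonde z| ^ (2 * β) * (Real.exp ((s - s₀) * p z) * p z * Q z) *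
      ∏ k, ρ (z k) = Real.exp ((s - s₀) * p z) * p z *
        (|vandermonde z| ^ (2 * β) * Q z * ∏ k, ρ (z k)) by ring, norm_mul]
    gcongr
    rw [norm_mul, Real.norm_eq_abs, Real.abs_exp]
    exact mul_le_mul h1 (hM z hz) (abs_nonneg _) (Real.exp_pos _).le
  · have h1 : HasDerivAt (fun s => Real.exp ((s - s₀) * p z))
        (Real.exp ((s - s₀) * p z) * p z) s := by
      simpa using (((hasDerivAt_id s).sub_const s₀).mul_const (p z)).exp
    exact ((h1.mul_const (Q z)).const_mul _).mul_const _

end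

theorem dFun_of_eq {k : ℤ} {i : ℕ+} (h : k = (i : ℕ)) (Φ : (ℕ+ → ℝ) → ℝ) :
    dFun k Φ = pderivFun i Φ := by
  subst h
  have h0 : (0 : ℤ) < ((i : ℕ) : ℤ) := by exact_mod_cast i.pos
  rw [dFun, dif_pos h0]
  congr 1

theorem dFun_of_nonpos {k : ℤ} (h : k ≤ 0) (Φ : (ℕ+ → ℝ) → ℝ) : dFun k Φ = 0 :=
  dif_neg h.not_gt

theorem coordFun_of_nonpos {k : ℤ} (h : k ≤ 0) (t : ℕ+ → ℝ) : coordFun k t = 0 :=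
  dif_neg h.not_gt

theorem coordFun_one (t : ℕ+ → ℝ) : coordFun 1 t = t 1 := dif_pos one_pos

theorem JJ1Fun_of_pos (β : ℝ) (n : ℤ) {q : ℤ} (hq : 0 < q) (Φ : (ℕ+ → ℝ) → ℝ) (t : ℕ+ → ℝ) :
    JJ1Fun β n q Φ t = dFun q Φ t := by
  simp [JJ1Fun, J1Fun, coordFun_of_nonpos (k := -q) (by omega), hq.ne']

theorem JJ1Fun_zero (β : ℝ) (n : ℤ) (Φ : (ℕ+ → ℝ) → ℝ) (t : ℕ+ → ℝ) :
    JJ1Fun β n 0 Φ t = n * Φ t := by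
  simp [JJ1Fun, J1Fun, dFun_of_nonpos]

theorem JJ2Fun_neg_one {β : ℝ} (hβ : β ≠ 0) (n : ℤ) (Φ : (ℕ+ → ℝ) → ℝ) (t : ℕ+ → ℝ) :
    JJ2Fun β n (-1) Φ t =
      (∑' i : ℕ+, (i : ℝ) * t i * dFun (i + -1) Φ t) + n * t 1 * Φ t := by
  have h1 : Finset.Ioo (0 : ℤ) 1 = ∅ := by decide
  have h2 : Finset.Ioo (0 : ℤ) (-1) = ∅ := by decide
  simp only [JJ2Fun, J2Fun, J1Fun, neg_neg, h1, h2, Finset.sum_empty, dFun_of_nonpos (k := -1) (by simp),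
    coordFun_one]
  simp
  field_simp

theorem JJ2Fun_zero {β : ℝ} (hβ : β ≠ 0) (n : ℤ) (Φ : (ℕ+ → ℝ) → ℝ) (t : ℕ+ → ℝ) :
    JJ2Fun β n 0 Φ t =
      (∑' i : ℕ+, (i : ℝ) * t i * dFun (i + 0) Φ t) + n * (n * β + 1 - β) * Φ t := by
  simp [JJ2Fun, J2Fun, J1Fun, dFun_of_nonpos, hβ]

theorem JJ2Fun_of_pos {β : ℝ} (hβ : β ≠ 0) (n : ℤ) {q : ℤ} (hq : 0 < q) (Φ : (ℕ+ → ℝ) → ℝ)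
    (t : ℕ+ → ℝ) :
    JJ2Fun β n q Φ t = (∑' i : ℕ+, (i : ℝ) * t i * dFun (i + q) Φ t) +
      (β * (∑ i ∈ Finset.Ioo 0 q, dFun i (dFun (q - i) Φ) t) +
        (2 * n * β + (q + 1) * (1 - β)) * dFun q Φ t) := by
  have h : Finset.Ioo (0 : ℤ) (-q) = ∅ := Finset.Ioo_eq_empty (by omega)
  simp only [JJ2Fun, J2Fun, J1Fun, h, coordFun_of_nonpos (k := -q) (by omega), hq.ne', if_false,
    Finset.sum_empty]
  field_simp
  ring

/-! ### The integral over a bounded set as a function of `t` -/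

section

variable {n : ℕ} {β : ℝ} {ρ : ℝ → ℝ} {E : Set ℝ} {t : ℕ+ → ℝ} {R R' : ℝ}

/-- The extra factor `Q` makes the statement iterable: `Q = 1` gives first and `Q = p_j` second
derivatives. -/
theorem hasDerivAt_ensembleIntegral_update (hβ : 0 < β) (hm : HasMoments ρ E)
    (hE : MeasurableSet E) (h0 : 0 < R') (hR : R' < R) (hER : E ⊆ Metric.ball 0 R')
    (ht : Summable fun i : ℕ+ => |t i| * R ^ (i : ℕ)) {Q : (Fin n → ℝ) → ℝ}
    (hQ : Tame (cube n E) Q) (j : ℕ+) :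
    HasDerivAt (fun s => ensembleIntegral n β ρ E fun z =>
        Q z * expPotential (Function.update t j s) z)
      (ensembleIntegral n β ρ E fun z => psum j z * Q z * expPotential t z) (t j) := by
  have hsub : cube n E ⊆ cube n (Metric.ball 0 R') := Set.pi_mono fun _ _ => hER
  have h := hasDerivAt_ensembleIntegral_exp hβ hm hE (tame_psum j)
    (hQ.mul ((tame_expPotential h0 hR ht).mono hsub))
    (fun z hz => abs_psum_le j fun k => (abs_lt_of_mem_cube (hsub hz) k).le) (t j)
  simp only [← mul_assoc] at h
  refine h.congr_of_eventuallyEq (Eventually.of_forall fun s => ?_)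
  refine ensembleIntegral_congr hE fun z hz => ?_
  rw [expPotential_update ht j s fun k => ((abs_lt_of_mem_cube (hsub hz) k).trans hR).le]
  ring

theorem hasDerivAt_integral_update (hβ : 0 < β) (hm : HasMoments ρ E)
    (hE : MeasurableSet E) (h0 : 0 < R') (hR : R' < R) (hER : E ⊆ Metric.ball 0 R')
    (ht : Summable fun i : ℕ+ => |t i| * R ^ (i : ℕ)) (j : ℕ+) :
    HasDerivAt (fun s => integral n β ρ E (Function.update t j s))
      (ensembleIntegral n β ρ E fun z => psum j z * expPotential t z) (t j) := by
  have h := hasDerivAt_ensembleIntegral_update (n := n) hβ hm hE h0 hR hER ht (Tame.const 1) j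
  simpa only [one_mul, mul_one, ← integral_eq_ensembleIntegral] using h

theorem pderivFun_integral (hβ : 0 < β) (hm : HasMoments ρ E)
    (hE : MeasurableSet E) (h0 : 0 < R') (hR : R' < R) (hER : E ⊆ Metric.ball 0 R')
    (ht : Summable fun i : ℕ+ => |t i| * R ^ (i : ℕ)) (j : ℕ+) :
    pderivFun j (integral n β ρ E) t =
      ensembleIntegral n β ρ E fun z => psum j z * expPotential t z :=
  (hasDerivAt_integral_update hβ hm hE h0 hR hER ht j).deriv

theorem hasDerivAt_pderivFun_integral (hβ : 0 < β) (hm : HasMoments ρ E)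
    (hE : MeasurableSet E) (h0 : 0 < R') (hR : R' < R) (hER : E ⊆ Metric.ball 0 R')
    (ht : Summable fun i : ℕ+ => |t i| * R ^ (i : ℕ)) (i j : ℕ+) :
    HasDerivAt (fun s => pderivFun j (integral n β ρ E) (Function.update t i s))
      (ensembleIntegral n β ρ E fun z => psum i z * psum j z * expPotential t z) (t i) := by
  have h := hasDerivAt_ensembleIntegral_update (n := n) hβ hm hE h0 hR hER ht
    (tame_psum (j : ℕ)) i
  -- The formula for the first derivative is available at every updated point, because changing one
  -- coordinate preserves summability.
  simpa only [pderivFun_integral hβ hm hE h0 hR hER (summable_update ht i _) j] using h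

theorem dFun_integral (hβ : 0 < β) (hm : HasMoments ρ E)
    (hE : MeasurableSet E) (h0 : 0 < R') (hR : R' < R) (hER : E ⊆ Metric.ball 0 R')
    (ht : Summable fun i : ℕ+ => |t i| * R ^ (i : ℕ)) {k : ℤ} {a : ℕ} (h : k = a) (ha : 0 < a) :
    dFun k (integral n β ρ E) t =
      ensembleIntegral n β ρ E fun z => psum a z * expPotential t z := by
  lift a to ℕ+ using ha
  rw [dFun_of_eq h, pderivFun_integral hβ hm hE h0 hR hER ht]

theorem dFun_dFun_integral (hβ : 0 < β) (hm : HasMoments ρ E)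
    (hE : MeasurableSet E) (h0 : 0 < R') (hR : R' < R) (hER : E ⊆ Metric.ball 0 R')
    (ht : Summable fun i : ℕ+ => |t i| * R ^ (i : ℕ)) {k l : ℤ} {a b : ℕ} (h : k = a)
    (ha : 0 < a) (h' : l = b) (hb : 0 < b) :
    dFun k (dFun l (integral n β ρ E)) t =
      ensembleIntegral n β ρ E fun z => psum a z * psum b z * expPotential t z := by
  lift a to ℕ+ using ha
  lift b to ℕ+ using hb
  rw [dFun_of_eq h, dFun_of_eq h']
  exact (hasDerivAt_pderivFun_integral hβ hm hE h0 hR hER ht a b).deriv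

/-- Sum and integral are interchanged by absolute convergence: on `E` the power sum is at most `n
R'^{p+i-1}`, and `∑ i |t_i| R'^{i-1}` converges. -/
theorem hasSum_ensembleIntegral_psum (hβ : 0 < β) (hm : HasMoments ρ E)
    (hE : MeasurableSet E) (h0 : 0 < R') (hR : R' < R) (hER : E ⊆ Metric.ball 0 R')
    (ht : Summable fun i : ℕ+ => |t i| * R ^ (i : ℕ)) {Q : (Fin n → ℝ) → ℝ}
    (hQ : Tame (cube n E) Q) (p : ℕ) :
    HasSum (fun i : ℕ+ => (i : ℝ) * t i *
        ensembleIntegral n β ρ E fun z => psum (p + (i - 1)) z * Q z)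
      (ensembleIntegral n β ρ E fun z => ∑ k, z k ^ p * (potentialDeriv t (z k) * Q z)) := by
  have hS := measurableSet_cube (n := n) hE
  have hsub : cube n E ⊆ cube n (Metric.ball 0 R') := Set.pi_mono fun _ _ => hER
  have hw := hm.integrableOn hE ((tame_abs_vandermonde_rpow hβ).mul hQ)
  have hF : ∀ i : ℕ+, IntegrableOn (fun z => |vandermonde z| ^ (2 * β) *
      ((i : ℝ) * t i * (psum (p + (i - 1)) z * Q z)) * ∏ k, ρ (z k)) (cube n E) := fun i =>
    hm.integrableOn hE ((tame_abs_vandermonde_rpow hβ).mul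
      (((tame_psum _).mul hQ).const_mul _))
  have hle : ∀ i : ℕ+, ∫ z in cube n E, ‖|vandermonde z| ^ (2 * β) *
      ((i : ℝ) * t i * (psum (p + (i - 1)) z * Q z)) * ∏ k, ρ (z k)‖ ≤
      (i : ℝ) * |t i| * R' ^ ((i : ℕ) - 1) * (n * R' ^ p *
        ∫ z in cube n E, ‖|vandermonde z| ^ (2 * β) * Q z * ∏ k, ρ (z k)‖) := by
    intro i
    rw [← integral_const_mul, ← integral_const_mul]
    refine setIntegral_mono_on (hF i).norm ((hw.norm.const_mul _).const_mul _) hS fun z hz => ?_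
    have h1 := abs_psum_le (p + ((i : ℕ) - 1)) fun k => (abs_lt_of_mem_cube (hsub hz) k).le
    rw [show |vandermonde z| ^ (2 * β) * ((i : ℝ) * t i * (psum (p + (i - 1)) z * Q z)) *
        ∏ k, ρ (z k) = (i : ℝ) * t i * psum (p + (i - 1)) z *
          (|vandermonde z| ^ (2 * β) * Q z * ∏ k, ρ (z k)) by ring, norm_mul, ← mul_assoc]
    refine mul_le_mul_of_nonneg_right ?_ (norm_nonneg _)
    rw [norm_mul, norm_mul, Real.norm_natCast, Real.norm_eq_abs, Real.norm_eq_abs]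
    refine (mul_le_mul_of_nonneg_left h1 (by positivity)).trans_eq ?_
    rw [pow_add]
    ring
  have h := hasSum_integral_of_summable_integral_norm (μ := volume.restrict (cube n E)) hF
    (((summable_deriv_bound h0 hR ht).mul_right _).of_nonneg_of_le
      (fun i => integral_nonneg fun z => norm_nonneg _) hle)
  have h1 : ∫ z in cube n E, ∑' i : ℕ+, |vandermonde z| ^ (2 * β) *
      ((i : ℝ) * t i * (psum (p + (i - 1)) z * Q z)) * ∏ k, ρ (z k) =
      ensembleIntegral n β ρ E fun z => ∑ k, z k ^ p * (potentialDeriv t (z k) * Q z) := by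
    refine setIntegral_congr_fun hS fun z hz => ?_
    have h2 := (((hasSum_psum h0 hR ht p fun k =>
      (abs_lt_of_mem_cube (hsub hz) k).le).mul_right (Q z)).mul_left
        (|vandermonde z| ^ (2 * β))).mul_right (∏ k, ρ (z k))
    simp only [← mul_assoc, Finset.sum_mul] at h2 ⊢
    exact h2.tsum_eq
  rw [h1] at h
  refine h.congr_fun fun i => ?_
  rw [← ensembleIntegral_const_mul]
  rfl

/-- The subtracted term is the same exception as in the formal case: for `p = 0`, `i = 1` the
integral side contains `p_0 = n`, whereas `∂/∂t_0` is zero. -/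
theorem hasSum_dFun_integral (hβ : 0 < β) (hm : HasMoments ρ E)
    (hE : MeasurableSet E) (h0 : 0 < R') (hR : R' < R) (hER : E ⊆ Metric.ball 0 R')
    (ht : Summable fun i : ℕ+ => |t i| * R ^ (i : ℕ)) (p : ℕ) :
    HasSum (fun i : ℕ+ => (i : ℝ) * t i * dFun (i + (p - 1)) (integral n β ρ E) t)
      ((ensembleIntegral n β ρ E fun z =>
        ∑ k, z k ^ p * (potentialDeriv t (z k) * expPotential t z)) -
          if p = 0 then n * t 1 * integral n β ρ E t else 0) := by
  have hsub : cube n E ⊆ cube n (Metric.ball 0 R') := Set.pi_mono fun _ _ => hER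
  have h := (hasSum_ensembleIntegral_psum hβ hm hE h0 hR hER ht
    ((tame_expPotential (n := n) h0 hR ht).mono hsub) p).sub (hasSum_ite_eq (1 : ℕ+)
      (if p = 0 then n * t 1 * integral n β ρ E t else 0))
  refine h.congr_fun fun i => ?_
  by_cases hp : 0 < p + ((i : ℕ) - 1)
  · have hi := i.pos
    rw [dFun_integral hβ hm hE h0 hR hER ht (a := p + ((i : ℕ) - 1)) (by omega) hp]
    by_cases h1 : i = 1
    · subst h1
      have : p ≠ 0 := by simpa [Nat.pos_iff_ne_zero] using hp
      simp [this]
    · simp [h1]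
  · obtain rfl : p = 0 := by omega
    obtain rfl : i = 1 := PNat.eq (by have := i.pos; simp only [PNat.one_coe]; omega)
    rw [dFun_of_nonpos (by simp)]
    simp [psum_zero, ensembleIntegral_const_mul, integral_eq_ensembleIntegral]
    ring

theorem JJ1Fun_integral (hβ : 0 < β) (hm : HasMoments ρ E)
    (hE : MeasurableSet E) (h0 : 0 < R') (hR : R' < R) (hER : E ⊆ Metric.ball 0 R')
    (ht : Summable fun i : ℕ+ => |t i| * R ^ (i : ℕ)) (q : ℕ) :
    JJ1Fun β n q (integral n β ρ E) t =
      ensembleIntegral n β ρ E fun z => psum q z * expPotential t z := by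
  rcases Nat.eq_zero_or_pos q with rfl | hq
  · simp [JJ1Fun_zero, psum_zero, ensembleIntegral_const_mul, integral_eq_ensembleIntegral]
  · rw [JJ1Fun_of_pos _ _ (by exact_mod_cast hq), dFun_integral hβ hm hE h0 hR hER ht rfl hq]

theorem JJ2Fun_integral (hβ : 0 < β) (hm : HasMoments ρ E)
    (hE : MeasurableSet E) (h0 : 0 < R') (hR : R' < R) (hER : E ⊆ Metric.ball 0 R')
    (ht : Summable fun i : ℕ+ => |t i| * R ^ (i : ℕ)) (p : ℕ) :
    JJ2Fun β n (p - 1) (integral n β ρ E) t = ensembleIntegral n β ρ E fun z =>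
      (∑ k, z k ^ p * (potentialDeriv t (z k) * expPotential t z)) +
        loopSymbol β p z * expPotential t z := by
  have hsub : cube n E ⊆ cube n (Metric.ball 0 R') := Set.pi_mono fun _ _ => hER
  have hΨ := (tame_expPotential (n := n) h0 hR ht).mono hsub
  rw [ensembleIntegral_add hβ hm hE (Tame.sum _ fun k _ => ((Tame.coord k).pow p).mul
    (((tame_potentialDeriv h0 hR ht k).mono hsub).mul hΨ)) ((tame_loopSymbol β p).mul hΨ)]
  have hsum := (hasSum_dFun_integral (n := n) hβ hm hE h0 hR hER ht p).tsum_eq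
  rcases p with _ | _ | q
  · simp only [Nat.cast_zero, zero_sub, if_true] at hsum ⊢
    rw [JJ2Fun_neg_one hβ.ne', hsum]
    simp [loopSymbol_zero, ensembleIntegral]
  · simp only [zero_add, Nat.cast_one, sub_self, one_ne_zero, if_false, sub_zero] at hsum ⊢
    rw [JJ2Fun_zero hβ.ne', hsum]
    simp only [loopSymbol_one, ensembleIntegral_const_mul, integral_eq_ensembleIntegral]
    simp
  · obtain ⟨q', hq⟩ : ∃ q' : ℕ+, (q' : ℕ) = q + 1 := ⟨⟨q + 1, q.succ_pos⟩, rfl⟩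
    have h1 : (((q + 1 + 1 : ℕ) : ℤ) - 1) = (q' : ℕ) := by omega
    have hT : ∀ i ∈ Finset.Ioo 0 (q' : ℕ), Tame (cube n E) fun z =>
        psum i z * psum (q' - i) z * expPotential t z := fun i _ =>
      ((tame_psum i).mul (tame_psum _)).mul hΨ
    have hT' : Tame (cube n E) fun z => psum q' z * expPotential t z := (tame_psum _).mul hΨ
    have h2 : ∑ i ∈ Finset.Ioo (0 : ℤ) (q' : ℕ),
          dFun i (dFun ((q' : ℕ) - i) (integral n β ρ E)) t =
        ∑ i ∈ Finset.Ioo 0 (q' : ℕ), ensembleIntegral n β ρ E (fun z =>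
            psum i z * psum (q' - i) z * expPotential t z) := by
      rw [sum_Ioo_intCast]
      refine Finset.sum_congr rfl fun i hi => ?_
      rw [Finset.mem_Ioo] at hi
      exact dFun_dFun_integral hβ hm hE h0 hR hER ht rfl hi.1 (by omega) (by omega)
    rw [h1] at hsum ⊢
    rw [JJ2Fun_of_pos hβ.ne' _ (by exact_mod_cast q'.pos), hsum, if_neg (by omega), sub_zero, h2,
      dFun_integral hβ hm hE h0 hR hER ht rfl q'.pos, ← ensembleIntegral_sum hβ hm hE _ hT,
      ← ensembleIntegral_const_mul, ← ensembleIntegral_const_mul,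
      ← ensembleIntegral_add hβ hm hE ((Tame.sum _ hT).const_mul _) (hT'.const_mul _)]
    congr 2 with z
    rw [← hq, loopSymbol_succ, ← Finset.sum_mul]
    push_cast
    ring

theorem virasoroFun_integral (hβ : 0 < β) (hm : HasMoments ρ E)
    (hE : MeasurableSet E) (h0 : 0 < R') (hR : R' < R) (hER : E ⊆ Metric.ball 0 R')
    (ht : Summable fun i : ℕ+ => |t i| * R ^ (i : ℕ)) (f g : Polynomial ℝ) {k : ℤ}
    (hk : -1 ≤ k) :
    virasoroFun f g β n k (integral n β ρ E) t =
      (f.sum fun i a => a * ensembleIntegral n β ρ E fun z =>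
          (∑ l, z l ^ ((k + 1).toNat + i) * (potentialDeriv t (z l) * expPotential t z)) +
            loopSymbol β ((k + 1).toNat + i) z * expPotential t z) -
        (g.sum fun i b => b * ensembleIntegral n β ρ E fun z =>
          psum ((k + 1).toNat + i) z * expPotential t z) := by
  simp only [virasoroFun, Polynomial.sum]
  congr 1
  · refine Finset.sum_congr rfl fun i _ => ?_
    rw [← JJ2Fun_integral hβ hm hE h0 hR hER ht, show k + (i : ℤ) =
      (((k + 1).toNat + i : ℕ) : ℤ) - 1 by push_cast; omega]
  · refine Finset.sum_congr rfl fun i _ => ?_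
    rw [← JJ1Fun_integral hβ hm hE h0 hR hER ht, show k + (i : ℤ) + 1 =
      (((k + 1).toNat + i : ℕ) : ℤ) by push_cast; omega]

end

/-! ### Constant functions -/

theorem pderivFun_const (i : ℕ+) (a : ℝ) : pderivFun i (fun _ => a) = 0 := by
  funext t
  exact deriv_const _ _

theorem dFun_const (k : ℤ) (a : ℝ) : dFun k (fun _ => a) = 0 := by
  rw [dFun]
  split_ifs
  · exact pderivFun_const _ a
  · rfl

/-- For indices at least `-1`, every term that does not differentiate carries a factor `n`. -/
theorem virasoroFun_const {β : ℝ} (hβ : β ≠ 0) {n : ℤ} {a : ℝ} (h : n * a = 0)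
    (f g : Polynomial ℝ) {k : ℤ} (hk : -1 ≤ k) (t : ℕ+ → ℝ) :
    virasoroFun f g β n k (fun _ => a) t = 0 := by
  have hd : ∀ k, dFun k 0 = 0 := fun k => dFun_const k 0
  have h1 : ∀ q : ℤ, 0 ≤ q → JJ1Fun β n q (fun _ => a) t = 0 := fun q hq => by
    rcases hq.eq_or_lt with rfl | hq
    · rw [JJ1Fun_zero, h]
    · simp [JJ1Fun_of_pos _ _ hq, dFun_const]
  have h2 : ∀ q : ℤ, -1 ≤ q → JJ2Fun β n q (fun _ => a) t = 0 := fun q hq => by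
    obtain rfl | rfl | hq : q = -1 ∨ q = 0 ∨ 0 < q := by omega
    · rw [JJ2Fun_neg_one hβ, mul_right_comm, h]
      simp [dFun_const]
    · rw [JJ2Fun_zero hβ, mul_right_comm, h]
      simp [dFun_const]
    · simp [JJ2Fun_of_pos hβ _ hq, dFun_const, hd]
  rw [virasoroFun, Polynomial.sum, Polynomial.sum, Finset.sum_eq_zero, Finset.sum_eq_zero, sub_zero]
  · exact fun i _ => by rw [h1 _ (by omega), mul_zero]
  · exact fun i _ => by rw [h2 _ (by omega), mul_zero]

/-! ### The Virasoro constraints for the functions of `t` -/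

/-- A bounded `E` is compact, so the maximum of `|z|` on it is still below `R`. This gap is what
differentiating the potential and moving the end points require; `r > 0` makes `E` nonempty, which
yields `R' > 0`. -/
theorem exists_radius {r : ℕ} (hr : 0 < r) {c : Fin (2 * r) → EReal} (hc : StrictMono c) {R : ℝ}
    (hR : ∀ z ∈ intervals c, |z| < R) :
    ∃ R', 0 < R' ∧ R' < R ∧ intervals c ⊆ Metric.ball 0 R' := by
  have hclosed : IsClosed (intervals c) := isClosed_iUnion_of_finite fun i =>
    (isClosed_Icc.preimage continuous_coe_real_ereal :)
  have hcpt : IsCompact (intervals c) := Metric.isCompact_of_isClosed_isBounded hclosed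
    ((Metric.isBounded_ball (x := (0 : ℝ)) (r := R)).subset fun z hz => by simpa using hR z hz)
  have hne : (intervals c).Nonempty := by
    have h : c ⟨2 * (⟨0, hr⟩ : Fin r), by omega⟩ < c ⟨2 * (⟨0, hr⟩ : Fin r) + 1, by omega⟩ :=
      hc (by simp)
    obtain ⟨z, hz, hz'⟩ := EReal.lt_iff_exists_real_btwn.1 h
    exact ⟨z, Set.mem_iUnion.2 ⟨⟨0, hr⟩, hz.le, hz'.le⟩⟩
  obtain ⟨x, hx, hmax⟩ := hcpt.exists_isMaxOn hne continuous_abs.continuousOn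
  obtain ⟨R', h1, h2⟩ := exists_between (hR x hx)
  exact ⟨R', (abs_nonneg x).trans_lt h1, h2, fun z hz => by simpa using (hmax hz).trans_lt h1⟩

theorem integral_virasoro_of_pos {β : ℝ} (hβ : 0 < β) {A B : EReal} {ρ : ℝ → ℝ}
    {f g : Polynomial ℝ} (hw : IsRationalWeight A B ρ f g) {r : ℕ} (hr : 0 < r)
    {c : Fin (2 * r) → EReal} (hc : StrictMono c) (hEF : intervals c ⊆ range A B)
    (hρ : IntegrableOn ρ (intervals c)) (n : ℕ) {t : ℕ+ → ℝ} {R : ℝ}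
    (hR : ∀ z ∈ intervals c, |z| < R) (ht : Summable fun i : ℕ+ => |t i| * R ^ (i : ℕ)) :
    (∀ i : ℕ+, HasPDeriv i (integral n β ρ (intervals c)) t) ∧
    (∀ i j : ℕ+, HasPDeriv i (pderivFun j (integral n β ρ (intervals c))) t) ∧
    (∀ k : ℤ, -1 ≤ k → Summable fun i : ℕ+ =>
      (i : ℝ) * t i * dFun (i + k) (integral n β ρ (intervals c)) t) ∧
    (∀ j ∈ finiteEnds c, f.eval (c j).toReal ≠ 0 →
      HasEndDeriv j (fun c' => integral n β ρ (intervals c') t) c) ∧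
    ∀ k : ℤ, -1 ≤ k → -boundaryOp f k (fun c' => integral n β ρ (intervals c') t) c +
      virasoroFun f g β n k (integral n β ρ (intervals c)) t = 0 := by
  obtain ⟨R', h0, hRR, hER⟩ := exists_radius hr hc hR
  have hE := measurableSet_intervals c
  have hm := hw.hasMoments hE hEF hρ
  obtain ⟨L, hL, hL'⟩ := exists_end_derivatives hβ hw hc hEF hρ Metric.isOpen_ball hER
    (tame_expPotential (n := n) h0 hRR ht)
    (fun k => (tame_potentialDeriv h0 hRR ht k).mul (tame_expPotential h0 hRR ht))
    fun k z hz => hasDerivAt_expPotential h0 hRR ht k hz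
  simp only [← integral_eq_ensembleIntegral] at hL
  refine ⟨fun i => (hasDerivAt_integral_update hβ hm hE h0 hRR hER ht i).differentiableAt,
    fun i j => (hasDerivAt_pderivFun_integral hβ hm hE h0 hRR hER ht i j).differentiableAt,
    fun k hk => ?_, fun j hj hf => (hL j hj hf).differentiableAt, fun k hk => ?_⟩
  · have h := (hasSum_dFun_integral (n := n) hβ hm hE h0 hRR hER ht (k + 1).toNat).summable
    rwa [show (((k + 1).toNat : ℕ) : ℤ) - 1 = k by omega] at h
  · rw [boundaryOp_eq f hk hL, virasoroFun_integral hβ hm hE h0 hRR hER ht f g hk,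
      hL' (k + 1).toNat, neg_add_cancel]

theorem integral_eq_const_of_isEmpty (n : ℕ) (β : ℝ) (ρ : ℝ → ℝ) (c : Fin (2 * 0) → EReal) :
    ∃ a : ℝ, ((n : ℤ) : ℝ) * a = 0 ∧ integral n β ρ (intervals c) = fun _ => a := by
  rcases n with _ | n
  · exact ⟨integral 0 β ρ (intervals c) 0, by simp, by funext t; simp [integral]⟩
  · refine ⟨0, mul_zero _, ?_⟩
    funext t
    have h : (Set.univ.pi fun _ : Fin (n + 1) => intervals c) = ∅ := by
      rw [Set.univ_pi_eq_empty_iff]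
      exact ⟨0, by simp [intervals]⟩
    rw [integral, h]
    simp

/-- The Virasoro constraints at the points `t` where `∑ t_i z^i` converges near `E`. -/
theorem integral_virasoro {β : ℝ} (hβ : 0 < β) {A B : EReal} {ρ : ℝ → ℝ}
    {f g : Polynomial ℝ} (hw : IsRationalWeight A B ρ f g) {r : ℕ}
    {c : Fin (2 * r) → EReal} (hc : StrictMono c) (hEF : intervals c ⊆ range A B)
    (hρ : IntegrableOn ρ (intervals c)) (n : ℕ) {t : ℕ+ → ℝ} {R : ℝ}
    (hR : ∀ z ∈ intervals c, |z| < R) (ht : Summable fun i : ℕ+ => |t i| * R ^ (i : ℕ)) :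
    (∀ i : ℕ+, HasPDeriv i (integral n β ρ (intervals c)) t) ∧
    (∀ i j : ℕ+, HasPDeriv i (pderivFun j (integral n β ρ (intervals c))) t) ∧
    (∀ k : ℤ, -1 ≤ k → Summable fun i : ℕ+ =>
      (i : ℝ) * t i * dFun (i + k) (integral n β ρ (intervals c)) t) ∧
    (∀ j ∈ finiteEnds c, f.eval (c j).toReal ≠ 0 →
      HasEndDeriv j (fun c' => integral n β ρ (intervals c') t) c) ∧
    ∀ k : ℤ, -1 ≤ k → -boundaryOp f k (fun c' => integral n β ρ (intervals c') t) c +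
      virasoroFun f g β n k (integral n β ρ (intervals c)) t = 0 := by
  rcases Nat.eq_zero_or_pos r with rfl | hr
  -- For `r = 0` the bound by `R` is vacuous and there may be no positive radius of convergence.
  -- Here `E` is empty, so the integral is independent of `t`, and it is zero unless `n = 0`.
  · obtain ⟨a, ha, h⟩ := integral_eq_const_of_isEmpty n β ρ c
    refine ⟨fun i => ?_, fun i j => ?_, fun k _ => ?_, fun j => j.elim0, fun k hk => ?_⟩
    · rw [HasPDeriv, h]
      exact differentiableAt_const _
    · rw [HasPDeriv, h, pderivFun_const]
      exact differentiableAt_const _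
    · simp only [h, dFun_const, Pi.zero_apply, mul_zero]
      exact summable_zero
    · rw [h, virasoroFun_const hβ.ne' ha f g hk, boundaryOp,
        Finset.sum_eq_zero fun j => j.elim0]
      simp
  · exact integral_virasoro_of_pos hβ hw hr hc hEF hρ n hR ht

end BetaVirasoro

theorem mainTheorem8 (β : ℝ) (hβ : 0 < β) :
    -- The Virasoro constraints for the integrals `I_n`.
    (∀ (A B : EReal) (ρ : ℝ → ℝ) (f g : Polynomial ℝ),
      BetaVirasoro.IsRationalWeight A B ρ f g →
      ∀ (r : ℕ) (c : Fin (2 * r) → EReal), StrictMono c →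
      BetaVirasoro.intervals c ⊆ BetaVirasoro.range A B →
      IntegrableOn ρ (BetaVirasoro.intervals c) →
      ∀ n : ℕ,
      -- As an identity of formal power series in `t`.
      ((∀ (m : ℕ+ →₀ ℕ) (j : Fin (2 * r)), j ∈ BetaVirasoro.finiteEnds c →
          f.eval (c j).toReal ≠ 0 →
          BetaVirasoro.HasEndDeriv j (fun c' => MvPowerSeries.coeff m
            (BetaVirasoro.formalIntegral n β ρ (BetaVirasoro.intervals c'))) c) ∧
        (∀ k : ℤ, -1 ≤ k → ∀ m : ℕ+ →₀ ℕ,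
          -BetaVirasoro.boundaryOp f k (fun c' => MvPowerSeries.coeff m
              (BetaVirasoro.formalIntegral n β ρ (BetaVirasoro.intervals c'))) c +
            MvPowerSeries.coeff m (BetaVirasoro.virasoroOp f g β n k
              (BetaVirasoro.formalIntegral n β ρ (BetaVirasoro.intervals c))) = 0) ∧
        (BetaVirasoro.intervals c = BetaVirasoro.range A B → ∀ k : ℤ, -1 ≤ k →
          BetaVirasoro.virasoroOp f g β n k
            (BetaVirasoro.formalIntegral n β ρ (BetaVirasoro.intervals c)) = 0)) ∧
      -- As an identity of functions, wherever `∑ t_i z^i` converges on a neighbourhood of `E`.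
      (∀ (t : ℕ+ → ℝ) (R : ℝ), (∀ z ∈ BetaVirasoro.intervals c, |z| < R) →
        Summable (fun i : ℕ+ => |t i| * R ^ (i : ℕ)) →
        (∀ i : ℕ+, BetaVirasoro.HasPDeriv i
          (BetaVirasoro.integral n β ρ (BetaVirasoro.intervals c)) t) ∧
        (∀ i j : ℕ+, BetaVirasoro.HasPDeriv i (BetaVirasoro.pderivFun j
          (BetaVirasoro.integral n β ρ (BetaVirasoro.intervals c))) t) ∧
        (∀ k : ℤ, -1 ≤ k → Summable (fun i : ℕ+ => (i : ℝ) * t i * BetaVirasoro.dFun (i + k)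
          (BetaVirasoro.integral n β ρ (BetaVirasoro.intervals c)) t)) ∧
        (∀ j : Fin (2 * r), j ∈ BetaVirasoro.finiteEnds c → f.eval (c j).toReal ≠ 0 →
          BetaVirasoro.HasEndDeriv j
            (fun c' => BetaVirasoro.integral n β ρ (BetaVirasoro.intervals c') t) c) ∧
        (∀ k : ℤ, -1 ≤ k →
          -BetaVirasoro.boundaryOp f k
              (fun c' => BetaVirasoro.integral n β ρ (BetaVirasoro.intervals c') t) c +
            BetaVirasoro.virasoroFun f g β n k
              (BetaVirasoro.integral n β ρ (BetaVirasoro.intervals c)) t = 0) ∧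
        (BetaVirasoro.intervals c = BetaVirasoro.range A B → ∀ k : ℤ, -1 ≤ k →
          BetaVirasoro.virasoroFun f g β n k
            (BetaVirasoro.integral n β ρ (BetaVirasoro.intervals c)) t = 0))) ∧
    -- The Virasoro and Heisenberg relations.
    (∀ n k l : ℤ,
      ⁅BetaVirasoro.JJ2 β n k, BetaVirasoro.JJ2 β n l⁆ =
          ((k : ℝ) - l) • BetaVirasoro.JJ2 β n (k + l) +
            (if k = -l then (1 - 6 * (β ^ (1 / 2 : ℝ) - β ^ (-1 / 2 : ℝ)) ^ 2) *
              (((k : ℝ) ^ 3 - k) / 12) else 0) • (1 : Module.End ℝ BetaVirasoro.TSeries) ∧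
      ⁅BetaVirasoro.JJ2 β n k, BetaVirasoro.JJ1 β n l⁆ =
          (-(l : ℝ)) • BetaVirasoro.JJ1 β n (k + l) +
            (if k = -l then (1 / 2 * (1 / β - 1)) * ((k : ℝ) * (k + 1)) else 0) •
              (1 : Module.End ℝ BetaVirasoro.TSeries) ∧
      ⁅BetaVirasoro.JJ1 β n k, BetaVirasoro.JJ1 β n l⁆ =
          (if k = -l then (k : ℝ) / (2 * β) else 0) •
            (1 : Module.End ℝ BetaVirasoro.TSeries)) := by
  refine ⟨fun A B ρ f g hw r c hc hEF hρ n => ⟨⟨fun m j hj hf => ?_, fun k hk m => ?_,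
    fun h k hk => ?_⟩, fun t R hR ht => ?_⟩, fun n k l =>
      ⟨BetaVirasoro.virasoro_relations hβ n k l,
        BetaVirasoro.virasoro_heisenberg_relations hβ.ne' n k l,
        BetaVirasoro.heisenberg_relations n k l⟩⟩
  · exact (BetaVirasoro.formalIntegral_virasoro hβ hw hc hEF hρ n m).1 j hj hf
  · exact (BetaVirasoro.formalIntegral_virasoro hβ hw hc hEF hρ n m).2 k hk
  · ext m
    have h1 := (BetaVirasoro.formalIntegral_virasoro hβ hw hc hEF hρ n m).2 k hk
    rwa [BetaVirasoro.boundaryOp_eq_zero hw hc h, neg_zero, zero_add] at h1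
  · obtain ⟨h1, h2, h3, h4, h5⟩ := BetaVirasoro.integral_virasoro hβ hw hc hEF hρ n hR ht
    refine ⟨h1, h2, h3, h4, h5, fun h k hk => ?_⟩
    have h6 := h5 k hk
    rwa [BetaVirasoro.boundaryOp_eq_zero hw hc h, neg_zero, zero_add] at h6
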